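/- Let $T=(\mathbb{C}^*)^r$ be an algebraic torus and let $X$ be an irreducible complex affine variety of dimension $n\ge 1$ with an algebraic action of $T$. Let $x_0\in X$ be an attractive fixed point, that is, $x_0$ is fixed by $T$ and there are a one-parameter subgroup $\lambda:\mathbb{C}^*\to T$ and a neighborhood $U$ of $x_0$ with $\lim_{t\to 0}\lambda(t)\cdot y=x_0$ for all $y\in U$. Suppose that $(X,x_0)$ is a rational cell, i.e. $X$ is rationally smooth at $x_0$: for all $y$ in some neighborhood of $x_0$ in the complex topology, $$H^m(X,X-\{y\};\mathbb{Q})=0\ \text{ for } m\neq 2n,\qquad H^{2n}(X,X-\{y\};\mathbb{Q})\cong\mathbb{Q}.$$ Let $X^+$ be the one-point compactification of $X$ (with its complex topology). Then $X^+$ is simply connected and has the rational homotopy type of the Euclidean sphere $S^{2n}$: the spaces $X^+$ and $S^{2n}$ are joined by a finite zigzag of continuous maps between simply connected spaces, each of which induces an isomorphism on $H^*(-;\mathbb{Q})$. In particular $H^m(X^+;\mathbb{Q})\cong H^m(S^{2n};\mathbb{Q})$ for all $m\ge 0$. -/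

import Mathlib

open CategoryTheory Topology

noncomputable section

namespace RationalCell

/-! ### Singular cohomology with rational coefficients -/

/-- The singular chain complex `C_*(Y; ℚ)` of a topological space, as a functor. -/
def chains : TopCat.{0} ⥤ ChainComplex (ModuleCat.{0} ℚ) ℕ :=
  (AlgebraicTopology.singularChainComplexFunctor (ModuleCat.{0} ℚ)).obj (ModuleCat.of ℚ ℚ)

/-- The `ℚ`-linear dual of a chain complex: in degree `m` the module `Hom(C_m, ℚ)`,
with differential the transpose of that of `C`. -/
def dual : (ChainComplex (ModuleCat.{0} ℚ) ℕ)ᵒᵖ ⥤ CochainComplex (ModuleCat.{0} ℚ) ℕ :=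
  ((((linearYoneda ℚ (ModuleCat.{0} ℚ)).obj (ModuleCat.of ℚ ℚ)).rightOp.mapHomologicalComplex
    (ComplexShape.down ℕ)).op) ⋙
    HomologicalComplex.unopFunctor (ModuleCat.{0} ℚ) (ComplexShape.down ℕ)

/-- Singular cohomology `H^m(-; ℚ)`, as a contravariant functor on topological spaces. -/
def cohomology (m : ℕ) : TopCat.{0}ᵒᵖ ⥤ ModuleCat.{0} ℚ :=
  chains.op ⋙ dual ⋙ HomologicalComplex.homologyFunctor _ _ m

/-- Relative singular cohomology `H^m(Y, A; ℚ)` of a subspace `A` of a topological space `Y`: the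
cohomology of the dual of `C_*(Y; ℚ) / C_*(A; ℚ)`. -/
def relativeCohomology (Y : Type) [TopologicalSpace Y] (A : Set Y) (m : ℕ) : ModuleCat.{0} ℚ :=
  (dual.obj (Opposite.op (Limits.cokernel
    (chains.map (TopCat.ofHom (⟨Subtype.val, continuous_subtype_val⟩ : C(A, Y))))))).homology m

/-! ### Rational homotopy type -/

/-- There is a rational homotopy equivalence `Y ⟶ Z`: both spaces are simply connected, and some
continuous map `Y ⟶ Z` induces isomorphisms on rational cohomology in all degrees. -/
def HasRationalEquivalence (Y Z : TopCat.{0}) : Prop :=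
  SimplyConnectedSpace Y ∧ SimplyConnectedSpace Z ∧
    ∃ f : Y ⟶ Z, ∀ m : ℕ, IsIso ((cohomology m).map f.op)

/-- Two simply connected spaces have the same rational homotopy type if they are joined by a finite
chain `Y ← Y₁ → Y₂ ← ⋯ → Z` of rational homotopy equivalences of simply connected spaces. -/
def SameRationalHomotopyType (Y Z : TopCat.{0}) : Prop :=
  SimplyConnectedSpace Y ∧ SimplyConnectedSpace Z ∧ Relation.EqvGen HasRationalEquivalence Y Z

/-! ### Affine varieties with a torus action

A subset `X` of `ℂ^N` carries the subspace topology of the standard topology of `ℂ^N`, which for an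
affine variety is its complex topology. The torus of rank `r` is `(ℂˣ)^r = (Fin r → ℂˣ)`. -/

/-- `X ⊆ ℂ^N` is an irreducible affine variety: it is Zariski closed and its ideal is prime. -/
structure IsIrreducibleAffineVariety {N : ℕ} (X : Set (Fin N → ℂ)) : Prop where
  isClosed : ∃ I : Ideal (MvPolynomial (Fin N) ℂ), X = MvPolynomial.zeroLocus ℂ I
  isPrime : (MvPolynomial.vanishingIdeal ℂ X).IsPrime

/-- The dimension of an affine variety: the Krull dimension of its coordinate ring. -/
def dimension {N : ℕ} (X : Set (Fin N → ℂ)) : WithBot ℕ∞ :=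
  ringKrullDim (MvPolynomial (Fin N) ℂ ⧸ MvPolynomial.vanishingIdeal ℂ X)

/-- An action of the torus `(ℂˣ)^r` on `X ⊆ ℂ^N` is algebraic if the action map is a morphism of
varieties, i.e. each coordinate of `t • x` is a polynomial in the coordinates `t_j`, their inverses
`t_j⁻¹` and the coordinates of `x`. -/
def IsAlgebraicAction {N : ℕ} (r : ℕ) (X : Set (Fin N → ℂ)) [MulAction (Fin r → ℂˣ) X] : Prop :=
  ∀ i : Fin N, ∃ P : MvPolynomial ((Fin r ⊕ Fin r) ⊕ Fin N) ℂ, ∀ (t : Fin r → ℂˣ) (x : X),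
    (t • x : X).1 i = MvPolynomial.eval
      (Sum.elim (Sum.elim (fun j => (t j : ℂ)) (fun j => ((t j)⁻¹ : ℂˣ).val)) x.1) P

/-- The one-parameter subgroup `t ↦ (t^{a_1}, …, t^{a_r})` of `(ℂˣ)^r` with exponents `a ∈ ℤ^r`;
these are all the one-parameter subgroups of the torus. -/
def oneParameterSubgroup {r : ℕ} (a : Fin r → ℤ) : ℂˣ →* (Fin r → ℂˣ) :=
  MonoidHom.mk' (fun t j => t ^ a j) fun s t => by
    funext j
    exact mul_zpow s t (a j)

/-- `x` is an attractive fixed point: it is fixed by the torus, and for some one-parameter subgroup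
`μ` we have `lim_{t → 0} μ(t) • y = x` for all `y` in a neighborhood of `x`. -/
def IsAttractiveFixedPoint {N : ℕ} (r : ℕ) (X : Set (Fin N → ℂ)) [MulAction (Fin r → ℂˣ) X]
    (x : X) : Prop :=
  (∀ t : Fin r → ℂˣ, t • x = x) ∧
    ∃ a : Fin r → ℤ, ∀ᶠ y in 𝓝 x,
      Filter.Tendsto (fun t : ℂˣ => oneParameterSubgroup a t • y)
        (Filter.comap (fun t : ℂˣ => (t : ℂ)) (𝓝 0)) (𝓝 x)

/-- A space `Y` (a variety of complex dimension `n` in its complex topology) is rationally smooth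
at `x`: for all `y` near `x`, `H^m(Y, Y - {y}; ℚ)` is `ℚ` for `m = 2n` and zero for `m ≠ 2n`. -/
def IsRationallySmoothAt (Y : Type) [TopologicalSpace Y] (n : ℕ) (x : Y) : Prop :=
  ∀ᶠ y in 𝓝 x,
    (∀ m : ℕ, m ≠ 2 * n → Subsingleton (relativeCohomology Y {y}ᶜ m)) ∧
      Nonempty (relativeCohomology Y {y}ᶜ (2 * n) ≃ₗ[ℚ] ℚ)

/-- `(X, x₀)` is a rational cell of dimension `n` for the given action of the torus `(ℂˣ)^r`. -/
structure IsRationalCell {N : ℕ} (r : ℕ) (X : Set (Fin N → ℂ)) [MulAction (Fin r → ℂˣ) X]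
    (x₀ : X) (n : ℕ) : Prop where
  irreducible : IsIrreducibleAffineVariety X
  dimension_eq : dimension X = n
  algebraic : IsAlgebraicAction r X
  attractive : IsAttractiveFixedPoint r X x₀
  rationallySmooth : IsRationallySmoothAt X n x₀

/-- The Euclidean sphere `S^d`, the unit sphere of `ℝ^{d+1}`. -/
def sphere (d : ℕ) : TopCat.{0} :=
  TopCat.of (Metric.sphere (0 : EuclideanSpace ℝ (Fin (d + 1))) 1)

end RationalCell

end

noncomputable section

namespace RationalCell

/-! An attracting one-parameter subgroup makes `X` a cone with vertex `x₀`. The coordinates of `t •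
x` are Laurent polynomials in `t` with regular coefficients. The limits near `x₀`, together with the
fact that a regular function vanishing near a point of an irreducible variety is zero
(`eq_zero_of_eventually`), leave only positive weights besides the constant term `x₀`. Hence real `t
≥ 0` acts on `X`, and a weighted norm is a proper homogeneous function (`exists_isCone`). Its unit
level `L`, the link, is compact; `X` is contractible, `X - {x₀}` is homotopy equivalent to `L`, and
the one-point compactification is the unreduced suspension of `L` (`IsCone.exists_isSusp`).

By rational smoothness at `x₀` and contractibility of `X`, the link has the reduced rational
homology of a sphere of dimension `2n - 1`. So `L` is path connected, its suspension is simply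
connected by van Kampen, and by Mayer-Vietoris the suspension has the rational homology of the
sphere of dimension `2n`. It remains to find a map from that sphere which is nonzero on rational
homology in degree `2n`: it is then an isomorphism on homology, and dually on cohomology.

The map comes from a rational Hurewicz theorem for suspensions (`exists_spherical`). A suspension
has pointed self-maps acting on reduced integral homology as any given `N ≥ 1` (`IsSusp.hasMult`),
and these turn torsion classes into zero. By induction on the dimension, every spherical simplex
below the critical dimension becomes null homotopic after such a self-map (`Kills.succ`); the link
between homology and homotopy groups is the homotopy addition theorem (`sum_splxClass_face`), proved
on cubes by rotating one face onto the next. A multiple of the fundamental cycle is then homologous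
to a combination of spherical simplices, one of which must be nontrivial in homology, and it factors
through a sphere.

Chains are indexed by the number of vertices. Index `0` contains the empty simplex, so the homology
is reduced, and index `n` stands for degree `n - 1`. -/

/-! ### Augmented semisimplicial sets and their chains -/

/-- An augmented semisimplicial set, indexed by the number of vertices. -/
structure FaceSet where
  obj : ℕ → Type
  face : ∀ {n : ℕ}, Fin (n + 1) → obj (n + 1) → obj n
  face_face : ∀ {n : ℕ} (i j : Fin (n + 1)), i ≤ j → ∀ s : obj (n + 2),
    face i (face j.succ s) = face j (face i.castSucc s)

namespace FaceSet

/-- A morphism of augmented semisimplicial sets. -/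
structure Hom (S T : FaceSet) where
  app : ∀ {n : ℕ}, S.obj n → T.obj n
  comm : ∀ {n : ℕ} (j : Fin (n + 1)) (s : S.obj (n + 1)), T.face j (app s) = app (S.face j s)

/-- Composition of morphisms. -/
def Hom.comp {S T U : FaceSet} (g : Hom T U) (f : Hom S T) : Hom S U where
  app s := g.app (f.app s)
  comm j s := by rw [g.comm, f.comm]

variable (R : Type) [CommRing R] (S : FaceSet)

/-- Chains with coefficients in `R` on simplices with `n` vertices. -/
abbrev Chain (n : ℕ) : Type := S.obj n →₀ R

variable {S}

/-- The linear extension of a map defined on simplices. -/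
def lift {n : ℕ} {M : Type} [AddCommGroup M] [Module R M] (f : S.obj n → M) :
    S.Chain R n →ₗ[R] M := Finsupp.linearCombination R f

/-- The chain of a simplex. -/
def of {n : ℕ} (s : S.obj n) : S.Chain R n := Finsupp.single s 1

@[simp] lemma lift_of {n : ℕ} {M : Type} [AddCommGroup M] [Module R M] (f : S.obj n → M)
    (s : S.obj n) : lift R f (of R s) = f s := by simp [lift, of]

variable {R} in
lemma chain_hom_ext {n : ℕ} {M : Type} [AddCommGroup M] [Module R M]
    {f g : S.Chain R n →ₗ[R] M} (h : ∀ s, f (of R s) = g (of R s)) : f = g :=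
  Finsupp.lhom_ext' fun s => LinearMap.ext_ring (h s)

variable {R} in
lemma chain_induction {n : ℕ} {p : S.Chain R n → Prop} (c : S.Chain R n) (h0 : p 0)
    (ha : ∀ a b, p a → p b → p (a + b)) (hs : ∀ (r : R) (s : S.obj n), p (r • of R s)) : p c := by
  induction c using Finsupp.induction_linear with
  | zero => exact h0
  | add a b h h' => exact ha a b h h'
  | single s r => simpa [of] using hs r s

/-- The boundary. -/
def d (n : ℕ) : S.Chain R (n + 1) →ₗ[R] S.Chain R n :=
  lift R fun s => ∑ j : Fin (n + 1), (-1 : R) ^ (j : ℕ) • of R (S.face j s)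

lemma d_of {n : ℕ} (s : S.obj (n + 1)) :
    d R n (of R s) = ∑ j : Fin (n + 1), (-1 : R) ^ (j : ℕ) • of R (S.face j s) := by
  simp [d]

lemma d_d_of {n : ℕ} (s : S.obj (n + 2)) : d R n (d R (n + 1) (of R s)) = 0 := by
  simp only [d_of, map_sum, map_smul, Finset.smul_sum, smul_smul]
  rw [← Finset.sum_product']
  -- The terms cancel in pairs: deleting `i` and then some `j < i` is the same as deleting `j` and
  -- then `i - 1`, with the opposite sign.
  let P : Finset (Fin (n + 2) × Fin (n + 1)) := Finset.univ.filter fun x => x.2.castSucc < x.1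
  have hP : ∀ x : Fin (n + 2) × Fin (n + 1), x ∈ P ↔ x.2.castSucc < x.1 := by simp [P]
  rw [Finset.univ_product_univ, ← Finset.sum_add_sum_compl P, ← eq_neg_iff_add_eq_zero,
    ← Finset.sum_neg_distrib]
  refine Finset.sum_bij (fun x hx => (x.2.castSucc, x.1.pred
    (Fin.ne_of_gt (lt_of_le_of_lt (Fin.zero_le _) ((hP x).1 hx))))) ?_ ?_ ?_ ?_
  · rintro ⟨i, j⟩ hx
    have hij : (j : ℕ) < i := (hP _).1 hx
    simp only [Finset.mem_compl, hP, not_lt]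
    change (j : ℕ) ≤ (i : ℕ) - 1
    omega
  · rintro ⟨i, j⟩ hx ⟨i', j'⟩ hx' h
    simp only [Prod.mk.injEq, Fin.castSucc_inj, Fin.pred_inj] at h ⊢
    exact ⟨h.2, h.1⟩
  · rintro ⟨i, j⟩ hx
    simp only [Finset.mem_compl, hP, not_lt] at hx
    have hij : (i : ℕ) ≤ j := hx
    have hi : (i : ℕ) < n + 1 := by have := j.2; omega
    refine ⟨(j.succ, ⟨i, hi⟩), (hP _).2 ?_, ?_⟩
    · change (i : ℕ) < j + 1
      omega
    · simp
  · rintro ⟨i, j⟩ hx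
    have hlt := (hP _).1 hx
    have hne : i ≠ 0 := Fin.ne_of_gt (lt_of_le_of_lt (Fin.zero_le _) hlt)
    obtain ⟨k, rfl⟩ := Fin.exists_succ_eq.2 hne
    have hjk' : (j : ℕ) < k + 1 := hlt
    have hjk : j ≤ k := Fin.le_def.2 (by omega)
    simp only [Fin.pred_succ]
    rw [S.face_face j k hjk, ← neg_smul]
    congr 1
    simp [pow_succ]
    ring

lemma d_d {n : ℕ} (c : S.Chain R (n + 2)) : d R n (d R (n + 1) c) = 0 := by
  have : (d R n).comp (d R (n + 1)) = (0 : S.Chain R (n + 2) →ₗ[R] _) :=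
    chain_hom_ext fun s => by simpa using d_d_of R s
  exact LinearMap.congr_fun this c

/-- The map on chains induced by a morphism. -/
def Hom.map {T : FaceSet} (f : Hom S T) (n : ℕ) : S.Chain R n →ₗ[R] T.Chain R n :=
  lift R fun s => of R (f.app s)

@[simp] lemma Hom.map_of {T : FaceSet} (f : Hom S T) {n : ℕ} (s : S.obj n) :
    f.map R n (of R s) = of R (f.app s) := by simp [Hom.map]

lemma Hom.d_map {T : FaceSet} (f : Hom S T) {n : ℕ} (c : S.Chain R (n + 1)) :
    d R n (f.map R (n + 1) c) = f.map R n (d R n c) := by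
  have : (d R n).comp (f.map R (n + 1)) = (f.map R n).comp (d R n) :=
    chain_hom_ext fun s => by simp [d_of, f.comm]
  exact LinearMap.congr_fun this c

lemma Hom.map_comp {T U : FaceSet} (g : Hom T U) (f : Hom S T) {n : ℕ} (c : S.Chain R n) :
    (g.comp f).map R n c = g.map R n (f.map R n c) := by
  have : (g.comp f).map R n = (g.map R n).comp (f.map R n) :=
    chain_hom_ext fun s => by simp [Hom.comp]
  exact LinearMap.congr_fun this c

lemma Hom.map_congr {T : FaceSet} {f g : Hom S T} {n : ℕ}
    (h : ∀ s : S.obj n, f.app s = g.app s) : f.map R n = g.map R n :=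
  chain_hom_ext fun s => by simp [h]

end FaceSet

open FaceSet

/-! ### Singular simplices and tuples of vertices -/

/-- The standard simplex with `n` vertices. -/
abbrev Splx (n : ℕ) : Type := stdSimplex ℝ (Fin n)

instance : IsEmpty (Splx 0) := ⟨fun x => by simpa using x.2.2⟩

lemma succAbove_succAbove_of_le {n : ℕ} {i j : Fin (n + 1)} (h : i ≤ j) (k : Fin n) :
    j.succ.succAbove (i.succAbove k) = i.castSucc.succAbove (j.succAbove k) := by
  dsimp [Fin.succAbove]
  rcases i with ⟨i, _⟩
  rcases j with ⟨j, _⟩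
  rcases k with ⟨k, _⟩
  split_ifs <;> · simp at * <;> lia

/-- The `j`-th face of the standard simplex. -/
def faceMap {n : ℕ} (j : Fin (n + 1)) : C(Splx n, Splx (n + 1)) :=
  ⟨stdSimplex.map j.succAbove, stdSimplex.continuous_map _⟩

lemma faceMap_faceMap {n : ℕ} {i j : Fin (n + 1)} (h : i ≤ j) :
    (faceMap j.succ).comp (faceMap i) = (faceMap i.castSucc).comp (faceMap j) := by
  ext1 x
  simp only [faceMap, ContinuousMap.comp_apply, ContinuousMap.coe_mk, stdSimplex.map_comp_apply]
  congr 1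
  funext k
  exact succAbove_succAbove_of_le h k

lemma faceMap_succAbove {n : ℕ} (j : Fin (n + 1)) (x : Splx n) (i : Fin n) :
    faceMap j x (j.succAbove i) = x i := by
  change FunOnFinite.linearMap ℝ ℝ j.succAbove x _ = _
  rw [FunOnFinite.linearMap_apply_apply]
  rw [Finset.sum_eq_single i]
  · simp
  · simp

lemma faceMap_self {n : ℕ} (j : Fin (n + 1)) (x : Splx n) : faceMap j x j = 0 := by
  change FunOnFinite.linearMap ℝ ℝ j.succAbove x _ = _
  rw [FunOnFinite.linearMap_apply_apply]
  exact Finset.sum_eq_zero fun i hi => by simp [Fin.succAbove_ne] at hi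

/-- The augmented semisimplicial set of singular simplices. -/
abbrev Sing (Y : Type) [TopologicalSpace Y] : FaceSet where
  obj n := C(Splx n, Y)
  face j σ := σ.comp (faceMap j)
  face_face i j h σ := by
    simp only [ContinuousMap.comp_assoc, faceMap_faceMap h]

/-- The augmented semisimplicial set of tuples of points. -/
abbrev Lin (T : Type) : FaceSet where
  obj n := Fin n → T
  face j v := v ∘ j.succAbove
  face_face i j h v := by
    funext k
    simp [succAbove_succAbove_of_le h]

/-- Postcomposition with a continuous map. -/
abbrev push {Y Z : Type} [TopologicalSpace Y] [TopologicalSpace Z] (f : C(Y, Z)) :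
    Hom (Sing Y) (Sing Z) where
  app σ := f.comp σ
  comm _ _ := rfl

/-- Postcomposition of tuples with a map. -/
abbrev Lin.push {T U : Type} (f : T → U) : Hom (Lin T) (Lin U) where
  app v := f ∘ v
  comm _ _ := rfl

/-- A space in which tuples of points have convex combinations. -/
class Combs (T : Type) [TopologicalSpace T] where
  comb : ∀ {n : ℕ}, (Fin n → T) → C(Splx n, T)
  comb_face : ∀ {n : ℕ} (v : Fin (n + 1) → T) (j : Fin (n + 1)) (x : Splx n),
    comb v (faceMap j x) = comb (v ∘ j.succAbove) x

/-- Convex combinations, as a morphism to singular simplices. -/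
def Combs.real (T : Type) [TopologicalSpace T] [Combs T] : Hom (Lin T) (Sing T) where
  app v := Combs.comb v
  comm j v := by
    refine ContinuousMap.ext fun x => ?_
    exact Combs.comb_face v j x

/-! ### Cones, subdivision and prisms for tuples -/

namespace Lin

variable (R : Type) [CommRing R] {T : Type}

/-- The cone on a chain of tuples. -/
def cone (b : T) (n : ℕ) : (Lin T).Chain R n →ₗ[R] (Lin T).Chain R (n + 1) :=
  lift R fun v => of R (S := Lin T) (n := n + 1) (Fin.cons b v : Fin (n + 1) → T)

@[simp] lemma cone_of (b : T) {n : ℕ} (v : (Lin T).obj n) :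
    cone R b n (of R v) = of R (S := Lin T) (n := n + 1) (Fin.cons b v : Fin (n + 1) → T) := by
  simp [cone]

/-- Deleting the cone point gives back `c`; deleting another vertex gives, with the opposite sign,
the cone on a face. Subdivision, its chain homotopy and prisms are all obtained recursively from
this identity. -/
lemma d_cone (b : T) {n : ℕ} (c : (Lin T).Chain R (n + 1)) :
    d R (n + 1) (cone R b (n + 1) c) = c - cone R b n (d R n c) := by
  have : (d R (n + 1)).comp (cone R b (n + 1)) = LinearMap.id - (cone R b n).comp (d R n) := by
    refine chain_hom_ext fun v => ?_
    simp only [LinearMap.comp_apply, cone_of, LinearMap.sub_apply, LinearMap.id_apply]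
    rw [d_of, Fin.sum_univ_succ, d_of, map_sum, sub_eq_add_neg, ← Finset.sum_neg_distrib]
    congr 1
    · simp only [Fin.val_zero, pow_zero, one_smul]
      congr 1
    · refine Finset.sum_congr rfl fun j _ => ?_
      rw [map_smul, cone_of, ← neg_smul]
      congr 1
      · simp [pow_succ]
      · congr 1
        funext k
        refine Fin.cases ?_ (fun k => ?_) k
        · simp
        · simp
  exact LinearMap.congr_fun this c

lemma d_cone_zero (b : T) (c : (Lin T).Chain R 0) : d R 0 (cone R b 0 c) = c := by
  have : (d R 0).comp (cone R b 0) = LinearMap.id := by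
    refine chain_hom_ext fun v => ?_
    simp only [LinearMap.comp_apply, cone_of, LinearMap.id_apply, d_of]
    rw [Fin.sum_univ_one, Fin.val_zero, pow_zero, one_smul]
    congr 1
  exact LinearMap.congr_fun this c

/-- The subdivision of tuples with new vertices `b v`. -/
def sd (b : ∀ n : ℕ, (Fin (n + 1) → T) → T) : ∀ n, (Lin T).Chain R n →ₗ[R] (Lin T).Chain R n
  | 0 => LinearMap.id
  | n + 1 => lift R fun v => cone R (b n v) n (sd b n (d R n (of R v)))

/-- By induction the chain to be coned off, `sd (d v)`, is a cycle because `d (d v) = 0`. Hence the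
correction term in `d_cone` disappears. -/
lemma d_sd (b : ∀ n : ℕ, (Fin (n + 1) → T) → T) {n : ℕ} (c : (Lin T).Chain R (n + 1)) :
    d R n (sd R b (n + 1) c) = sd R b n (d R n c) := by
  have : (d R n).comp (sd R b (n + 1)) = (sd R b n).comp (d R n) := by
    refine chain_hom_ext fun v => ?_
    simp only [LinearMap.comp_apply, sd, lift_of]
    cases n with
    | zero => rw [d_cone_zero]
    | succ n => rw [d_cone, d_sd b (d R (n + 1) (of R v)), d_d]; simp
  exact LinearMap.congr_fun this c

/-- A chain homotopy from the identity to subdivision. -/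
def sdHomotopy (b : ∀ n : ℕ, (Fin (n + 1) → T) → T) :
    ∀ n, (Lin T).Chain R n →ₗ[R] (Lin T).Chain R (n + 1)
  | 0 => 0
  | n + 1 => lift R fun v =>
      cone R (b n v) (n + 1) (of R v - sdHomotopy b n (d R n (of R v)))

lemma d_sdHomotopy (b : ∀ n : ℕ, (Fin (n + 1) → T) → T) {n : ℕ} (c : (Lin T).Chain R (n + 1)) :
    d R (n + 1) (sdHomotopy R b (n + 1) c) =
      c - sd R b (n + 1) c - sdHomotopy R b n (d R n c) := by
  have : (d R (n + 1)).comp (sdHomotopy R b (n + 1)) =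
      LinearMap.id - sd R b (n + 1) - (sdHomotopy R b n).comp (d R n) := by
    refine chain_hom_ext fun v => ?_
    simp only [LinearMap.comp_apply, LinearMap.sub_apply, LinearMap.id_apply, sdHomotopy, sd,
      lift_of]
    rw [d_cone]
    have : d R n (sdHomotopy R b n (d R n (of R v))) =
        d R n (of R v) - sd R b n (d R n (of R v)) := by
      cases n with
      | zero => simp [sdHomotopy, sd]
      | succ n => rw [d_sdHomotopy b (d R (n + 1) (of R v)), d_d]; simp
    rw [map_sub, this, sub_sub_cancel]
    abel
  exact LinearMap.congr_fun this c

/-- The prism between two maps of tuples, with cone points `q v`. -/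
def prism {U : Type} (f g : T → U) (q : ∀ n : ℕ, (Fin (n + 1) → T) → U) :
    ∀ n, (Lin T).Chain R n →ₗ[R] (Lin U).Chain R (n + 1)
  | 0 => 0
  | n + 1 => lift R fun v => cone R (q n v) (n + 1)
      ((push g).map R (n + 1) (of R v) - (push f).map R (n + 1) (of R v) -
        prism f g q n (d R n (of R v)))

/-- The chain that is coned off is a cycle by induction, whatever the cone points `q`. No
triangulation of a prism is needed; geometry enters only when tuples are realized by convex
combinations. -/
lemma d_prism {U : Type} (f g : T → U) (q : ∀ n : ℕ, (Fin (n + 1) → T) → U) {n : ℕ}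
    (c : (Lin T).Chain R (n + 1)) :
    d R (n + 1) (prism R f g q (n + 1) c) =
      (push g).map R (n + 1) c - (push f).map R (n + 1) c - prism R f g q n (d R n c) := by
  have : (d R (n + 1)).comp (prism R f g q (n + 1)) =
      (push g).map R (n + 1) - (push f).map R (n + 1) - (prism R f g q n).comp (d R n) := by
    refine chain_hom_ext fun v => ?_
    simp only [LinearMap.comp_apply, LinearMap.sub_apply, prism, lift_of]
    rw [d_cone]
    have : d R n (prism R f g q n (d R n (of R v))) =
        (push g).map R n (d R n (of R v)) - (push f).map R n (d R n (of R v)) := by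
      cases n with
      | zero =>
        have : (push g : Hom (Lin T) (Lin U)).map R 0 = (push f : Hom (Lin T) (Lin U)).map R 0 :=
          chain_hom_ext fun s => by
            simp only [Hom.map_of]
            congr 1
            funext k
            exact k.elim0
        simp [prism, this]
      | succ n => rw [d_prism f g q (d R (n + 1) (of R v)), d_d]; simp
    rw [map_sub, this, map_sub (d R n), Hom.d_map, Hom.d_map]
    simp
  exact LinearMap.congr_fun this c

lemma map_cone {U : Type} (h : T → U) (b : T) {n : ℕ} (c : (Lin T).Chain R n) :
    (push h).map R (n + 1) (cone R b n c) = cone R (h b) n ((push h).map R n c) := by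
  have : ((push h).map R (n + 1)).comp (cone R b n) =
      (cone R (h b) n).comp ((push h).map R n) := by
    refine chain_hom_ext fun v => ?_
    simp only [LinearMap.comp_apply, cone_of, Hom.map_of]
    congr 1
    funext k
    refine Fin.cases ?_ (fun k => ?_) k <;> simp
  exact LinearMap.congr_fun this c

/-- Applied to face inclusions, which preserve barycenters, this naturality lets the subdivision of
the standard simplex define an operator on all singular chains. -/
lemma map_sd {U : Type} (h : T → U) (b : ∀ n : ℕ, (Fin (n + 1) → T) → T)
    (b' : ∀ n : ℕ, (Fin (n + 1) → U) → U) (hb : ∀ n v, h (b n v) = b' n (h ∘ v)) {n : ℕ}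
    (c : (Lin T).Chain R n) :
    (push h).map R n (sd R b n c) = sd R b' n ((push h).map R n c) := by
  have : ((push h).map R n).comp (sd R b n) = (sd R b' n).comp ((push h).map R n) := by
    refine chain_hom_ext fun v => ?_
    cases n with
    | zero => simp [sd]
    | succ n =>
      simp only [LinearMap.comp_apply, Hom.map_of, sd, lift_of]
      rw [map_cone, map_sd h b b' hb, ← Hom.d_map, Hom.map_of, hb]
  exact LinearMap.congr_fun this c

lemma map_sdHomotopy {U : Type} (h : T → U) (b : ∀ n : ℕ, (Fin (n + 1) → T) → T)
    (b' : ∀ n : ℕ, (Fin (n + 1) → U) → U) (hb : ∀ n v, h (b n v) = b' n (h ∘ v)) {n : ℕ}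
    (c : (Lin T).Chain R n) :
    (push h).map R (n + 1) (sdHomotopy R b n c) =
      sdHomotopy R b' n ((push h).map R n c) := by
  have : ((push h).map R (n + 1)).comp (sdHomotopy R b n) =
      (sdHomotopy R b' n).comp ((push h).map R n) := by
    refine chain_hom_ext fun v => ?_
    cases n with
    | zero => simp [sdHomotopy]
    | succ n =>
      simp only [LinearMap.comp_apply, Hom.map_of, sdHomotopy, lift_of]
      rw [map_cone, map_sub, map_sdHomotopy h b b' hb, ← Hom.d_map, Hom.map_of, hb]
  exact LinearMap.congr_fun this c

lemma map_prism {T' U U' : Type} (h : T → T') (k : U → U') (f g : T → U) (f' g' : T' → U')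
    (q : ∀ n : ℕ, (Fin (n + 1) → T) → U) (q' : ∀ n : ℕ, (Fin (n + 1) → T') → U')
    (hf : k ∘ f = f' ∘ h) (hg : k ∘ g = g' ∘ h) (hq : ∀ n v, k (q n v) = q' n (h ∘ v)) {n : ℕ}
    (c : (Lin T).Chain R n) :
    (push k).map R (n + 1) (prism R f g q n c) = prism R f' g' q' n ((push h).map R n c) := by
  have : ((push k).map R (n + 1)).comp (prism R f g q n) =
      (prism R f' g' q' n).comp ((push h).map R n) := by
    refine chain_hom_ext fun v => ?_
    cases n with
    | zero => simp [prism]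
    | succ n =>
      simp only [LinearMap.comp_apply, Hom.map_of, prism, lift_of]
      have e1 : k ∘ f ∘ v = f' ∘ h ∘ v := by
        rw [← Function.comp_assoc, hf, Function.comp_assoc]
      have e2 : k ∘ g ∘ v = g' ∘ h ∘ v := by
        rw [← Function.comp_assoc, hg, Function.comp_assoc]
      rw [map_cone, map_sub, map_sub, map_prism h k f g f' g' q q' hf hg hq, ← Hom.d_map, hq]
      simp only [Hom.map_of, map_sub, e1, e2]
  exact LinearMap.congr_fun this c

end Lin

section

/-! ### Spaces with convex combinations -/

lemma continuous_splx_apply {n : ℕ} (i : Fin n) : Continuous fun x : Splx n => x i :=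
  (continuous_apply i).comp continuous_subtype_val

instance Splx.instCombs (m : ℕ) : Combs (Splx m) where
  comb {n} v :=
    { toFun := fun x => ⟨fun k => ∑ i, x i * v i k, by
        refine ⟨fun k => Finset.sum_nonneg fun i _ => mul_nonneg (x.2.1 i) ((v i).2.1 k), ?_⟩
        rw [Finset.sum_comm]
        simp only [← Finset.mul_sum]
        have h : ∀ i, ∑ k, v i k = 1 := fun i => (v i).2.2
        simp only [h, mul_one]
        exact x.2.2⟩
      continuous_toFun := by
        refine Continuous.subtype_mk (continuous_pi fun k => ?_) _
        exact continuous_finsetSum _ fun i _ => (continuous_splx_apply i).mul continuous_const }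
  comb_face {n} v j x := by
    refine stdSimplex.ext (funext fun k => ?_)
    change ∑ i, faceMap j x i * v i k = ∑ i, x i * v (j.succAbove i) k
    rw [Fin.sum_univ_succAbove _ j, faceMap_self]
    simp [faceMap_succAbove]

lemma Splx.comb_apply {m n : ℕ} (v : Fin n → Splx m) (x : Splx n) (k : Fin m) :
    Combs.comb v x k = ∑ i, x i * v i k := rfl

instance unitInterval.instCombs : Combs unitInterval where
  comb {n} v :=
    { toFun := fun x => ⟨∑ i, x i * (v i : ℝ), by
        refine ⟨Finset.sum_nonneg fun i _ => mul_nonneg (x.2.1 i) (v i).2.1, ?_⟩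
        have h : ∑ i, x i = 1 := x.2.2
        rw [← h]
        exact Finset.sum_le_sum fun i _ => mul_le_of_le_one_right (x.2.1 i) (v i).2.2⟩
      continuous_toFun := by
        refine Continuous.subtype_mk ?_ _
        exact continuous_finsetSum _ fun i _ => (continuous_splx_apply i).mul continuous_const }
  comb_face {n} v j x := by
    refine Subtype.ext ?_
    change ∑ i, faceMap j x i * (v i : ℝ) = ∑ i, x i * (v (j.succAbove i) : ℝ)
    rw [Fin.sum_univ_succAbove _ j, faceMap_self]
    simp [faceMap_succAbove]

lemma unitInterval.comb_const {n : ℕ} (t : unitInterval) (x : Splx n) :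
    Combs.comb (fun _ : Fin n => t) x = t := by
  refine Subtype.ext ?_
  change ∑ i, x i * (t : ℝ) = t
  have h : ∑ i, x i = 1 := x.2.2
  rw [← Finset.sum_mul, h, one_mul]

instance Prod.instCombs (T U : Type) [TopologicalSpace T] [TopologicalSpace U] [Combs T]
    [Combs U] : Combs (T × U) where
  comb v := (Combs.comb (Prod.fst ∘ v)).prodMk (Combs.comb (Prod.snd ∘ v))
  comb_face _ _ _ := Prod.ext (Combs.comb_face _ _ _) (Combs.comb_face _ _ _)

/-- The vertices of the standard simplex. -/
def vert (n : ℕ) : Fin n → Splx n := fun i => stdSimplex.vertex i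

lemma comb_vert (n : ℕ) : Combs.comb (vert n) = ContinuousMap.id (Splx n) := by
  refine ContinuousMap.ext fun x => stdSimplex.ext (funext fun k => ?_)
  rw [Splx.comb_apply, Finset.sum_eq_single k]
  · simp [vert]
  · intro i _ hi
    simp [vert, hi.symm]
  · simp

lemma faceMap_vert {n : ℕ} (j : Fin (n + 1)) :
    faceMap j ∘ vert n = vert (n + 1) ∘ j.succAbove := by
  funext i
  exact stdSimplex.map_vertex _ _

lemma faceMap_comb {m n : ℕ} (j : Fin (m + 1)) (v : Fin n → Splx m) (x : Splx n) :
    faceMap j (Combs.comb v x) = Combs.comb (faceMap j ∘ v) x := by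
  refine stdSimplex.ext (funext fun k => ?_)
  rw [Splx.comb_apply]
  rcases Fin.eq_self_or_eq_succAbove j k with rfl | ⟨k, rfl⟩
  · simp [faceMap_self]
  · rw [faceMap_succAbove, Splx.comb_apply]
    simp [faceMap_succAbove]

/-! ### Natural homotopies of operators on singular simplices -/

variable (R : Type) [CommRing R]

/-- The prism on the standard simplex. -/
def prismChain (n : ℕ) : (Sing (unitInterval × Splx n)).Chain R (n + 1) :=
  (Combs.real _).map R (n + 1) (Lin.prism R (fun x => ((0 : unitInterval), x))
    (fun x => ((1 : unitInterval), x)) (fun _ v => ((0 : unitInterval), v 0)) n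
    (of R (S := Lin (Splx n)) (vert n)))

lemma map_real_prism {m n : ℕ} (j : Fin (m + 1)) (c : (Lin (Splx m)).Chain R n) :
    (push ((ContinuousMap.id unitInterval).prodMap (faceMap j))).map R n.succ
      ((Combs.real _).map R (n + 1) (Lin.prism R (fun x => ((0 : unitInterval), x))
        (fun x => ((1 : unitInterval), x)) (fun _ v => ((0 : unitInterval), v 0)) n c)) =
    (Combs.real _).map R (n + 1) (Lin.prism R (fun x => ((0 : unitInterval), x))
        (fun x => ((1 : unitInterval), x)) (fun _ v => ((0 : unitInterval), v 0)) n
        ((Lin.push (faceMap j)).map R n c)) := by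
  have e := Lin.map_prism R (faceMap j) (Prod.map id (faceMap j) : unitInterval × Splx m → _)
    (fun x => ((0 : unitInterval), x)) (fun x => ((1 : unitInterval), x))
    (fun x => ((0 : unitInterval), x)) (fun x => ((1 : unitInterval), x))
    (fun _ v => ((0 : unitInterval), v 0)) (fun _ v => ((0 : unitInterval), v 0)) rfl rfl
    (fun _ _ => rfl) c
  rw [← e, ← Hom.map_comp, ← Hom.map_comp]
  refine LinearMap.congr_fun (Hom.map_congr R fun v => ?_) _
  refine ContinuousMap.ext fun x => Prod.ext rfl ?_
  exact faceMap_comb j (Prod.snd ∘ v) x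

lemma comb_prod_vert (n : ℕ) (t : unitInterval) :
    Combs.comb ((fun x => (t, x)) ∘ vert n) =
      (ContinuousMap.const _ t).prodMk (ContinuousMap.id (Splx n)) := by
  refine ContinuousMap.ext fun x => Prod.ext ?_ ?_
  · exact unitInterval.comb_const t x
  · exact congrArg (fun f : C(Splx n, Splx n) => f x) (comb_vert n)

/-- This is the universal case of the homotopy formula. Pushing it forward along the homotopy
attached to a singular simplex gives `NatHomotopy.d_prism`. -/
lemma d_prismChain (n : ℕ) :
    d R (n + 1) (prismChain R (n + 1)) =
      of R (S := Sing (unitInterval × Splx (n + 1)))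
        ((ContinuousMap.const _ 1).prodMk (ContinuousMap.id (Splx (n + 1)))) -
      of R (S := Sing (unitInterval × Splx (n + 1)))
        ((ContinuousMap.const _ 0).prodMk (ContinuousMap.id (Splx (n + 1)))) -
      ∑ j : Fin (n + 1), (-1 : R) ^ (j : ℕ) •
        (push ((ContinuousMap.id unitInterval).prodMap (faceMap j))).map R (n + 1)
          (prismChain R n) := by
  rw [prismChain, Hom.d_map, Lin.d_prism, map_sub, map_sub]
  congr 1
  · congr 1
    · simp only [Hom.map_of]
      exact congrArg _ (comb_prod_vert _ _)
    · simp only [Hom.map_of]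
      exact congrArg _ (comb_prod_vert _ _)
  · rw [d_of, map_sum, map_sum]
    refine Finset.sum_congr rfl fun j _ => ?_
    rw [map_smul, map_smul, prismChain, map_real_prism, Hom.map_of]
    congr 4
    exact (faceMap_vert j).symm

variable {X Y Z : Type} [TopologicalSpace X] [TopologicalSpace Y] [TopologicalSpace Z]

/-- A homotopy between two operators on singular simplices, natural for faces. -/
structure NatHomotopy (G E : Hom (Sing X) (Sing Y)) where
  h : ∀ {n : ℕ}, C(Splx n, X) → C(unitInterval × Splx n, Y)
  h_zero : ∀ {n : ℕ} (σ : C(Splx n, X)) (x : Splx n), h σ (0, x) = G.app σ x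
  h_one : ∀ {n : ℕ} (σ : C(Splx n, X)) (x : Splx n), h σ (1, x) = E.app σ x
  h_face : ∀ {n : ℕ} (σ : C(Splx (n + 1), X)) (j : Fin (n + 1)) (t : unitInterval) (x : Splx n),
    h (σ.comp (faceMap j)) (t, x) = h σ (t, faceMap j x)

/-- The chain homotopy given by a natural homotopy. -/
def NatHomotopy.prism {G E : Hom (Sing X) (Sing Y)} (H : NatHomotopy G E) (n : ℕ) :
    (Sing X).Chain R n →ₗ[R] (Sing Y).Chain R (n + 1) :=
  lift R fun σ => (push (H.h σ)).map R (n + 1) (prismChain R n)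

/-- Homotopy invariance is needed for operators on simplices and not just for maps: the deformations
of skeleta below move each simplex separately and need not come from a self-map of the space. -/
lemma NatHomotopy.d_prism {G E : Hom (Sing X) (Sing Y)} (H : NatHomotopy G E) {n : ℕ}
    (c : (Sing X).Chain R (n + 1)) :
    d R (n + 1) (H.prism R (n + 1) c) =
      E.map R (n + 1) c - G.map R (n + 1) c - H.prism R n (d R n c) := by
  have : (d R (n + 1)).comp (H.prism R (n + 1)) =
      E.map R (n + 1) - G.map R (n + 1) - (H.prism R n).comp (d R n) := by
    refine chain_hom_ext fun σ => ?_
    simp only [LinearMap.comp_apply, LinearMap.sub_apply, NatHomotopy.prism, lift_of, Hom.d_map,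
      d_prismChain, map_sub, map_sum, map_smul, d_of]
    congr 1
    · congr 1
      · simp only [Hom.map_of]
        congr 1
        exact ContinuousMap.ext fun x => H.h_one σ x
      · simp only [Hom.map_of]
        congr 1
        exact ContinuousMap.ext fun x => H.h_zero σ x
    · refine Finset.sum_congr rfl fun j _ => ?_
      rw [← Hom.map_comp]
      congr 1
      refine LinearMap.congr_fun (Hom.map_congr R fun v => ?_) _
      exact ContinuousMap.ext fun x => (H.h_face σ j (v x).1 (v x).2).symm
  exact LinearMap.congr_fun this c

/-! ### Cycles and boundaries -/

/-- The cycles. -/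
def cyc (S : FaceSet) : ∀ n : ℕ, Submodule R (S.Chain R n)
  | 0 => ⊤
  | n + 1 => LinearMap.ker (d R n)

/-- The boundaries. -/
def bdry (S : FaceSet) (n : ℕ) : Submodule R (S.Chain R n) := LinearMap.range (d R n)

variable {R}

lemma bdry_le_cyc {S : FaceSet} {n : ℕ} {c : S.Chain R n} (h : c ∈ bdry R S n) :
    c ∈ cyc R S n := by
  obtain ⟨w, rfl⟩ := h
  cases n with
  | zero => trivial
  | succ n => exact d_d R w

lemma map_mem_cyc {S T : FaceSet} (f : Hom S T) {n : ℕ} {c : S.Chain R n} (h : c ∈ cyc R S n) :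
    f.map R n c ∈ cyc R T n := by
  cases n with
  | zero => trivial
  | succ n =>
    change d R n (f.map R _ c) = 0
    rw [Hom.d_map, show d R n c = 0 from h, map_zero]

lemma map_mem_bdry {S T : FaceSet} (f : Hom S T) {n : ℕ} {c : S.Chain R n} (h : c ∈ bdry R S n) :
    f.map R n c ∈ bdry R T n := by
  obtain ⟨w, rfl⟩ := h
  exact ⟨f.map R _ w, Hom.d_map _ _ _⟩

lemma NatHomotopy.sub_mem_bdry {G E : Hom (Sing X) (Sing Y)} (H : NatHomotopy G E) {n : ℕ}
    {c : (Sing X).Chain R n} (hc : c ∈ cyc R _ n) :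
    E.map R n c - G.map R n c ∈ bdry R _ n := by
  cases n with
  | zero =>
    have : E.map R 0 = G.map R 0 := chain_hom_ext fun s => by
      simp only [Hom.map_of]
      congr 1
      exact ContinuousMap.ext fun x => isEmptyElim x
    rw [this, sub_self]
    exact Submodule.zero_mem _
  | succ n =>
    refine ⟨H.prism R (n + 1) c, ?_⟩
    rw [H.d_prism R, show d R n c = 0 from hc, map_zero, sub_zero]

/-- The natural homotopy given by a homotopy of maps. -/
def NatHomotopy.ofHomotopy {f g : C(X, Y)} (H : f.Homotopy g) :
    NatHomotopy (push f) (push g) where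
  h σ := H.toContinuousMap.comp ((ContinuousMap.id unitInterval).prodMap σ)
  h_zero _ _ := H.apply_zero _
  h_one _ _ := H.apply_one _
  h_face _ _ _ _ := rfl

lemma map_sub_map_mem_bdry {f g : C(X, Y)} (H : f.Homotopic g) {n : ℕ}
    {c : (Sing X).Chain R n} (hc : c ∈ cyc R _ n) :
    (push f).map R n c - (push g).map R n c ∈ bdry R _ n :=
  NatHomotopy.sub_mem_bdry (NatHomotopy.ofHomotopy H.some.symm) hc

@[simp] lemma push_id_map {n : ℕ} (c : (Sing X).Chain R n) :
    (push (ContinuousMap.id X)).map R n c = c := by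
  have : (push (ContinuousMap.id X)).map R n = LinearMap.id := chain_hom_ext fun s => by simp
  rw [this]; rfl

lemma push_comp_map (g : C(Y, Z)) (f : C(X, Y)) {n : ℕ} (c : (Sing X).Chain R n) :
    (push (g.comp f)).map R n c = (push g).map R n ((push f).map R n c) := by
  rw [← Hom.map_comp]
  rfl

variable (R)

/-- Every reduced cycle with `n` vertices is a boundary. -/
def Acyc (X : Type) [TopologicalSpace X] (n : ℕ) : Prop :=
  ∀ c ∈ cyc R (Sing X) n, c ∈ bdry R (Sing X) n

/-- The reduced homology on `n` vertices is generated by one cycle which is not a boundary. -/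
def HomLine (X : Type) [TopologicalSpace X] (n : ℕ) : Prop :=
  ∃ z ∈ cyc R (Sing X) n, z ∉ bdry R (Sing X) n ∧
    ∀ c ∈ cyc R (Sing X) n, ∃ a : R, c - a • z ∈ bdry R (Sing X) n

variable {R}

lemma Acyc.of_retract {f : C(X, Y)} {g : C(Y, X)}
    (h : (g.comp f).Homotopic (ContinuousMap.id X)) {n : ℕ} (hY : Acyc R Y n) : Acyc R X n := by
  intro c hc
  have h1 := map_sub_map_mem_bdry h hc
  have h2 := map_mem_bdry (push g) (hY _ (map_mem_cyc (push f) hc))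
  rw [push_comp_map, push_id_map] at h1
  simpa using Submodule.sub_mem _ h2 h1

lemma HomLine.of_equiv {f : C(X, Y)} {g : C(Y, X)}
    (h : (g.comp f).Homotopic (ContinuousMap.id X))
    (h' : (f.comp g).Homotopic (ContinuousMap.id Y)) {n : ℕ} (hY : HomLine R Y n) :
    HomLine R X n := by
  obtain ⟨z, hz, hzn, hz'⟩ := hY
  refine ⟨(push g).map R n z, map_mem_cyc _ hz, fun hb => hzn ?_, fun c hc => ?_⟩
  · have h1 := map_sub_map_mem_bdry h' hz
    have h2 := map_mem_bdry (push f) hb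
    rw [push_comp_map, push_id_map] at h1
    simpa using Submodule.sub_mem _ h2 h1
  · obtain ⟨a, ha⟩ := hz' _ (map_mem_cyc (push f) hc)
    refine ⟨a, ?_⟩
    have h1 := map_sub_map_mem_bdry h hc
    have h2 := map_mem_bdry (push g) ha
    rw [push_comp_map, push_id_map] at h1
    rw [map_sub, map_smul] at h2
    have := Submodule.sub_mem _ h2 h1
    rw [sub_sub_sub_cancel_left] at this
    exact this

/-- There is one simplex for each number of vertices, and the boundary is alternately an isomorphism
and zero, starting with an isomorphism onto the span of the empty simplex. -/
lemma acyc_punit (n : ℕ) : Acyc R PUnit n := by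
  intro c hc
  have hof : ∀ (k : ℕ) (c : (Sing PUnit).Chain R k),
      ∃ a : R, c = a • of R (S := Sing PUnit) (ContinuousMap.const _ PUnit.unit) := by
    intro k c
    refine chain_induction (p := fun c => ∃ a : R, c = a • of R (S := Sing PUnit)
      (ContinuousMap.const _ PUnit.unit)) c ⟨0, by simp⟩ ?_ ?_
    · rintro _ _ ⟨a, rfl⟩ ⟨b, rfl⟩
      exact ⟨a + b, (add_smul _ _ _).symm⟩
    · intro r s
      exact ⟨r, rfl⟩
  have hd : ∀ k : ℕ, d R k (of R (S := Sing PUnit) (n := k + 1) (ContinuousMap.const _ PUnit.unit)) =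
      (∑ j : Fin (k + 1), (-1 : R) ^ (j : ℕ)) •
        of R (S := Sing PUnit) (n := k) (ContinuousMap.const _ PUnit.unit) := by
    intro k
    rw [d_of, Finset.sum_smul]
    rfl
  have hsum : ∀ k : ℕ, (∑ j : Fin (k + 1), (-1 : R) ^ (j : ℕ)) = if Even k then 1 else 0 := by
    intro k
    rw [Fin.sum_univ_eq_sum_range (fun i => (-1 : R) ^ i) (k + 1), neg_one_geom_sum]
    simp only [Nat.even_add_one]
    split_ifs <;> simp_all
  obtain ⟨a, rfl⟩ := hof n c
  by_cases hn : Even n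
  · refine ⟨a • of R (S := Sing PUnit) (n := n + 1) (ContinuousMap.const _ PUnit.unit), ?_⟩
    rw [map_smul, hd, hsum, if_pos hn, one_smul]
  · cases n with
    | zero => simp at hn
    | succ n =>
      have h : d R n _ = 0 := hc
      rw [map_smul, hd, hsum, if_pos (by simpa [Nat.even_add_one] using hn), one_smul] at h
      have ha : a = 0 := by simpa [of] using h
      rw [ha, zero_smul]
      exact Submodule.zero_mem _

lemma Acyc.of_contractible [ContractibleSpace X] (n : ℕ) : Acyc R X n := by
  obtain ⟨x, hx⟩ := id_nullhomotopic X
  refine Acyc.of_retract (Y := PUnit) (f := ContinuousMap.const _ PUnit.unit)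
    (g := ContinuousMap.const _ x) ?_ (acyc_punit n)
  exact hx.symm

lemma map_const_mem_bdry (y : Y) {n : ℕ} {c : (Sing X).Chain R n} (hc : c ∈ cyc R _ n) :
    (push (ContinuousMap.const X y)).map R n c ∈ bdry R _ n := by
  have h1 := acyc_punit n _ (map_mem_cyc (push (ContinuousMap.const X PUnit.unit)) hc)
  have h2 := map_mem_bdry (push (ContinuousMap.const PUnit y)) h1
  rwa [← push_comp_map] at h2

end

section

/-! ### Iterated barycentric subdivision -/

namespace Lin

variable (R : Type) [CommRing R] {T : Type}

/-- The iterated subdivision. -/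
def sdIter (b : ∀ n : ℕ, (Fin (n + 1) → T) → T) : ∀ _ n : ℕ,
    (Lin T).Chain R n →ₗ[R] (Lin T).Chain R n
  | 0, _ => LinearMap.id
  | N + 1, n => (sd R b n).comp (sdIter b N n)

/-- A chain homotopy from the identity to the iterated subdivision. -/
def sdIterHomotopy (b : ∀ n : ℕ, (Fin (n + 1) → T) → T) : ∀ _ n : ℕ,
    (Lin T).Chain R n →ₗ[R] (Lin T).Chain R (n + 1)
  | 0, _ => 0
  | N + 1, n => sdIterHomotopy b N n + (sdHomotopy R b n).comp (sdIter R b N n)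

lemma d_sdIter (b : ∀ n : ℕ, (Fin (n + 1) → T) → T) (N : ℕ) {n : ℕ}
    (c : (Lin T).Chain R (n + 1)) :
    d R n (sdIter R b N (n + 1) c) = sdIter R b N n (d R n c) := by
  induction N with
  | zero => rfl
  | succ N ih => simp only [sdIter, LinearMap.comp_apply, d_sd, ih]

lemma d_sdIterHomotopy (b : ∀ n : ℕ, (Fin (n + 1) → T) → T) (N : ℕ) {n : ℕ}
    (c : (Lin T).Chain R (n + 1)) :
    d R (n + 1) (sdIterHomotopy R b N (n + 1) c) =
      c - sdIter R b N (n + 1) c - sdIterHomotopy R b N n (d R n c) := by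
  induction N with
  | zero => simp [sdIterHomotopy, sdIter]
  | succ N ih =>
    simp only [sdIterHomotopy, sdIter, LinearMap.comp_apply, LinearMap.add_apply, map_add, ih,
      d_sdHomotopy, d_sdIter]
    abel

lemma map_sdIter {U : Type} (h : T → U) (b : ∀ n : ℕ, (Fin (n + 1) → T) → T)
    (b' : ∀ n : ℕ, (Fin (n + 1) → U) → U) (hb : ∀ n v, h (b n v) = b' n (h ∘ v)) (N : ℕ) {n : ℕ}
    (c : (Lin T).Chain R n) :
    (push h).map R n (sdIter R b N n c) = sdIter R b' N n ((push h).map R n c) := by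
  induction N with
  | zero => rfl
  | succ N ih => simp only [sdIter, LinearMap.comp_apply, map_sd R h b b' hb, ih]

lemma map_sdIterHomotopy {U : Type} (h : T → U) (b : ∀ n : ℕ, (Fin (n + 1) → T) → T)
    (b' : ∀ n : ℕ, (Fin (n + 1) → U) → U) (hb : ∀ n v, h (b n v) = b' n (h ∘ v)) (N : ℕ) {n : ℕ}
    (c : (Lin T).Chain R n) :
    (push h).map R (n + 1) (sdIterHomotopy R b N n c) =
      sdIterHomotopy R b' N n ((push h).map R n c) := by
  induction N with
  | zero => simp [sdIterHomotopy]
  | succ N ih =>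
    simp only [sdIterHomotopy, LinearMap.comp_apply, LinearMap.add_apply, map_add, ih,
      map_sdHomotopy R h b b' hb, map_sdIter R h b b' hb]

end Lin

/-- The barycenter of a tuple of points of a simplex. -/
def baryc (m n : ℕ) (v : Fin (n + 1) → Splx m) : Splx m :=
  Combs.comb v stdSimplex.barycenter

lemma faceMap_baryc {m : ℕ} (j : Fin (m + 1)) (n : ℕ) (v : Fin (n + 1) → Splx m) :
    faceMap j (baryc m n v) = baryc (m + 1) n (faceMap j ∘ v) := faceMap_comb j v _

variable (R : Type) [CommRing R] {X Y Z : Type} [TopologicalSpace X] [TopologicalSpace Y]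
  [TopologicalSpace Z]

lemma map_real_push {m n : ℕ} (j : Fin (m + 1)) (c : (Lin (Splx m)).Chain R n) :
    (push (faceMap j)).map R n ((Combs.real _).map R n c) =
      (Combs.real _).map R n ((Lin.push (faceMap j)).map R n c) := by
  rw [← Hom.map_comp, ← Hom.map_comp]
  refine LinearMap.congr_fun (Hom.map_congr R fun v => ?_) _
  exact ContinuousMap.ext fun x => faceMap_comb j v x

/-- The iterated subdivision of singular chains. -/
def sub (N n : ℕ) : (Sing Y).Chain R n →ₗ[R] (Sing Y).Chain R n :=
  lift R fun σ => (push σ).map R n ((Combs.real _).map R n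
    (Lin.sdIter R (baryc n) N n (of R (S := Lin (Splx n)) (vert n))))

/-- A chain homotopy from the identity to the iterated subdivision. -/
def subHomotopy (N n : ℕ) : (Sing Y).Chain R n →ₗ[R] (Sing Y).Chain R (n + 1) :=
  lift R fun σ => (push σ).map R (n + 1) ((Combs.real _).map R (n + 1)
    (Lin.sdIterHomotopy R (baryc n) N n (of R (S := Lin (Splx n)) (vert n))))

lemma of_vert_face {n : ℕ} (j : Fin (n + 1)) :
    of R (S := Lin (Splx (n + 1))) ((Lin (Splx (n + 1))).face j (vert (n + 1))) =
      (Lin.push (faceMap j)).map R n (of R (S := Lin (Splx n)) (vert n)) := by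
  rw [Hom.map_of]
  exact congrArg (of R (S := Lin (Splx (n + 1)))) (faceMap_vert j).symm

lemma real_vert (n : ℕ) : (Combs.real (Splx n)).map R n (of R (S := Lin (Splx n)) (vert n)) =
    of R (S := Sing (Splx n)) (ContinuousMap.id _) := by
  rw [Hom.map_of]
  exact congrArg (of R (S := Sing (Splx n))) (comb_vert n)

variable {R}

lemma d_subHomotopy (N : ℕ) {n : ℕ} (c : (Sing Y).Chain R (n + 1)) :
    d R (n + 1) (subHomotopy R N (n + 1) c) =
      c - sub R N (n + 1) c - subHomotopy R N n (d R n c) := by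
  have : (d R (n + 1)).comp (subHomotopy R N (n + 1)) =
      LinearMap.id - sub R (Y := Y) N (n + 1) - (subHomotopy R N n).comp (d R n) := by
    refine chain_hom_ext fun σ => ?_
    simp only [LinearMap.comp_apply, LinearMap.sub_apply, LinearMap.id_apply, sub, subHomotopy,
      lift_of, Hom.d_map, Lin.d_sdIterHomotopy, map_sub, real_vert]
    congr 1
    · congr 1
      simp [push]
    · simp only [d_of, map_sum, map_smul, lift_of]
      refine Finset.sum_congr rfl fun j _ => ?_
      rw [of_vert_face, ← Lin.map_sdIterHomotopy R (faceMap j) _ _ (faceMap_baryc j),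
        ← map_real_push, ← push_comp_map]
  exact LinearMap.congr_fun this c

/-! ### Chains supported in a subset -/

lemma map_mem_of_supported {S : FaceSet} {n : ℕ} {M : Type} [AddCommGroup M] [Module R M]
    (f : S.Chain R n →ₗ[R] M) (P : Submodule R M) {s : Set (S.obj n)}
    (h : ∀ σ ∈ s, f (of R σ) ∈ P) {c : S.Chain R n} (hc : c ∈ Finsupp.supported R R s) :
    f c ∈ P := by
  rw [Finsupp.supported_eq_span_single] at hc
  refine (Submodule.span_le (p := P.comap f)).2 ?_ hc
  rintro _ ⟨w, hw, rfl⟩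
  exact h w hw

variable (R) in
/-- The chains of simplices contained in a subset. -/
def supp (A : Set Y) (n : ℕ) : Submodule R ((Sing Y).Chain R n) :=
  Finsupp.supported R R {σ : C(Splx n, Y) | ∀ x, σ x ∈ A}

lemma of_mem_supp {A : Set Y} {n : ℕ} {σ : C(Splx n, Y)} (h : ∀ x, σ x ∈ A) :
    of R (S := Sing Y) σ ∈ supp R A n :=
  Finsupp.single_mem_supported R 1 h

lemma map_mem_supp {A : Set Y} {f : C(X, Y)} (h : ∀ x, f x ∈ A) {n : ℕ}
    (c : (Sing X).Chain R n) : (push f).map R n c ∈ supp R A n := by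
  refine chain_induction (p := fun c => (push f).map R n c ∈ supp R A n) c (by simp) ?_ ?_
  · intro a b ha hb
    rw [map_add]
    exact Submodule.add_mem _ ha hb
  · intro r σ
    rw [map_smul, Hom.map_of]
    exact Submodule.smul_mem _ _ (of_mem_supp fun x => h _)

lemma supp_induction {A : Set Y} {n : ℕ} {p : (Sing Y).Chain R n → Prop}
    {c : (Sing Y).Chain R n} (hc : c ∈ supp R A n) (h0 : p 0)
    (ha : ∀ a b, p a → p b → p (a + b))
    (hs : ∀ (r : R) (σ : C(Splx n, Y)), (∀ x, σ x ∈ A) → p (r • of R (S := Sing Y) σ)) : p c := by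
  rw [supp, Finsupp.supported_eq_span_single] at hc
  induction hc using Submodule.span_induction with
  | mem x hx => obtain ⟨σ, hσ, rfl⟩ := hx; simpa [of] using hs 1 σ hσ
  | zero => exact h0
  | add x y _ _ h h' => exact ha _ _ h h'
  | smul a x hx h =>
    rw [← Finsupp.supported_eq_span_single] at hx
    clear h
    rw [← Finsupp.sum_single x, Finsupp.smul_sum, Finsupp.sum]
    have hsub : ∀ σ ∈ x.support, ∀ t, σ t ∈ A := fun σ hσ => (Finsupp.mem_supported R x).1 hx hσ
    refine Finset.sum_induction _ p ha h0 fun σ hσ => ?_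
    have := hs (a * x σ) σ (hsub σ hσ)
    simpa [of] using this

lemma mem_of_supp {A : Set Y} {n : ℕ} {M : Type} [AddCommGroup M] [Module R M]
    (f : (Sing Y).Chain R n →ₗ[R] M) (P : Submodule R M)
    (h : ∀ σ : C(Splx n, Y), (∀ x, σ x ∈ A) → f (of R (S := Sing Y) σ) ∈ P)
    {c : (Sing Y).Chain R n} (hc : c ∈ supp R A n) : f c ∈ P :=
  map_mem_of_supported f P h hc

lemma d_mem_supp {A : Set Y} {n : ℕ} {c : (Sing Y).Chain R (n + 1)} (hc : c ∈ supp R A (n + 1)) :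
    d R n c ∈ supp R A n := by
  refine mem_of_supp (d R n) _ (fun σ hσ => ?_) hc
  rw [d_of]
  exact Submodule.sum_mem _ fun j _ => Submodule.smul_mem _ _ (of_mem_supp fun x => hσ _)

/-- The homotopy never leaves the image of a simplex. Hence chains small for a cover stay small,
which is used to correct boundaries in `exists_small_of_mem_bdry`. -/
lemma subHomotopy_mem_supp {A : Set Y} (N : ℕ) {n : ℕ} {c : (Sing Y).Chain R n}
    (hc : c ∈ supp R A n) : subHomotopy R N n c ∈ supp R A (n + 1) := by
  refine mem_of_supp _ _ (fun σ hσ => ?_) hc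
  rw [subHomotopy, lift_of]
  exact map_mem_supp hσ _

lemma supp_inter (A B : Set Y) (n : ℕ) : supp R A n ⊓ supp R B n = supp R (A ∩ B) n := by
  rw [supp, supp, ← Finsupp.supported_inter, supp]
  congr 1
  ext σ
  simp [forall_and]

/-- The inclusion of a subset. -/
abbrev incl (A : Set Y) : C(A, Y) := ⟨Subtype.val, continuous_subtype_val⟩

lemma exists_of_mem_supp {A : Set Y} {n : ℕ} {c : (Sing Y).Chain R n} (hc : c ∈ supp R A n) :
    ∃ c', (push (incl A)).map R n c' = c := by
  refine supp_induction (p := fun c => ∃ c', (push (incl A)).map R n c' = c) hc ⟨0, by simp⟩ ?_ ?_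
  · rintro _ _ ⟨a, rfl⟩ ⟨b, rfl⟩
    exact ⟨a + b, map_add _ _ _⟩
  · intro r σ hσ
    refine ⟨r • of R (S := Sing A) ⟨fun x => ⟨σ x, hσ x⟩, σ.continuous.subtype_mk _⟩, ?_⟩
    rw [map_smul, Hom.map_of]
    rfl

lemma map_incl_injective (A : Set Y) (n : ℕ) :
    Function.Injective ((push (incl A)).map R n) := by
  have h : (push (incl A)).map R n =
      Finsupp.lmapDomain R R (fun σ : C(Splx n, A) => (incl A).comp σ) := by
    refine chain_hom_ext fun σ => ?_
    rw [Hom.map_of]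
    simp [of]
  rw [h]
  refine Finsupp.mapDomain_injective fun σ τ e => ?_
  refine ContinuousMap.ext fun x => Subtype.ext ?_
  exact congrArg (fun f : C(Splx n, Y) => f x) e

/-! ### Mesh of the subdivision -/

lemma dist_comb_le {m n : ℕ} (v : Fin n → Splx m) (p : Splx m) (r : ℝ)
    (h : ∀ i, dist (v i) p ≤ r) (x : Splx n) : dist (Combs.comb v x) p ≤ r := by
  have hx : ∑ i, x i = 1 := x.2.2
  have h0 : (0 : ℝ) ≤ r := by
    rcases isEmpty_or_nonempty (Fin n) with hn | ⟨⟨i⟩⟩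
    · simp at hx
    · exact dist_nonneg.trans (h i)
  change dist (Combs.comb v x).1 p.1 ≤ r
  rw [dist_pi_le_iff h0]
  intro k
  rw [Real.dist_eq]
  have e : (Combs.comb v x).1 k - p.1 k = ∑ i, x i * (v i k - p k) := by
    simp only [mul_sub, Finset.sum_sub_distrib, ← Finset.sum_mul, hx, one_mul]
    rfl
  rw [e]
  calc |∑ i, x i * (v i k - p k)| ≤ ∑ i, |x i * (v i k - p k)| := Finset.abs_sum_le_sum_abs _ _
    _ ≤ ∑ i, x i * r := by
        refine Finset.sum_le_sum fun i _ => ?_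
        rw [abs_mul, abs_of_nonneg (show 0 ≤ x i from x.2.1 i)]
        refine mul_le_mul_of_nonneg_left ?_ (x.2.1 i)
        have := (dist_pi_le_iff h0).1 (h i) k
        rwa [Real.dist_eq] at this
    _ = r := by rw [← Finset.sum_mul, hx, one_mul]

/-- The vector from the barycenter to `v i` is the average of the `v i - v j` over the `n + 1`
indices `j`, and the term `j = i` vanishes. This produces the factor `n / (n + 1) < 1`. -/
lemma dist_baryc_le {m n : ℕ} (v : Fin (n + 1) → Splx m) (r : ℝ)
    (h : ∀ i j, dist (v i) (v j) ≤ r) (i : Fin (n + 1)) :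
    dist (v i) (baryc m n v) ≤ (n : ℝ) / (n + 1) * r := by
  have h0 : (0 : ℝ) ≤ r := dist_nonneg.trans (h 0 0)
  have hn : (0 : ℝ) < n + 1 := by positivity
  change dist (v i).1 (baryc m n v).1 ≤ _
  rw [dist_pi_le_iff (by positivity)]
  intro k
  rw [Real.dist_eq]
  have e : (v i).1 k - (baryc m n v).1 k =
      ∑ j, ((n : ℝ) + 1)⁻¹ * (v i k - v j k) := by
    have : (baryc m n v).1 k = ∑ j, ((n : ℝ) + 1)⁻¹ * v j k := by
      change ∑ j, (stdSimplex.barycenter : Splx (n + 1)) j * v j k = _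
      refine Finset.sum_congr rfl fun j _ => ?_
      congr 1
      refine (stdSimplex.barycenter_apply (𝕜 := ℝ) j).trans ?_
      simp
    rw [this]
    simp only [mul_sub, Finset.sum_sub_distrib]
    congr 1
    rw [Finset.sum_const, Finset.card_univ, Fintype.card_fin, nsmul_eq_mul]
    push_cast
    rw [← mul_assoc, mul_inv_cancel₀ hn.ne', one_mul]
    rfl
  rw [e, Fin.sum_univ_succAbove _ i]
  simp only [sub_self, mul_zero, zero_add]
  calc |∑ j, ((n : ℝ) + 1)⁻¹ * (v i k - v (i.succAbove j) k)|
      ≤ ∑ j, |((n : ℝ) + 1)⁻¹ * (v i k - v (i.succAbove j) k)| := Finset.abs_sum_le_sum_abs _ _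
    _ ≤ ∑ _j : Fin n, ((n : ℝ) + 1)⁻¹ * r := by
        refine Finset.sum_le_sum fun j _ => ?_
        rw [abs_mul, abs_of_nonneg (by positivity)]
        refine mul_le_mul_of_nonneg_left ?_ (by positivity)
        have := (dist_pi_le_iff h0).1 (h i (i.succAbove j)) k
        rwa [Real.dist_eq] at this
    _ = (n : ℝ) / (n + 1) * r := by
        rw [Finset.sum_const, Finset.card_univ, Fintype.card_fin, nsmul_eq_mul]
        ring

/-- The tuples in the hull of `v` whose points have mutual distance at most `r`. -/
def meshSet {m n k : ℕ} (v : Fin n → Splx m) (r : ℝ) : Set (Fin k → Splx m) :=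
  {w | (∀ i j, dist (w i) (w j) ≤ r) ∧ ∀ i, ∃ x, w i = Combs.comb v x}

/-- The hull condition in `meshSet` carries the induction: a simplex of a subdivided face lies in
the hull of `v`, hence its vertices are within `n / (n + 1) * r` of the new barycenter. For the
empty tuple there is nothing to check. -/
lemma sd_mem_mesh {m : ℕ} : ∀ {n : ℕ} (v : Fin n → Splx m) (r : ℝ),
    (∀ i j, dist (v i) (v j) ≤ r) →
    Lin.sd R (baryc m) n (of R (S := Lin (Splx m)) v) ∈
      Finsupp.supported R R (meshSet (k := n) v ((n - 1 : ℝ) / n * r)) := by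
  intro n
  induction n with
  | zero =>
    intro v r h
    exact Finsupp.single_mem_supported R 1 ⟨fun i => i.elim0, fun i => i.elim0⟩
  | succ n ih =>
    intro v r h
    have h0 : (0 : ℝ) ≤ r := dist_nonneg.trans (h 0 0)
    rw [Lin.sd, lift_of, d_of, map_sum, map_sum]
    refine Submodule.sum_mem _ fun j _ => ?_
    rw [map_smul, map_smul]
    refine Submodule.smul_mem _ _ ?_
    have hj := ih (v ∘ j.succAbove) r fun a b => h _ _
    refine map_mem_of_supported (Lin.cone R (baryc m n v) n) _ (fun w hw => ?_) hj
    rw [Lin.cone_of]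
    refine Finsupp.single_mem_supported R 1 ?_
    have hn : (0 : ℝ) < n + 1 := by positivity
    have hb : ∀ x : Splx (n + 1), dist (Combs.comb v x) (baryc m n v) ≤ n / (n + 1) * r :=
      dist_comb_le v _ _ (dist_baryc_le v r h)
    have hw' : ∀ i, ∃ x : Splx (n + 1), w i = Combs.comb v x := fun i => by
      obtain ⟨x, hx⟩ := hw.2 i
      exact ⟨faceMap j x, by rw [hx, Combs.comb_face]⟩
    -- The factor grows with the number of vertices, so the edges coming from the subdivided face
    -- obey the new bound as well. For `n = 0` the left side is zero because division by zero gives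
    -- zero.
    have hmono : ((n : ℝ) - 1) / n * r ≤ n / (n + 1) * r := by
      refine mul_le_mul_of_nonneg_right ?_ h0
      rcases Nat.eq_zero_or_pos n with rfl | hpos
      · simp
      · have : (0 : ℝ) < n := by exact_mod_cast hpos
        rw [div_le_div_iff₀ this hn]
        nlinarith
    constructor
    · push_cast
      rw [add_sub_cancel_right]
      intro a b
      refine Fin.cases ?_ (fun a => ?_) a <;> refine Fin.cases ?_ (fun b => ?_) b
      · simp only [Fin.cons_zero, dist_self]
        positivity
      · simp only [Fin.cons_zero, Fin.cons_succ]
        obtain ⟨x, hx⟩ := hw' b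
        rw [hx, dist_comm]
        exact hb x
      · simp only [Fin.cons_zero, Fin.cons_succ]
        obtain ⟨x, hx⟩ := hw' a
        rw [hx]
        exact hb x
      · simp only [Fin.cons_succ]
        exact (hw.1 a b).trans hmono
    · intro a
      refine Fin.cases ?_ (fun a => ?_) a
      · exact ⟨stdSimplex.barycenter, by simp [baryc]⟩
      · simpa using hw' a

lemma sdIter_mem_mesh {m n : ℕ} (v : Fin n → Splx m) (r : ℝ) (h : ∀ i j, dist (v i) (v j) ≤ r)
    (N : ℕ) : Lin.sdIter R (baryc m) N n (of R (S := Lin (Splx m)) v) ∈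
      Finsupp.supported R R {w : Fin n → Splx m |
        ∀ i j, dist (w i) (w j) ≤ ((n - 1 : ℝ) / n) ^ N * r} := by
  induction N with
  | zero =>
    refine Finsupp.single_mem_supported R 1 ?_
    simpa using h
  | succ N ih =>
    rw [Lin.sdIter, LinearMap.comp_apply]
    refine map_mem_of_supported (Lin.sd R (baryc m) n) _ (fun w hw => ?_) ih
    refine Finsupp.supported_mono ?_ (sd_mem_mesh w _ hw)
    intro u hu i j
    rw [pow_succ', mul_assoc]
    exact hu.1 i j

/-- Sufficiently fine subdivisions of a chain are sums of chains in two open sets which cover. -/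
lemma exists_sub_mem {U V : Set Y} (hU : IsOpen U) (hV : IsOpen V) (hUV : U ∪ V = Set.univ)
    {n : ℕ} (c : (Sing Y).Chain R n) :
    ∃ N, ∀ N' ≥ N, sub R N' n c ∈ supp R U n ⊔ supp R V n := by
  refine chain_induction (p := fun c => ∃ N, ∀ N' ≥ N, sub R N' n c ∈ supp R U n ⊔ supp R V n)
    c ⟨0, by simp⟩ ?_ ?_
  · rintro a b ⟨N, hN⟩ ⟨N', hN'⟩
    refine ⟨max N N', fun k hk => ?_⟩
    rw [map_add]
    exact Submodule.add_mem _ (hN k (le_trans (le_max_left _ _) hk))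
      (hN' k (le_trans (le_max_right _ _) hk))
  · intro r σ
    rcases n.eq_zero_or_pos with rfl | hn
    · refine ⟨0, fun k _ => ?_⟩
      have hs : supp R U 0 = (⊤ : Submodule R ((Sing Y).Chain R 0)) := by
        rw [supp, ← Finsupp.supported_univ]
        congr 1
        ext σ
        simp
      rw [hs, top_sup_eq]
      trivial
    -- A Lebesgue number of the pulled back cover of the standard simplex: once the mesh is below
    -- `δ`, each small simplex is mapped into one of the two open sets.
    · obtain ⟨δ, hδ, hball⟩ := lebesgue_number_lemma_of_metric (ι := Bool)
        (c := fun b => if b then σ ⁻¹' U else σ ⁻¹' V) (isCompact_univ (X := Splx n))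
        (by rintro (_ | _)
            · simpa using hV.preimage σ.continuous
            · simpa using hU.preimage σ.continuous)
        (by
          intro x _
          have : σ x ∈ U ∪ V := hUV ▸ Set.mem_univ _
          rcases this with h | h
          · exact Set.mem_iUnion.2 ⟨true, by simpa using h⟩
          · exact Set.mem_iUnion.2 ⟨false, by simpa using h⟩)
      have hn' : (0 : ℝ) < n := by exact_mod_cast hn
      have hn1 : (1 : ℝ) ≤ n := by exact_mod_cast hn
      have hlt : ((n : ℝ) - 1) / n < 1 := by rw [div_lt_one hn']; linarith
      have h0 : 0 ≤ ((n : ℝ) - 1) / n := div_nonneg (by linarith) hn'.le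
      have hdist : ∀ i j, dist (vert n i) (vert n j) ≤ 1 := by
        intro i j
        change dist (vert n i).1 (vert n j).1 ≤ 1
        rw [dist_pi_le_iff zero_le_one]
        intro k
        have h1 := mem_Icc_of_mem_stdSimplex (vert n i).2 k
        have h2 := mem_Icc_of_mem_stdSimplex (vert n j).2 k
        rw [Real.dist_eq, abs_le]
        constructor <;> linarith [h1.1, h1.2, h2.1, h2.2]
      obtain ⟨N, hN⟩ := exists_pow_lt_of_lt_one hδ hlt
      refine ⟨N, fun k hk => ?_⟩
      rw [map_smul]
      refine Submodule.smul_mem _ _ ?_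
      rw [sub, lift_of]
      have hmem := sdIter_mem_mesh (R := R) (vert n) 1 hdist k
      refine map_mem_of_supported ((push σ).map R n ∘ₗ (Combs.real _).map R n) _
        (fun w hw => ?_) hmem
      have hw' : ∀ x, Combs.comb w x ∈ Metric.ball (w ⟨0, hn⟩) δ := by
        intro x
        rw [Metric.mem_ball]
        refine lt_of_le_of_lt (dist_comb_le w _ _ (fun i => hw i _) x) ?_
        rw [mul_one]
        exact lt_of_le_of_lt (pow_le_pow_of_le_one h0 hlt.le hk) hN
      obtain ⟨b, hb⟩ := hball (w ⟨0, hn⟩) trivial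
      rw [LinearMap.comp_apply, Hom.map_of, Hom.map_of]
      cases b with
      | true => exact Submodule.mem_sup_left (of_mem_supp fun x => hb (hw' x))
      | false => exact Submodule.mem_sup_right (of_mem_supp fun x => hb (hw' x))

/-! ### Mayer-Vietoris for covers by two open sets -/

lemma exists_mem_supp_of_acyc {A : Set Y} {n : ℕ} (hA : Acyc R A n) {c : (Sing Y).Chain R n}
    (hc : c ∈ supp R A n) (hc' : c ∈ cyc R _ n) : ∃ w ∈ supp R A (n + 1), d R n w = c := by
  obtain ⟨c, rfl⟩ := exists_of_mem_supp hc
  have : c ∈ cyc R _ n := by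
    cases n with
    | zero => trivial
    | succ n =>
      refine map_incl_injective A n ?_
      rw [← Hom.d_map, map_zero]
      exact hc'
  obtain ⟨w, rfl⟩ := hA c this
  exact ⟨_, map_mem_supp (fun x => x.2) w, Hom.d_map _ _ _⟩

variable {U V : Set Y} (hU : IsOpen U) (hV : IsOpen V) (hUV : U ∪ V = Set.univ)

include hU hV hUV

lemma exists_small_cycle {n : ℕ} {z : (Sing Y).Chain R n} (hz : z ∈ cyc R _ n) :
    ∃ a ∈ supp R U n, ∃ b ∈ supp R V n, z - (a + b) ∈ bdry R _ n := by
  obtain ⟨N, hN⟩ := exists_sub_mem (R := R) hU hV hUV z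
  obtain ⟨a, ha, b, hb, hab⟩ := Submodule.mem_sup.1 (hN N le_rfl)
  refine ⟨a, ha, b, hb, ?_⟩
  rw [hab]
  cases n with
  | zero =>
    have : sub R N 0 = (LinearMap.id : (Sing Y).Chain R 0 →ₗ[R] _) := by
      refine chain_hom_ext fun σ => ?_
      have e : ∀ N, Lin.sdIter R (baryc 0) N 0 = LinearMap.id := by
        intro N
        induction N with
        | zero => rfl
        | succ N ih => rw [Lin.sdIter, ih]; rfl
      rw [sub, lift_of, e, LinearMap.id_apply, real_vert]
      simp [push]
    rw [this, LinearMap.id_apply, sub_self]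
    exact Submodule.zero_mem _
  | succ n =>
    refine ⟨subHomotopy R N (n + 1) z, ?_⟩
    rw [d_subHomotopy, show d R n z = 0 from hz, map_zero, sub_zero]

/-- If `a + b = d w`, subdivide `w`. This changes the boundary by the boundary of `subHomotopy (a +
b)`, which is again a chain in `U` plus a chain in `V` and can be added back. -/
lemma exists_small_of_mem_bdry {n : ℕ} {a b : (Sing Y).Chain R n} (ha : a ∈ supp R U n)
    (hb : b ∈ supp R V n) (hab : a + b ∈ bdry R _ n) :
    ∃ u ∈ supp R U (n + 1), ∃ v ∈ supp R V (n + 1), d R n (u + v) = a + b := by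
  obtain ⟨w, hw⟩ := hab
  obtain ⟨N, hN⟩ := exists_sub_mem (R := R) hU hV hUV w
  obtain ⟨u, hu, v, hv, huv⟩ := Submodule.mem_sup.1 (hN N le_rfl)
  refine ⟨u + subHomotopy R N n a, Submodule.add_mem _ hu (subHomotopy_mem_supp N ha),
    v + subHomotopy R N n b, Submodule.add_mem _ hv (subHomotopy_mem_supp N hb), ?_⟩
  have e : u + subHomotopy R N n a + (v + subHomotopy R N n b) =
      sub R N (n + 1) w + subHomotopy R N n (a + b) := by
    rw [map_add, ← huv]
    abel
  have h2 := congrArg (d R n) (d_subHomotopy N w)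
  rw [d_d, map_sub, map_sub, hw] at h2
  rw [e, map_add]
  rw [eq_comm, sub_eq_zero, sub_eq_iff_eq_add] at h2
  rw [add_comm]
  exact h2.symm

/-- For a small cycle `a + b`, the chain `d a = - d b` lies in the intersection and bounds some `c`
there. Then `a - c` and `b + c` are cycles in the two acyclic pieces. -/
lemma acyc_of_cover (AU : ∀ n, Acyc R U n) (AV : ∀ n, Acyc R V n) {n : ℕ}
    (h : Acyc R ↥(U ∩ V) n) : Acyc R Y (n + 1) := by
  intro z hz
  obtain ⟨a, ha, b, hb, hab⟩ := exists_small_cycle hU hV hUV hz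
  have hcyc : d R n (a + b) = 0 := by
    have h1 : z - (a + b) ∈ cyc R _ (n + 1) := bdry_le_cyc hab
    have h2 := Submodule.sub_mem _ hz h1
    rwa [sub_sub_cancel] at h2
  have hda : d R n a = - d R n b := by rwa [map_add, ← eq_neg_iff_add_eq_zero] at hcyc
  obtain ⟨c, hc, hdc⟩ := exists_mem_supp_of_acyc h (c := d R n a) (by
    rw [← supp_inter]
    refine ⟨d_mem_supp ha, ?_⟩
    rw [hda]
    exact Submodule.neg_mem _ (d_mem_supp hb)) (bdry_le_cyc ⟨a, rfl⟩)
  rw [← supp_inter] at hc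
  obtain ⟨w1, -, h1⟩ := exists_mem_supp_of_acyc (AU (n + 1)) (Submodule.sub_mem _ ha hc.1)
    (show d R n (a - c) = 0 by rw [map_sub, hdc, sub_self])
  obtain ⟨w2, -, h2⟩ := exists_mem_supp_of_acyc (AV (n + 1)) (Submodule.add_mem _ hb hc.2)
    (show d R n (b + c) = 0 by rw [map_add, hdc, hda, add_neg_cancel])
  have : a + b ∈ bdry R (Sing Y) (n + 1) := ⟨w1 + w2, by rw [map_add, h1, h2]; abel⟩
  simpa using Submodule.add_mem _ hab this

/-- The new generator is the difference of two fillings of the old generator `z`, one in each piece.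
If it bounded, a small filling `u + v` would give `a - d u = b + d v`, a chain in the intersection
which fills `z`. -/
lemma homLine_of_cover (AU : ∀ n, Acyc R U n) (AV : ∀ n, Acyc R V n) {n : ℕ}
    (h : HomLine R ↥(U ∩ V) n) : HomLine R Y (n + 1) := by
  obtain ⟨z, hz, hzn, hgen⟩ := h
  have hz' := map_mem_cyc (push (incl (U ∩ V))) hz
  have hzs : (push (incl (U ∩ V))).map R n z ∈ supp R (U ∩ V) n :=
    map_mem_supp (fun x => x.2) z
  have hzs' := hzs
  rw [← supp_inter] at hzs'
  obtain ⟨a, ha, hda⟩ := exists_mem_supp_of_acyc (AU n) hzs'.1 hz'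
  obtain ⟨b, hb, hdb⟩ := exists_mem_supp_of_acyc (AV n) hzs'.2 hz'
  refine ⟨a + -b, show d R n (a + -b) = 0 by rw [map_add, map_neg, hda, hdb, add_neg_cancel],
    fun hbd => hzn ?_, fun w hw => ?_⟩
  · obtain ⟨u, hu, v, hv, huv⟩ := exists_small_of_mem_bdry hU hV hUV ha
      (Submodule.neg_mem _ hb) hbd
    have e : a - d R _ u = b + d R _ v := by
      rw [map_add] at huv
      calc a - d R _ u = (a + -b) + b - d R _ u := by abel
        _ = b + d R _ v := by rw [← huv]; abel
    have hc : a - d R _ u ∈ supp R (U ∩ V) (n + 1) := by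
      rw [← supp_inter]
      refine ⟨Submodule.sub_mem _ ha (d_mem_supp hu), ?_⟩
      rw [e]
      exact Submodule.add_mem _ hb (d_mem_supp hv)
    obtain ⟨c, hc'⟩ := exists_of_mem_supp hc
    refine ⟨c, map_incl_injective _ _ ?_⟩
    rw [← Hom.d_map, hc', map_sub, d_d, sub_zero, hda]
  · obtain ⟨a', ha', b', hb', hab⟩ := exists_small_cycle hU hV hUV hw
    have hcyc : d R n (a' + b') = 0 := by
      have h1 : w - (a' + b') ∈ cyc R _ (n + 1) := bdry_le_cyc hab
      have h2 := Submodule.sub_mem _ hw h1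
      rwa [sub_sub_cancel] at h2
    have hda' : d R n a' = - d R n b' := by rwa [map_add, ← eq_neg_iff_add_eq_zero] at hcyc
    have hs : d R n a' ∈ supp R (U ∩ V) n := by
      rw [← supp_inter]
      refine ⟨d_mem_supp ha', ?_⟩
      rw [hda']
      exact Submodule.neg_mem _ (d_mem_supp hb')
    obtain ⟨c, hc⟩ := exists_of_mem_supp hs
    have hcc : c ∈ cyc R _ n := by
      cases n with
      | zero => trivial
      | succ n =>
        refine map_incl_injective (U ∩ V) n ?_
        rw [← Hom.d_map, hc, d_d, map_zero]
    obtain ⟨r, e, he⟩ := hgen c hcc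
    have he' : d R n ((push (incl (U ∩ V))).map R (n + 1) e) = d R n a' - r • d R n a := by
      rw [Hom.d_map, he, map_sub, map_smul, hc, hda]
    have hes : (push (incl (U ∩ V))).map R (n + 1) e ∈ supp R (U ∩ V) (n + 1) :=
      map_mem_supp (fun x => x.2) e
    rw [← supp_inter] at hes
    set E := (push (incl (U ∩ V))).map R (n + 1) e
    obtain ⟨w1, -, h1⟩ := exists_mem_supp_of_acyc (AU (n + 1))
      (Submodule.sub_mem _ (Submodule.sub_mem _ ha' (Submodule.smul_mem _ r ha)) hes.1)
      (show d R n (a' - r • a - E) = 0 by rw [map_sub, map_sub, map_smul, he', sub_self])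
    obtain ⟨w2, -, h2⟩ := exists_mem_supp_of_acyc (AV (n + 1))
      (Submodule.add_mem _ (Submodule.add_mem _ hb' (Submodule.smul_mem _ r hb)) hes.2)
      (show d R n (b' + r • b + E) = 0 by
        rw [map_add, map_add, map_smul, he', hda, hdb, hda']
        abel)
    refine ⟨r, ?_⟩
    have h3 : a' + b' - r • (a + -b) ∈ bdry R (Sing Y) (n + 1) := ⟨w1 + w2, by
      rw [map_add, h1, h2, smul_add, smul_neg]; abel⟩
    have := Submodule.add_mem _ hab h3
    rwa [sub_add_sub_cancel] at this

end

section
open Opposite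

/-! ### Cohomology as the dual of homology -/

/-- The duality functor. -/
abbrev dualFunctor : ModuleCat.{0} ℚ ⥤ (ModuleCat.{0} ℚ)ᵒᵖ :=
  ((linearYoneda ℚ (ModuleCat.{0} ℚ)).obj (ModuleCat.of ℚ ℚ)).rightOp

/-- A vector space is an injective module, so every functional vanishing on the image of `S.f`
extends over `S.g`. -/
lemma dualFunctor_map_exact (S : ShortComplex (ModuleCat.{0} ℚ)) (hS : S.Exact) :
    (S.map dualFunctor).Exact := by
  rw [← ShortComplex.exact_unop_iff, ShortComplex.moduleCat_exact_iff]
  intro φ hφ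
  have hφ' : S.f ≫ (show S.X₂ ⟶ ModuleCat.of ℚ ℚ from φ) = 0 := hφ
  have : Module.Injective ℚ ℚ := Module.injective_of_isSemisimpleRing ℚ ℚ
  have : Injective (ModuleCat.of ℚ ℚ) := Module.injective_object_of_injective_module ℚ ℚ
  exact ⟨hS.descToInjective _ hφ', hS.comp_descToInjective _ hφ'⟩

instance : dualFunctor.PreservesHomology :=
  Functor.preservesHomology_of_map_exact _ dualFunctor_map_exact

lemma isIso_cohomology_map_of_quasiIso {Y Z : TopCat.{0}} (f : Y ⟶ Z) [QuasiIso (chains.map f)]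
    (m : ℕ) : IsIso ((cohomology m).map f.op) := by
  have h1 : QuasiIso ((dualFunctor.mapHomologicalComplex (ComplexShape.down ℕ)).map
    (chains.map f)) := inferInstance
  have h2 : QuasiIso ((HomologicalComplex.unopFunctor (ModuleCat.{0} ℚ)
    (ComplexShape.down ℕ)).map ((dualFunctor.mapHomologicalComplex (ComplexShape.down ℕ)).map
    (chains.map f)).op) := inferInstance
  have h3 := (quasiIsoAt_iff_isIso_homologyMap _ m).1 (h2.quasiIsoAt m)
  exact h3

/-- The cohomology of the dual complex is the dual of the homology. -/
def dualHomologyIso (C : ChainComplex (ModuleCat.{0} ℚ) ℕ) (m : ℕ) :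
    (dual.obj (op C)).homology m ≅ ModuleCat.of ℚ (C.homology m ⟶ ModuleCat.of ℚ ℚ) :=
  (((dualFunctor.mapHomologicalComplex (ComplexShape.down ℕ)).obj C).homologyUnop m) ≪≫
    ((C.sc m).mapHomologyIso dualFunctor).symm.unop

lemma subsingleton_homology_of_dual {C : ChainComplex (ModuleCat.{0} ℚ) ℕ} {m : ℕ}
    (h : Subsingleton ((dual.obj (op C)).homology m)) : Subsingleton (C.homology m) := by
  have h1 : Subsingleton (C.homology m ⟶ ModuleCat.of ℚ ℚ) :=
    (dualHomologyIso C m).toLinearEquiv.symm.toEquiv.subsingleton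
  refine ⟨fun x y => ?_⟩
  rw [← sub_eq_zero, ← Module.forall_dual_apply_eq_zero_iff ℚ]
  intro φ
  have := Subsingleton.elim (ModuleCat.ofHom φ) (0 : C.homology m ⟶ ModuleCat.of ℚ ℚ)
  exact LinearMap.congr_fun (ModuleCat.hom_ext_iff.1 this) _

/-- A space whose dual is a line is a line. No finiteness is needed in advance, since `finrank` is
zero for an infinite-dimensional space and for its dual. -/
lemma exists_generator_homology_of_dual {C : ChainComplex (ModuleCat.{0} ℚ) ℕ} {m : ℕ}
    (h : Nonempty ((dual.obj (op C)).homology m ≃ₗ[ℚ] ℚ)) :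
    ∃ v : C.homology m, v ≠ 0 ∧ ∀ w, ∃ a : ℚ, a • v = w := by
  obtain ⟨e⟩ := h
  have e' : Module.Dual ℚ (C.homology m) ≃ₗ[ℚ] ℚ :=
    (ModuleCat.homLinearEquiv (S := ℚ)).symm.trans
      ((dualHomologyIso C m).toLinearEquiv.symm.trans e)
  have h1 : Module.finrank ℚ (C.homology m) = 1 := by
    rw [← Subspace.dual_finrank_eq, e'.finrank_eq, Module.finrank_self]
  exact (finrank_eq_one_iff'.1 h1)

/-! ### Homology classes of cycles in complexes of vector spaces -/

/-- The homology class of `z` is `h`. -/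
def IsClass (K : ChainComplex (ModuleCat.{0} ℚ) ℕ) (m : ℕ) (z : K.X m) (h : K.homology m) : Prop :=
  ∃ w : K.cycles m, K.iCycles m w = z ∧ K.homologyπ m w = h

section
variable {K L : ChainComplex (ModuleCat.{0} ℚ) ℕ} {m : ℕ}

lemma IsClass.d_eq_zero {z : K.X m} {h : K.homology m} (H : IsClass K m z h) (j : ℕ) :
    K.d m j z = 0 := by
  obtain ⟨w, rfl, -⟩ := H
  rw [← ModuleCat.comp_apply, K.iCycles_d]
  rfl

lemma exists_isClass_of_cycle (z : K.X m) (hz : ∀ j, K.d m j z = 0) : ∃ h, IsClass K m z h := by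
  let k : ModuleCat.of ℚ ℚ ⟶ K.X m := ModuleCat.ofHom (LinearMap.toSpanSingleton ℚ _ z)
  have hk : k ≫ K.d m ((ComplexShape.down ℕ).next m) = 0 := by
    refine ModuleCat.hom_ext (LinearMap.ext_ring ?_)
    simpa [k] using hz _
  refine ⟨_, K.liftCycles k _ rfl hk (1 : ℚ), ?_, rfl⟩
  rw [← ModuleCat.comp_apply, K.liftCycles_i]
  simp [k]

lemma exists_isClass (h : K.homology m) : ∃ z, IsClass K m z h := by
  obtain ⟨w, hw⟩ := (ModuleCat.epi_iff_surjective (K.homologyπ m)).1 inferInstance h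
  exact ⟨_, w, rfl, hw⟩

lemma IsClass.sub_smul {z z' : K.X m} {h h' : K.homology m} (H : IsClass K m z h)
    (H' : IsClass K m z' h') (a : ℚ) : IsClass K m (z - a • z') (h - a • h') := by
  obtain ⟨w, rfl, rfl⟩ := H
  obtain ⟨w', rfl, rfl⟩ := H'
  exact ⟨w - a • w', by simp, by simp⟩

lemma IsClass.eq_zero_iff {z : K.X m} {h : K.homology m} (H : IsClass K m z h) :
    h = 0 ↔ ∃ w : K.X (m + 1), K.d (m + 1) m w = z := by
  obtain ⟨w, rfl, rfl⟩ := H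
  have hp : (ComplexShape.down ℕ).prev m = m + 1 := by simp
  have ex := ShortComplex.exact_of_g_is_cokernel
    (ShortComplex.mk _ _ (K.toCycles_comp_homologyπ (m + 1) m)) (K.homologyIsCokernel _ _ hp)
  rw [ShortComplex.moduleCat_exact_iff] at ex
  constructor
  · intro h0
    obtain ⟨u, hu⟩ := ex w h0
    refine ⟨u, ?_⟩
    rw [← hu]
    dsimp only
    rw [← ModuleCat.comp_apply, K.toCycles_i]
  · rintro ⟨u, hu⟩
    have : K.toCycles (m + 1) m u = w := by
      refine (ModuleCat.mono_iff_injective (K.iCycles m)).1 inferInstance ?_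
      rw [← ModuleCat.comp_apply, K.toCycles_i, hu]
    rw [← this, ← ModuleCat.comp_apply, K.toCycles_comp_homologyπ]
    rfl

lemma IsClass.map (F : K ⟶ L) {z : K.X m} {h : K.homology m} (H : IsClass K m z h) :
    IsClass L m (F.f m z) (HomologicalComplex.homologyMap F m h) := by
  obtain ⟨w, rfl, rfl⟩ := H
  refine ⟨HomologicalComplex.cyclesMap F m w, ?_, ?_⟩
  · rw [← ModuleCat.comp_apply, HomologicalComplex.cyclesMap_i]
    rfl
  · rw [← ModuleCat.comp_apply, ← HomologicalComplex.homologyπ_naturality]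
    rfl

lemma quasiIsoAt_of_cycles (F : K ⟶ L)
    (hinj : ∀ z : K.X m, (∀ j, K.d m j z = 0) → (∃ w : L.X (m + 1), L.d (m + 1) m w = F.f m z) →
      ∃ w : K.X (m + 1), K.d (m + 1) m w = z)
    (hsurj : ∀ y : L.X m, (∀ j, L.d m j y = 0) → ∃ z : K.X m, (∀ j, K.d m j z = 0) ∧
      ∃ w : L.X (m + 1), L.d (m + 1) m w = y - F.f m z) : QuasiIsoAt F m := by
  rw [quasiIsoAt_iff_isIso_homologyMap, ConcreteCategory.isIso_iff_bijective]
  constructor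
  · rw [injective_iff_map_eq_zero]
    intro h h0
    obtain ⟨z, hz⟩ := exists_isClass h
    exact hz.eq_zero_iff.2 (hinj z hz.d_eq_zero ((hz.map F).eq_zero_iff.1 h0))
  · intro h
    obtain ⟨y, hy⟩ := exists_isClass h
    obtain ⟨z, hz, hw⟩ := hsurj y hy.d_eq_zero
    obtain ⟨g, hg⟩ := exists_isClass_of_cycle z hz
    refine ⟨g, ?_⟩
    have := (hy.sub_smul (hg.map F) 1).eq_zero_iff.2 (by simpa using hw)
    rw [one_smul, sub_eq_zero] at this
    exact this.symm

end

/-! ### Comparison of the singular chain complex with chains of singular simplices -/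

section
variable (Y : Type) [TopologicalSpace Y] {Z : Type} [TopologicalSpace Z]

/-- The simplices of the singular simplicial set. -/
abbrev simplexEquiv (m : ℕ) :
    (TopCat.toSSet.obj (TopCat.of Y)).obj (op (SimplexCategory.mk m)) ≃ (Sing Y).obj (m + 1) :=
  (TopCat.of Y).toSSetObjEquiv (op (SimplexCategory.mk m))

/-- The chain of a simplex in the singular chain complex. -/
def singι (m : ℕ) (σ : (Sing Y).obj (m + 1)) : (chains.obj (TopCat.of Y)).X m :=
  ((TopCat.toSSet.obj (TopCat.of Y)).ιChainComplex (R := ModuleCat.of ℚ ℚ)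
    ((simplexEquiv Y m).symm σ)).hom (1 : ℚ)

lemma chains_hom_ext {m : ℕ} {M : Type} [AddCommGroup M] [Module ℚ M]
    {f g : (chains.obj (TopCat.of Y)).X m →ₗ[ℚ] M} (h : ∀ σ, f (singι Y m σ) = g (singι Y m σ)) :
    f = g := by
  have : ModuleCat.ofHom f = ModuleCat.ofHom g := by
    refine SSet.chainComplex_hom_ext fun x => ModuleCat.hom_ext (LinearMap.ext_ring ?_)
    obtain ⟨σ, rfl⟩ := (simplexEquiv Y m).symm.surjective x
    exact h σ
  exact ModuleCat.hom_ext_iff.1 this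

/-- The singular chains as finitely supported functions. -/
def toChain (m : ℕ) : (chains.obj (TopCat.of Y)).X m →ₗ[ℚ] (Sing Y).Chain ℚ (m + 1) :=
  (((TopCat.toSSet.obj (TopCat.of Y)).isColimitChainComplexXCofan (ModuleCat.of ℚ ℚ) m).desc
    (Limits.Cofan.mk (ModuleCat.of ℚ ((Sing Y).Chain ℚ (m + 1))) fun x =>
      ModuleCat.ofHom (LinearMap.toSpanSingleton ℚ _
        (of ℚ (S := Sing Y) (simplexEquiv Y m x))))).hom

lemma toChain_singι {m : ℕ} (σ : (Sing Y).obj (m + 1)) :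
    toChain Y m (singι Y m σ) = of ℚ (S := Sing Y) σ := by
  have h := ((TopCat.toSSet.obj (TopCat.of Y)).isColimitChainComplexXCofan
    (ModuleCat.of ℚ ℚ) m).fac (Limits.Cofan.mk (ModuleCat.of ℚ ((Sing Y).Chain ℚ (m + 1))) fun x =>
      ModuleCat.ofHom (LinearMap.toSpanSingleton ℚ _
        (of ℚ (S := Sing Y) (simplexEquiv Y m x)))) ⟨(simplexEquiv Y m).symm σ⟩
  have h' := LinearMap.congr_fun (ModuleCat.hom_ext_iff.1 h) (1 : ℚ)
  refine h'.trans ?_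
  simp

/-- The singular chain complex consists of the chains of singular simplices. -/
def chainEquiv (m : ℕ) : (chains.obj (TopCat.of Y)).X m ≃ₗ[ℚ] (Sing Y).Chain ℚ (m + 1) :=
  LinearEquiv.ofLinearMap (toChain Y m) (lift ℚ (singι Y m))
    (chain_hom_ext fun σ => by simp [toChain_singι])
    (chains_hom_ext Y fun σ => by simp [toChain_singι])

lemma chainEquiv_singι {m : ℕ} (σ : (Sing Y).obj (m + 1)) :
    chainEquiv Y m (singι Y m σ) = of ℚ (S := Sing Y) σ := toChain_singι Y σ

lemma d_singι {m : ℕ} (σ : (Sing Y).obj (m + 2)) :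
    (chains.obj (TopCat.of Y)).d (m + 1) m (singι Y (m + 1) σ) =
      ∑ j : Fin (m + 2), (-1 : ℚ) ^ (j : ℕ) • singι Y m ((Sing Y).face j σ) := by
  have h := (TopCat.toSSet.obj (TopCat.of Y)).ιChainComplex_d (R := ModuleCat.of ℚ ℚ)
    ((simplexEquiv Y (m + 1)).symm σ)
  have h' := LinearMap.congr_fun (ModuleCat.hom_ext_iff.1 h) (1 : ℚ)
  refine h'.trans ?_
  rw [ModuleCat.hom_sum, LinearMap.sum_apply]
  refine Finset.sum_congr rfl fun j _ => ?_
  rcases Nat.even_or_odd (j : ℕ) with hj | hj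
  · rw [hj.neg_one_pow, hj.neg_one_pow, one_smul, one_smul]
    rfl
  · rw [hj.neg_one_pow, hj.neg_one_pow, neg_smul, neg_smul, one_smul, one_smul]
    rfl

lemma chainEquiv_d {m : ℕ} (z : (chains.obj (TopCat.of Y)).X (m + 1)) :
    chainEquiv Y m ((chains.obj (TopCat.of Y)).d (m + 1) m z) =
      d ℚ (m + 1) (chainEquiv Y (m + 1) z) := by
  have : (chainEquiv Y m).toLinearMap.comp ((chains.obj (TopCat.of Y)).d (m + 1) m).hom =
      (d ℚ (m + 1)).comp (chainEquiv Y (m + 1)).toLinearMap := by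
    refine chains_hom_ext Y fun σ => ?_
    simp only [LinearMap.comp_apply, LinearEquiv.coe_coe]
    rw [chainEquiv_singι, d_of]
    refine (congrArg _ (d_singι Y σ)).trans ?_
    simp only [map_sum, map_smul, chainEquiv_singι]
  exact LinearMap.congr_fun this z

lemma chainEquiv_map {m : ℕ} (f : C(Y, Z)) (z : (chains.obj (TopCat.of Y)).X m) :
    chainEquiv Z m ((chains.map (TopCat.ofHom f)).f m z) =
      (push f).map ℚ (m + 1) (chainEquiv Y m z) := by
  have : (chainEquiv Z m).toLinearMap.comp ((chains.map (TopCat.ofHom f)).f m).hom =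
      ((push f).map ℚ (m + 1)).comp (chainEquiv Y m).toLinearMap := by
    refine chains_hom_ext Y fun σ => ?_
    simp only [LinearMap.comp_apply, LinearEquiv.coe_coe]
    rw [chainEquiv_singι, Hom.map_of, ← chainEquiv_singι]
    congr 1
    have h := SSet.ι_chainComplexMap_f _ _ (TopCat.toSSet.map (TopCat.ofHom f)) (ModuleCat.of ℚ ℚ)
      ((simplexEquiv Y m).symm σ)
    exact LinearMap.congr_fun (ModuleCat.hom_ext_iff.1 h) (1 : ℚ)
  exact LinearMap.congr_fun this z

end

end

/-! ### From reduced homology to absolute and relative cohomology -/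

section
open Opposite

section
variable {Y Z : Type} [TopologicalSpace Y] [TopologicalSpace Z]

/-- The unique simplex without vertices. -/
def emptySimplex (Y : Type) [TopologicalSpace Y] : (Sing Y).obj 0 :=
  (⟨fun x => isEmptyElim x, continuous_of_const fun x => isEmptyElim x⟩ : C(Splx 0, Y))

lemma eq_emptySimplex (σ : (Sing Y).obj 0) : σ = emptySimplex Y :=
  ContinuousMap.ext fun x => isEmptyElim x

lemma chain_zero_eq {R : Type} [CommRing R] (c : (Sing Y).Chain R 0) :
    ∃ a : R, c = a • of R (emptySimplex Y) := by
  refine chain_induction (p := fun c => ∃ a : R, c = a • of R (emptySimplex Y)) c ⟨0, by simp⟩ ?_ ?_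
  · rintro _ _ ⟨a, rfl⟩ ⟨b, rfl⟩
    exact ⟨a + b, by rw [add_smul]⟩
  · intro r s
    exact ⟨r, by rw [eq_emptySimplex s]⟩

lemma map_zero_injective {R : Type} [CommRing R] (f : C(Y, Z)) :
    Function.Injective ((push f).map R 0) := by
  rw [injective_iff_map_eq_zero]
  intro c hc
  obtain ⟨a, rfl⟩ := chain_zero_eq c
  rw [map_smul, Hom.map_of, eq_emptySimplex ((push f).app (emptySimplex Y)), of,
    Finsupp.smul_single', Finsupp.single_eq_zero, mul_one] at hc
  simp [hc]

/-- The singular simplex with one vertex at `y`. -/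
abbrev pt (y : Y) : (Sing Y).obj 1 := ContinuousMap.const (Splx 1) y

lemma d_pt {R : Type} [CommRing R] (y : Y) :
    d R 0 (of R (S := Sing Y) (n := 1) (pt y)) = of R (emptySimplex Y) := by
  rw [d_of, Fin.sum_univ_one, Fin.val_zero, pow_zero, one_smul, eq_emptySimplex (Y := Y)
    ((Sing Y).face 0 (pt y))]

lemma mem_cyc_of_chainEquiv {m : ℕ} {z : (chains.obj (TopCat.of Y)).X (m + 1)}
    (hz : ∀ j, (chains.obj (TopCat.of Y)).d (m + 1) j z = 0) :
    chainEquiv Y (m + 1) z ∈ cyc ℚ (Sing Y) (m + 2) := by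
  change d ℚ (m + 1) _ = 0
  rw [← chainEquiv_d, hz, map_zero]

lemma d_zero_of_chainEquiv {m : ℕ} {z : (Sing Y).Chain ℚ (m + 1)}
    (hz : z ∈ cyc ℚ (Sing Y) (m + 1)) (j : ℕ) :
    (chains.obj (TopCat.of Y)).d m j ((chainEquiv Y m).symm z) = 0 := by
  by_cases hj : j + 1 = m
  · subst hj
    apply (chainEquiv Y j).injective
    rw [chainEquiv_d, LinearEquiv.apply_symm_apply, map_zero]
    exact hz
  · rw [HomologicalComplex.shape _ _ _ (by simpa using hj)]
    rfl

/-- The hypotheses concern reduced cycles, while the complex behind `cohomology` has no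
augmentation. The two notions of cycle differ in degree zero only, where the augmentation is
corrected by a multiple of a point of `Y`. -/
lemma isIso_cohomology_map [Nonempty Y] (f : C(Y, Z))
    (hinj : ∀ n, ∀ z ∈ cyc ℚ (Sing Y) n, (push f).map ℚ n z ∈ bdry ℚ _ n → z ∈ bdry ℚ _ n)
    (hsurj : ∀ n, ∀ y ∈ cyc ℚ (Sing Z) n, ∃ z ∈ cyc ℚ (Sing Y) n,
      y - (push f).map ℚ n z ∈ bdry ℚ _ n) (m : ℕ) :
    IsIso ((cohomology m).map (TopCat.ofHom f).op) := by
  have : QuasiIso (chains.map (TopCat.ofHom f)) := by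
    refine ⟨fun m => quasiIsoAt_of_cycles _ ?_ ?_⟩
    · rintro z hz ⟨w, hw⟩
      have hb : (push f).map ℚ (m + 1) (chainEquiv Y m z) ∈ bdry ℚ _ (m + 1) :=
        ⟨chainEquiv Z (m + 1) w, by rw [← chainEquiv_d, hw, chainEquiv_map]⟩
      have hc : chainEquiv Y m z ∈ cyc ℚ (Sing Y) (m + 1) := by
        cases m with
        | zero =>
          apply map_zero_injective f
          rw [map_zero, ← Hom.d_map]
          exact bdry_le_cyc hb
        | succ m => exact mem_cyc_of_chainEquiv hz
      obtain ⟨w, hw⟩ := hinj _ _ hc hb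
      refine ⟨(chainEquiv Y (m + 1)).symm w, (chainEquiv Y m).injective ?_⟩
      rw [chainEquiv_d, LinearEquiv.apply_symm_apply, hw]
    · intro y hy
      have key : ∃ z : (Sing Y).Chain ℚ (m + 1),
          (∀ j, (chains.obj (TopCat.of Y)).d m j ((chainEquiv Y m).symm z) = 0) ∧
          chainEquiv Z m y - (push f).map ℚ (m + 1) z ∈ bdry ℚ _ (m + 1) := by
        cases m with
        | zero =>
          obtain ⟨y₀⟩ := ‹Nonempty Y›
          obtain ⟨a, ha⟩ := chain_zero_eq (d ℚ 0 (chainEquiv Z 0 y))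
          obtain ⟨z, hz, hzy⟩ := hsurj 1
            (chainEquiv Z 0 y - a • of ℚ (S := Sing Z) (n := 1) (pt (f y₀))) (by
              change d ℚ 0 _ = 0
              rw [map_sub, ha, map_smul, d_pt, sub_self])
          refine ⟨z + a • of ℚ (S := Sing Y) (n := 1) (pt y₀), fun j => ?_, ?_⟩
          · rw [HomologicalComplex.shape _ _ _ (by simp)]
            rfl
          · rw [map_add, map_smul, Hom.map_of, sub_add_eq_sub_sub_swap]
            exact hzy
        | succ m =>
          obtain ⟨z, hz, hzy⟩ := hsurj _ _ (mem_cyc_of_chainEquiv hy)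
          exact ⟨z, d_zero_of_chainEquiv hz, hzy⟩
      obtain ⟨z, hz, w, hw⟩ := key
      refine ⟨_, hz, (chainEquiv Z (m + 1)).symm w, (chainEquiv Z m).injective ?_⟩
      rw [chainEquiv_d, LinearEquiv.apply_symm_apply, hw, map_sub, chainEquiv_map,
        LinearEquiv.apply_symm_apply]
  exact isIso_cohomology_map_of_quasiIso _ m

end

/-! ### Relative cohomology -/

section
variable {Y : Type} [TopologicalSpace Y] (A : Set Y)

/-- The complex of relative chains. -/
abbrev relChains : ChainComplex (ModuleCat.{0} ℚ) ℕ :=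
  Limits.cokernel (chains.map (TopCat.ofHom (incl A)))

/-- The projection to relative chains. -/
abbrev relProj : chains.obj (TopCat.of Y) ⟶ relChains A :=
  Limits.cokernel.π (chains.map (TopCat.ofHom (incl A)))

lemma relProj_exact (m : ℕ) : (ShortComplex.mk ((chains.map (TopCat.ofHom (incl A))).f m)
    ((relProj A).f m) (by
      rw [← HomologicalComplex.comp_f, Limits.cokernel.condition]; rfl)).Exact :=
  (HomologicalComplex.exact_iff_degreewise_exact _).1
    (ShortComplex.exact_cokernel (chains.map (TopCat.ofHom (incl A)))) m

lemma relProj_surjective (m : ℕ) : Function.Surjective ((relProj A).f m) := by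
  rw [← ModuleCat.epi_iff_surjective]
  infer_instance

/-- The class of a chain modulo chains in `A`. -/
def relClass (m : ℕ) : (Sing Y).Chain ℚ (m + 1) →ₗ[ℚ] (relChains A).X m :=
  ((relProj A).f m).hom.comp (chainEquiv Y m).symm.toLinearMap

lemma relClass_surjective (m : ℕ) : Function.Surjective (relClass A m) :=
  (relProj_surjective A m).comp (chainEquiv Y m).symm.surjective

lemma relClass_eq_zero {m : ℕ} {z : (Sing Y).Chain ℚ (m + 1)} :
    relClass A m z = 0 ↔ z ∈ supp ℚ A (m + 1) := by
  constructor
  · intro h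
    obtain ⟨c, hc⟩ := (ShortComplex.moduleCat_exact_iff _).1 (relProj_exact A m) _ h
    have : z = (push (incl A)).map ℚ (m + 1) (chainEquiv A m c) := by
      rw [← chainEquiv_map]
      exact ((LinearEquiv.symm_apply_eq _).1 hc.symm)
    rw [this]
    exact map_mem_supp (fun x => x.2) _
  · intro h
    obtain ⟨c, rfl⟩ := exists_of_mem_supp h
    obtain ⟨c, rfl⟩ := (chainEquiv A m).surjective c
    rw [← chainEquiv_map, relClass, LinearMap.comp_apply, LinearEquiv.coe_coe,
      LinearEquiv.symm_apply_apply, ← ModuleCat.comp_apply, ← HomologicalComplex.comp_f,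
      Limits.cokernel.condition]
    rfl

lemma relClass_d {m : ℕ} (z : (Sing Y).Chain ℚ (m + 2)) :
    (relChains A).d (m + 1) m (relClass A (m + 1) z) = relClass A m (d ℚ (m + 1) z) := by
  obtain ⟨z, rfl⟩ := (chainEquiv Y (m + 1)).surjective z
  rw [← chainEquiv_d]
  simp only [relClass, LinearMap.comp_apply, LinearEquiv.coe_coe, LinearEquiv.symm_apply_apply]
  rw [← ModuleCat.comp_apply, ← ModuleCat.comp_apply, HomologicalComplex.Hom.comm]

lemma relClass_cycle {m : ℕ} {z : (Sing Y).Chain ℚ (m + 1)} :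
    (∀ j, (relChains A).d m j (relClass A m z) = 0) ↔ d ℚ m z ∈ supp ℚ A m := by
  cases m with
  | zero =>
    refine ⟨fun _ => ?_, fun _ j => ?_⟩
    -- The augmentation is a multiple of the empty simplex, which is supported in every subset.
    · obtain ⟨a, ha⟩ := chain_zero_eq (d ℚ 0 z)
      rw [ha]
      exact Submodule.smul_mem _ _ (of_mem_supp fun x => isEmptyElim x)
    · rw [HomologicalComplex.shape _ _ _ (by simp)]
      rfl
  | succ m =>
    rw [← relClass_eq_zero, ← relClass_d]
    refine ⟨fun h => h m, fun h j => ?_⟩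
    by_cases hj : j = m
    · subst hj
      exact h
    · rw [HomologicalComplex.shape _ _ _ (by simpa using hj)]
      rfl

lemma relClass_boundary {m : ℕ} {z : (Sing Y).Chain ℚ (m + 1)} :
    (∃ w, (relChains A).d (m + 1) m w = relClass A m z) ↔
      ∃ w, z - d ℚ (m + 1) w ∈ supp ℚ A (m + 1) := by
  constructor
  · rintro ⟨w, hw⟩
    obtain ⟨w, rfl⟩ := relClass_surjective A (m + 1) w
    refine ⟨w, ?_⟩
    rw [← relClass_eq_zero, map_sub, ← relClass_d, hw, sub_self]
  · rintro ⟨w, hw⟩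
    refine ⟨relClass A (m + 1) w, ?_⟩
    rw [← relClass_eq_zero, map_sub, ← relClass_d, sub_eq_zero] at hw
    exact hw.symm

variable {A}

lemma exists_of_relativeCohomology_subsingleton {m : ℕ}
    (h : Subsingleton (relativeCohomology Y A m)) {z : (Sing Y).Chain ℚ (m + 1)}
    (hz : d ℚ m z ∈ supp ℚ A m) : ∃ w, z - d ℚ (m + 1) w ∈ supp ℚ A (m + 1) := by
  have h1 : Subsingleton ((relChains A).homology m) := subsingleton_homology_of_dual h
  obtain ⟨c, hc⟩ := exists_isClass_of_cycle _ ((relClass_cycle A).2 hz)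
  exact (relClass_boundary A).1 (hc.eq_zero_iff.1 (Subsingleton.elim _ _))

lemma exists_of_relativeCohomology_line {m : ℕ}
    (h : Nonempty (relativeCohomology Y A m ≃ₗ[ℚ] ℚ)) :
    ∃ z₀ : (Sing Y).Chain ℚ (m + 1), d ℚ m z₀ ∈ supp ℚ A m ∧
      (¬ ∃ w, z₀ - d ℚ (m + 1) w ∈ supp ℚ A (m + 1)) ∧
      ∀ z, d ℚ m z ∈ supp ℚ A m → ∃ (a : ℚ) (w : _),
        z - a • z₀ - d ℚ (m + 1) w ∈ supp ℚ A (m + 1) := by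
  obtain ⟨v, hv, hgen⟩ : ∃ v : (relChains A).homology m, v ≠ 0 ∧ ∀ w, ∃ a : ℚ, a • v = w :=
    exists_generator_homology_of_dual h
  obtain ⟨y, hy⟩ := exists_isClass v
  obtain ⟨z₀, rfl⟩ := relClass_surjective A m y
  refine ⟨z₀, (relClass_cycle A).1 hy.d_eq_zero, fun hw => hv ?_, fun z hz => ?_⟩
  · exact hy.eq_zero_iff.2 ((relClass_boundary A).2 hw)
  · obtain ⟨c, hc⟩ := exists_isClass_of_cycle _ ((relClass_cycle A).2 hz)
    obtain ⟨a, ha⟩ := hgen c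
    have h1 := (hc.sub_smul hy a).eq_zero_iff.1 (by rw [ha, sub_self])
    rw [← map_smul, ← map_sub] at h1
    exact ⟨a, (relClass_boundary A).1 h1⟩

lemma map_incl_mem_cyc_iff {R : Type} [CommRing R] {n : ℕ} {c : (Sing A).Chain R n} :
    (push (incl A)).map R n c ∈ cyc R _ n ↔ c ∈ cyc R _ n := by
  refine ⟨fun h => ?_, map_mem_cyc _⟩
  cases n with
  | zero => trivial
  | succ n =>
    apply map_incl_injective A n
    rw [← Hom.d_map, map_zero]
    exact h

/-- Since `Y` is acyclic, the connecting map from the relative homology of the pair to the reduced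
homology of `A` is an isomorphism. It lowers the degree by one; counting vertices instead of
dimension absorbs the shift, so the same `m` occurs on both sides. -/
lemma acyc_of_relativeCohomology_subsingleton (hY : ∀ n, Acyc ℚ Y n) {m : ℕ}
    (h : Subsingleton (relativeCohomology Y A m)) : Acyc ℚ A m := by
  intro c hc
  obtain ⟨z, hz⟩ := hY m _ (map_mem_cyc (push (incl A)) hc)
  obtain ⟨w, hw⟩ := exists_of_relativeCohomology_subsingleton h (z := z)
    (hz ▸ map_mem_supp (fun x => x.2) _)
  obtain ⟨s, hs⟩ := exists_of_mem_supp hw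
  refine ⟨s, map_incl_injective A m ?_⟩
  rw [← Hom.d_map, hs, map_sub, d_d, sub_zero, hz]

lemma homLine_of_relativeCohomology_line (hY : ∀ n, Acyc ℚ Y n) {m : ℕ}
    (h : Nonempty (relativeCohomology Y A m ≃ₗ[ℚ] ℚ)) : HomLine ℚ A m := by
  obtain ⟨z₀, hz₀, hn, hgen⟩ := exists_of_relativeCohomology_line h
  obtain ⟨c₀, hc₀⟩ := exists_of_mem_supp hz₀
  refine ⟨c₀, ?_, ?_, fun c hc => ?_⟩
  · rw [← map_incl_mem_cyc_iff, hc₀]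
    exact bdry_le_cyc ⟨z₀, rfl⟩
  · rintro ⟨s, rfl⟩
    obtain ⟨w, hw⟩ := hY (m + 1) (z₀ - (push (incl A)).map ℚ (m + 1) s) (by
      change d ℚ m _ = 0
      rw [map_sub, Hom.d_map, hc₀, sub_self])
    refine hn ⟨w, ?_⟩
    rw [hw, sub_sub_cancel]
    exact map_mem_supp (fun x => x.2) _
  · obtain ⟨z, hz⟩ := hY m _ (map_mem_cyc (push (incl A)) hc)
    obtain ⟨a, w, hw⟩ := hgen z (hz ▸ map_mem_supp (fun x => x.2) _)
    obtain ⟨s, hs⟩ := exists_of_mem_supp hw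
    refine ⟨a, s, map_incl_injective A m ?_⟩
    rw [← Hom.d_map, hs, map_sub, d_d, sub_zero, map_sub, hz, map_smul, ← hc₀, map_sub, map_smul]

end

end

local notation "I" => unitInterval

section

/-! ### The homotopy extension property for the boundary of a simplex -/

section
variable {Y : Type} [TopologicalSpace Y]

lemma splx_le_one {n : ℕ} (x : Splx n) (i : Fin n) : x i ≤ 1 :=
  (Finset.single_le_sum (f := fun i => x i) (fun i _ => x.2.1 i) (Finset.mem_univ i)).trans
    x.2.2.le

lemma exists_faceMap_eq {n : ℕ} {j : Fin (n + 1)} {x : Splx (n + 1)} (h : x j = 0) :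
    ∃ z, faceMap j z = x := by
  have hs : ∑ i, x i = 1 := x.2.2
  rw [Fin.sum_univ_succAbove _ j, h, zero_add] at hs
  refine ⟨⟨fun i => x (j.succAbove i), fun i => x.2.1 _, hs⟩, stdSimplex.ext (funext fun k => ?_)⟩
  rcases Fin.eq_self_or_eq_succAbove j k with rfl | ⟨k, rfl⟩
  · rw [faceMap_self, h]
  · rw [faceMap_succAbove]
    rfl

lemma faceMap_injective {n : ℕ} (j : Fin (n + 1)) : Function.Injective (faceMap j) := by
  intro x y h
  refine stdSimplex.ext (funext fun k => ?_)
  rw [← faceMap_succAbove j, h, faceMap_succAbove]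

lemma exists_of_faceMap_eq {n : ℕ} {i j : Fin (n + 1)} (hij : i ≤ j) {x y : Splx (n + 1)}
    (h : faceMap j.succ x = faceMap i.castSucc y) : ∃ z, x = faceMap i z ∧ y = faceMap j z := by
  have h0 : x i = 0 := by
    rw [← faceMap_succAbove j.succ, h, Fin.succAbove_of_castSucc_lt _ _
      (Fin.lt_def.2 (by have := Fin.le_def.1 hij; simp; omega)), faceMap_self]
  obtain ⟨z, rfl⟩ := exists_faceMap_eq h0
  refine ⟨z, rfl, faceMap_injective i.castSucc ?_⟩
  rw [← h]
  exact DFunLike.congr_fun (faceMap_faceMap hij) z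

/-- Homotopies on the faces which agree on common faces are compatible. -/
lemma faces_compatible {n : ℕ} {b : Fin (n + 2) → C(I × Splx (n + 1), Y)}
    (hb : ∀ i j : Fin (n + 1), i ≤ j → ∀ t z, b j.succ (t, faceMap i z) =
      b i.castSucc (t, faceMap j z)) {j j' : Fin (n + 2)} {x x' : Splx (n + 1)} (t : I)
    (h : faceMap j x = faceMap j' x') : b j (t, x) = b j' (t, x') := by
  -- A common point of two distinct faces lies in a face of codimension two, where the hypothesis on
  -- faces of faces applies.
  have key : ∀ {j j' : Fin (n + 2)} {x x' : Splx (n + 1)}, j' < j → faceMap j x = faceMap j' x' →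
      b j (t, x) = b j' (t, x') := by
    intro j j' x x' hlt h
    obtain ⟨k, rfl⟩ := Fin.exists_succ_eq.2 (Fin.ne_of_gt (lt_of_le_of_lt (Fin.zero_le _) hlt))
    obtain ⟨i, rfl⟩ : ∃ i : Fin (n + 1), i.castSucc = j' :=
      ⟨⟨j', by have := Fin.lt_def.1 hlt; have := k.2; simp at *; omega⟩, rfl⟩
    have hik : i ≤ k := by have := Fin.lt_def.1 hlt; simp at this; exact Fin.le_def.2 (by omega)
    obtain ⟨z, rfl, rfl⟩ := exists_of_faceMap_eq hik h
    exact hb i k hik t z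
  rcases lt_trichotomy j j' with hlt | rfl | hlt
  · exact (key hlt h.symm).symm
  · rw [faceMap_injective j h]
  · exact key hlt h

/-- The part of the cylinder over a simplex on which a homotopy is prescribed. -/
def boxSet (n : ℕ) : Set (I × Splx (n + 1)) := {p | p.1 = 0 ∨ ∃ j, p.2 j = 0}

/-- The minimal coordinate of a point of a simplex. -/
def minCoord {n : ℕ} (x : Splx (n + 1)) : ℝ := Finset.univ.inf' Finset.univ_nonempty fun i => x i

lemma continuous_minCoord {n : ℕ} : Continuous (minCoord (n := n)) :=
  Continuous.finset_inf'_apply _ fun i _ => continuous_splx_apply i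

lemma minCoord_le {n : ℕ} (x : Splx (n + 1)) (i : Fin (n + 1)) : minCoord x ≤ x i :=
  Finset.inf'_le _ (Finset.mem_univ i)

lemma exists_eq_minCoord {n : ℕ} (x : Splx (n + 1)) : ∃ i, x i = minCoord x := by
  obtain ⟨i, -, h⟩ := Finset.exists_mem_eq_inf' Finset.univ_nonempty fun i => x i
  exact ⟨i, h.symm⟩

lemma minCoord_nonneg {n : ℕ} (x : Splx (n + 1)) : 0 ≤ minCoord x := by
  obtain ⟨i, h⟩ := exists_eq_minCoord x
  exact h ▸ x.2.1 i

lemma minCoord_eq_zero_iff {n : ℕ} (x : Splx (n + 1)) : minCoord x = 0 ↔ ∃ i, x i = 0 := by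
  constructor
  · intro h
    obtain ⟨i, hi⟩ := exists_eq_minCoord x
    exact ⟨i, hi.trans h⟩
  · rintro ⟨i, hi⟩
    exact le_antisymm (hi ▸ minCoord_le x i) (minCoord_nonneg x)

/-- The amount subtracted from all coordinates by the retraction to `boxSet n`. -/
def boxShift (n : ℕ) (p : I × Splx (n + 1)) : ℝ := min (minCoord p.2) (p.1 / (2 * (n + 1)))

lemma boxShift_nonneg (n : ℕ) (p : I × Splx (n + 1)) : 0 ≤ boxShift n p :=
  le_min (minCoord_nonneg _) (div_nonneg p.1.2.1 (by positivity))

/-- This bound is the reason for the factor `2 * (n + 1)` in `boxShift`: after the subtraction the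
coordinates still have sum at least `1 / 2`, so they can be normalized continuously. -/
lemma boxShift_le (n : ℕ) (p : I × Splx (n + 1)) : (n + 1) * boxShift n p ≤ 1 / 2 := by
  have h : boxShift n p ≤ p.1 / (2 * (n + 1)) := min_le_right _ _
  have h1 : (p.1 : ℝ) ≤ 1 := p.1.2.2
  rw [le_div_iff₀ (by positivity)] at h
  linarith

lemma continuous_boxShift (n : ℕ) : Continuous (boxShift n) :=
  (continuous_minCoord.comp continuous_snd).min
    ((continuous_subtype_val.comp continuous_fst).div_const _)

lemma boxShift_eq_zero (n : ℕ) {p : I × Splx (n + 1)} (hp : p ∈ boxSet n) : boxShift n p = 0 := by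
  refine le_antisymm ?_ (boxShift_nonneg n p)
  rcases hp with h | h
  · exact (min_le_right _ _).trans (by simp [h])
  · exact (min_le_left _ _).trans ((minCoord_eq_zero_iff _).2 h).le

/-- The retraction of the cylinder over a simplex to `boxSet n`. -/
def boxRetract (n : ℕ) : C(I × Splx (n + 1), boxSet n) where
  toFun p := ⟨(⟨p.1 - boxShift n p * (2 * (n + 1)), by
      have h : boxShift n p ≤ p.1 / (2 * (n + 1)) := min_le_right _ _
      rw [le_div_iff₀ (by positivity)] at h
      have h0 : (0 : ℝ) ≤ boxShift n p * (2 * (n + 1)) :=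
        mul_nonneg (boxShift_nonneg n p) (by positivity)
      exact ⟨by linarith, by have := p.1.2.2; linarith⟩⟩,
      ⟨fun i => (p.2 i - boxShift n p) / (1 - (n + 1) * boxShift n p), by
        have h := boxShift_le n p
        refine ⟨fun i => div_nonneg ?_ (by linarith), ?_⟩
        · exact sub_nonneg.2 ((min_le_left _ _).trans (minCoord_le _ i))
        · have hs : ∑ i, p.2 i = 1 := p.2.2.2
          rw [← Finset.sum_div, Finset.sum_sub_distrib, hs]
          simp only [Finset.sum_const, Finset.card_univ, Fintype.card_fin, nsmul_eq_mul]
          push_cast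
          exact div_self (by linarith)⟩), by
    -- If the minimum is the smallest coordinate, this coordinate becomes zero and the point lands
    -- on a side. Otherwise the time becomes zero and it lands on the bottom.
    rcases min_choice (minCoord p.2) (p.1 / (2 * (n + 1)) : ℝ) with h | h
    · right
      obtain ⟨i, hi⟩ := exists_eq_minCoord p.2
      refine ⟨i, ?_⟩
      change (p.2 i - min _ _) / _ = (0 : ℝ)
      rw [h, hi, sub_self, zero_div]
    · left
      refine Subtype.ext ?_
      change (p.1 : ℝ) - min _ _ * (2 * (n + 1)) = 0
      rw [h, div_mul_cancel₀ _ (by positivity), sub_self]⟩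
  continuous_toFun := by
    have hs := continuous_boxShift n
    refine Continuous.subtype_mk (Continuous.prodMk (Continuous.subtype_mk ?_ _)
      (Continuous.subtype_mk (continuous_pi fun i => Continuous.div₀ ?_ ?_ ?_) _)) _
    · exact (continuous_subtype_val.comp continuous_fst).sub (hs.mul continuous_const)
    · exact ((continuous_splx_apply i).comp continuous_snd).sub hs
    · exact continuous_const.sub (continuous_const.mul hs)
    · intro p
      have := boxShift_le n p
      linarith

lemma boxRetract_apply (n : ℕ) {p : I × Splx (n + 1)} (hp : p ∈ boxSet n) :
    (boxRetract n p).1 = p := by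
  refine Prod.ext (Subtype.ext ?_) (stdSimplex.ext (funext fun i => ?_))
  · change (p.1 : ℝ) - boxShift n p * (2 * (n + 1)) = p.1
    rw [boxShift_eq_zero n hp]
    ring
  · change (p.2 i - boxShift n p) / (1 - (n + 1) * boxShift n p) = p.2 i
    rw [boxShift_eq_zero n hp]
    simp

/-- The parametrization of `boxSet n` by the bottom and the sides. -/
def boxCover (n : ℕ) : C(Splx (n + 1) ⊕ (Σ _ : Fin (n + 1), I × Splx n), boxSet n) where
  toFun := Sum.elim (fun x => ⟨(0, x), Or.inl rfl⟩)
    fun s => ⟨(s.2.1, faceMap s.1 s.2.2), Or.inr ⟨s.1, faceMap_self _ _⟩⟩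
  continuous_toFun := by
    refine Continuous.sumElim (by fun_prop) (continuous_sigma fun j => ?_)
    exact Continuous.subtype_mk (by fun_prop) _

lemma isQuotientMap_boxCover (n : ℕ) : IsQuotientMap (boxCover n) := by
  refine IsQuotientMap.of_surjective_continuous ?_ (boxCover n).continuous
  rintro ⟨⟨t, x⟩, h⟩
  rcases h with h | ⟨j, hj⟩
  · exact ⟨Sum.inl x, Subtype.ext (Prod.ext h.symm rfl)⟩
  · obtain ⟨z, hz⟩ := exists_faceMap_eq hj
    exact ⟨Sum.inr ⟨j, t, z⟩, Subtype.ext (Prod.ext rfl hz)⟩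

/-- The box is a quotient of the disjoint union of bottom and sides, as a continuous surjection from
a compact to a Hausdorff space. So compatible data glue to a map on the box, and `boxRetract`
extends it to the cylinder. -/
lemma exists_homotopy_extension {n : ℕ} (s₀ : C(Splx (n + 1), Y))
    (b : Fin (n + 1) → C(I × Splx n, Y)) (h0 : ∀ j x, b j (0, x) = s₀ (faceMap j x))
    (hc : ∀ j j' x x' t, faceMap j x = faceMap j' x' → b j (t, x) = b j' (t, x')) :
    ∃ h : C(I × Splx (n + 1), Y), (∀ x, h (0, x) = s₀ x) ∧
      ∀ j t x, h (t, faceMap j x) = b j (t, x) := by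
  let g : C(Splx (n + 1) ⊕ (Σ _ : Fin (n + 1), I × Splx n), Y) :=
    ⟨Sum.elim s₀ fun s => b s.1 s.2, Continuous.sumElim s₀.continuous
      (continuous_sigma fun j => (b j).continuous)⟩
  have hg : ∀ a a', boxCover n a = boxCover n a' → g a = g a' := by
    have key : ∀ x (s : Σ _ : Fin (n + 1), I × Splx n),
        boxCover n (Sum.inl x) = boxCover n (Sum.inr s) → g (Sum.inl x) = g (Sum.inr s) := by
      rintro x ⟨j, t, z⟩ h
      obtain ⟨h1, h2⟩ := Prod.ext_iff.1 (Subtype.ext_iff.1 h)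
      change 0 = t at h1
      change x = faceMap j z at h2
      change s₀ x = b j (t, z)
      rw [← h1, h0, h2]
    rintro (x | ⟨j, t, z⟩) (x' | ⟨j', t', z'⟩) h
    · rw [show x = x' from (Prod.ext_iff.1 (Subtype.ext_iff.1 h)).2]
    · exact key _ _ h
    · exact (key _ _ h.symm).symm
    · obtain ⟨h1, h2⟩ := Prod.ext_iff.1 (Subtype.ext_iff.1 h)
      change t = t' at h1
      subst h1
      exact hc j j' z z' t h2
  let G : C(boxSet n, Y) := (isQuotientMap_boxCover n).lift g fun a a' => hg a a'
  have hG : ∀ a, G (boxCover n a) = g a := fun a =>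
    DFunLike.congr_fun ((isQuotientMap_boxCover n).lift_comp g fun a a' => hg a a') a
  refine ⟨G.comp (boxRetract n), fun x => ?_, fun j t x => ?_⟩
  · have : boxRetract n (0, x) = boxCover n (Sum.inl x) :=
      Subtype.ext (boxRetract_apply n (Or.inl rfl))
    rw [ContinuousMap.comp_apply, this, hG]
    rfl
  · have : boxRetract n (t, faceMap j x) = boxCover n (Sum.inr ⟨j, t, x⟩) :=
      Subtype.ext (boxRetract_apply n (Or.inr ⟨j, faceMap_self _ _⟩))
    rw [ContinuousMap.comp_apply, this, hG]
    rfl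

end

end

section

/-! ### Deforming skeleta to the base point -/

section
variable {Y : Type} [TopologicalSpace Y]

/-- Recursion on the number of vertices: the homotopy is stationary up to `N`, is the given `k` at
`N + 1`, and is extended from the boundary of each simplex above. Constant simplices at `y₀` are
treated apart so that they do not move, which later keeps homotopies of spherical simplices relative
to the boundary. -/
lemma exists_natHomotopy {y₀ : Y} (E : Hom (Sing Y) (Sing Y))
    (hE : ∀ n, E.app (ContinuousMap.const (Splx n) y₀) = ContinuousMap.const _ y₀) (N : ℕ)
    (k : ∀ {n : ℕ}, C(Splx n, Y) → C(I × Splx n, Y))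
    (k_zero : ∀ (σ : C(Splx (N + 1), Y)) x, k σ (0, x) = E.app σ x)
    (k_face : ∀ (σ : C(Splx (N + 1), Y)) (t : I) j x,
      k σ (t, faceMap j x) = E.app (σ.comp (faceMap j)) x)
    (k_const : k (ContinuousMap.const (Splx (N + 1)) y₀) = ContinuousMap.const _ y₀) :
    ∃ (E' : Hom (Sing Y) (Sing Y)) (H : NatHomotopy E E'),
      (∀ n ≤ N, ∀ σ : C(Splx n, Y), E'.app σ = E.app σ) ∧
      (∀ (σ : C(Splx (N + 1), Y)) x, E'.app σ x = k σ (1, x)) ∧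
      ∀ n, H.h (ContinuousMap.const (Splx n) y₀) = ContinuousMap.const _ y₀ := by
  classical
  let stay : ∀ {n : ℕ}, C(Splx n, Y) → C(I × Splx n, Y) := fun σ => (E.app σ).comp ContinuousMap.snd
  -- The recursion step at `n` defines the homotopy on simplices with `n + 1` vertices, hence the
  -- tests `n + 1 ≤ N` and `n = N`. The last `stay` is a default value for a missing extension;
  -- `good` shows that this case does not occur.
  let h : ∀ n : ℕ, C(Splx n, Y) → C(I × Splx n, Y) := fun n => Nat.rec (fun σ => stay σ)
    (fun n hn σ => if n + 1 ≤ N then stay σ else if n = N then k σ else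
      if σ = ContinuousMap.const _ y₀ then ContinuousMap.const _ y₀ else
      if ex : ∃ H : C(I × Splx (n + 1), Y), (∀ x, H (0, x) = E.app σ x) ∧
        ∀ j t x, H (t, faceMap j x) = hn (σ.comp (faceMap j)) (t, x) then ex.choose
      else stay σ) n
  have h_le : ∀ n ≤ N, ∀ σ, h n σ = stay σ := by
    intro n hn σ
    cases n with
    | zero => rfl
    | succ n => exact if_pos hn
  have h_eq : ∀ σ, h (N + 1) σ = k σ := fun σ => (if_neg (by omega)).trans (if_pos rfl)
  have h_const : ∀ n, h n (ContinuousMap.const _ y₀) = ContinuousMap.const _ y₀ := by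
    have hs : ∀ n, stay (ContinuousMap.const (Splx n) y₀) = ContinuousMap.const _ y₀ := by
      intro n
      simp only [stay, hE]
      rfl
    intro n
    rcases lt_trichotomy n (N + 1) with hn | rfl | hn
    · rw [h_le n (by omega), hs]
    · rw [h_eq, k_const]
    · cases n with
      | zero => omega
      | succ n => exact (if_neg (by omega)).trans ((if_neg (by omega)).trans (if_pos rfl))
  have h_ext : ∀ n, N < n → ∀ σ : C(Splx (n + 1), Y), σ ≠ ContinuousMap.const _ y₀ →
      ∀ ex : (∃ H : C(I × Splx (n + 1), Y), (∀ x, H (0, x) = E.app σ x) ∧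
        ∀ j t x, H (t, faceMap j x) = h n (σ.comp (faceMap j)) (t, x)), h (n + 1) σ = ex.choose :=
    fun n hn σ hσ ex => (if_neg (by omega)).trans ((if_neg (by omega)).trans
      ((if_neg hσ).trans (dif_pos ex)))
  have h_zero : ∀ σ, h 0 σ = stay σ := fun σ => rfl
  clear_value h
  have good : ∀ n, (∀ (σ : C(Splx n, Y)) x, h n σ (0, x) = E.app σ x) ∧
      (∀ (σ : C(Splx (n + 1), Y)) x, h (n + 1) σ (0, x) = E.app σ x) ∧
      ∀ (σ : C(Splx (n + 1), Y)) j t x,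
        h (n + 1) σ (t, faceMap j x) = h n (σ.comp (faceMap j)) (t, x) := by
    have stay_face : ∀ {n : ℕ} (σ : C(Splx (n + 1), Y)) j t x,
        stay σ (t, faceMap j x) = stay (σ.comp (faceMap j)) (t, x) := by
      intro n σ j t x
      exact DFunLike.congr_fun (E.comm j σ) x
    have step : ∀ n, (∀ (σ : C(Splx n, Y)) x, h n σ (0, x) = E.app σ x) →
        (∀ (σ : C(Splx (n + 1), Y)) (j j' : Fin (n + 1)) x x' t, faceMap j x = faceMap j' x' →
          h n (σ.comp (faceMap j)) (t, x) = h n (σ.comp (faceMap j')) (t, x')) →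
        (∀ (σ : C(Splx (n + 1), Y)) x, h (n + 1) σ (0, x) = E.app σ x) ∧
        ∀ (σ : C(Splx (n + 1), Y)) j t x,
          h (n + 1) σ (t, faceMap j x) = h n (σ.comp (faceMap j)) (t, x) := by
      intro n hn hc
      rw [← forall_and]
      intro σ
      rcases lt_trichotomy n N with hlt | rfl | hlt
      · rw [h_le _ hlt]
        refine ⟨fun x => rfl, fun j t x => ?_⟩
        rw [h_le _ hlt.le]
        exact stay_face σ j t x
      · rw [h_eq]
        refine ⟨k_zero σ, fun j t x => ?_⟩
        rw [h_le _ le_rfl, k_face]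
        rfl
      · by_cases hσ : σ = ContinuousMap.const _ y₀
        · subst hσ
          refine ⟨fun x => ?_, fun j t x => ?_⟩
          · rw [hE]
            exact DFunLike.congr_fun (h_const (n + 1)) (0, x)
          · rw [ContinuousMap.const_comp, h_const]
            exact (DFunLike.congr_fun (h_const n) (t, x)).symm
        · have ex : ∃ H : C(I × Splx (n + 1), Y), (∀ x, H (0, x) = E.app σ x) ∧
              ∀ j t x, H (t, faceMap j x) = h n (σ.comp (faceMap j)) (t, x) := by
            refine exists_homotopy_extension _ _ (fun j x => ?_) (hc σ)
            rw [hn]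
            exact (DFunLike.congr_fun (E.comm j σ) x).symm
          rw [h_ext n hlt σ hσ ex]
          exact ex.choose_spec
    intro n
    induction n with
    | zero =>
      have h0 : ∀ (σ : C(Splx 0, Y)) x, h 0 σ (0, x) = E.app σ x := fun σ x => by
        rw [h_zero]
        rfl
      exact ⟨h0, step 0 h0 fun σ j j' x => isEmptyElim x⟩
    | succ n ih =>
      refine ⟨ih.2.1, step (n + 1) ih.2.1 fun σ j j' x x' t hx => ?_⟩
      refine faces_compatible (b := fun j => h (n + 1) (σ.comp (faceMap j)))
        (fun i j hij t z => ?_) t hx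
      rw [ih.2.2, ih.2.2, ContinuousMap.comp_assoc, ContinuousMap.comp_assoc, faceMap_faceMap hij]
  let E' : Hom (Sing Y) (Sing Y) :=
    { app := fun {n} σ => (h n σ).comp ((ContinuousMap.const _ 1).prodMk (ContinuousMap.id _))
      comm := fun {n} j σ => ContinuousMap.ext fun x => (good n).2.2 σ j 1 x }
  let H : NatHomotopy E E' :=
    { h := fun {n} σ => h n σ
      h_zero := fun {n} σ x => (good n).1 σ x
      h_one := fun σ x => rfl
      h_face := fun {n} σ j t x => ((good n).2.2 σ j t x).symm }
  refine ⟨E', H, fun n hn σ => ?_, fun σ x => ?_, h_const⟩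
  · refine ContinuousMap.ext fun x => ?_
    change h n σ (1, x) = _
    rw [h_le n hn]
    rfl
  · change h (N + 1) σ (1, x) = _
    rw [h_eq]

/-- The boundary of a simplex. -/
def bd (n : ℕ) : Set (Splx n) := {x | ∃ i, x i = 0}

/-- A simplex whose boundary is mapped to the base point. -/
def Spherical (y₀ : Y) {n : ℕ} (σ : C(Splx n, Y)) : Prop := ∀ x ∈ bd n, σ x = y₀

/-- `E` is a natural deformation of the operator given by `g`. -/
structure Deforms (y₀ : Y) (g : C(Y, Y)) (E : Hom (Sing Y) (Sing Y)) : Prop where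
  const : ∀ n, E.app (ContinuousMap.const (Splx n) y₀) = ContinuousMap.const _ y₀
  sub_mem : ∀ (R : Type) [CommRing R] (n : ℕ), ∀ c ∈ cyc R (Sing Y) n,
    E.map R n c - (push g).map R n c ∈ bdry R (Sing Y) n
  rel : ∀ {n : ℕ} (σ : C(Splx n, Y)), Spherical y₀ σ →
    (g.comp σ).HomotopicRel (E.app σ) (bd n)

lemma Deforms.refl (y₀ : Y) : Deforms y₀ (ContinuousMap.id Y) (push (ContinuousMap.id Y)) where
  const _ := rfl
  sub_mem R _ n c _ := by
    rw [sub_self]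
    exact Submodule.zero_mem _
  rel σ _ := ContinuousMap.HomotopicRel.refl _

lemma Spherical.comp {y₀ : Y} {n : ℕ} {σ : C(Splx n, Y)} (h : Spherical y₀ σ) {g : C(Y, Y)}
    (hg : g y₀ = y₀) : Spherical y₀ (g.comp σ) := fun x hx => by
  rw [ContinuousMap.comp_apply, h x hx, hg]

lemma Deforms.comp {y₀ : Y} {g : C(Y, Y)} {E : Hom (Sing Y) (Sing Y)} (h : Deforms y₀ g E)
    {g' : C(Y, Y)} (hg' : g' y₀ = y₀) : Deforms y₀ (g'.comp g) ((push g').comp E) where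
  const n := by
    change g'.comp (E.app _) = _
    rw [h.const]
    exact ContinuousMap.ext fun x => hg'
  sub_mem R _ n c hc := by
    rw [Hom.map_comp, push_comp_map, ← map_sub]
    exact map_mem_bdry _ (h.sub_mem R n c hc)
  rel σ hσ := by
    rw [ContinuousMap.comp_assoc]
    exact (h.rel σ hσ).comp_continuousMap g'

/-- The faces of a spherical simplex are constant simplices, which `H` leaves in place. Hence `H`
moves a spherical simplex relative to its boundary. -/
lemma Deforms.trans {y₀ : Y} {g : C(Y, Y)} {E E' : Hom (Sing Y) (Sing Y)} (h : Deforms y₀ g E)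
    (H : NatHomotopy E E') (hH : ∀ n, H.h (ContinuousMap.const (Splx n) y₀) =
      ContinuousMap.const _ y₀) : Deforms y₀ g E' where
  const n := ContinuousMap.ext fun x => by
    rw [← H.h_one, hH]
    rfl
  sub_mem R _ n c hc := by
    have := Submodule.add_mem _ (H.sub_mem_bdry hc) (h.sub_mem R n c hc)
    rwa [sub_add_sub_cancel] at this
  rel {n} σ hσ := by
    refine (h.rel σ hσ).trans ⟨⟨⟨H.h σ, H.h_zero σ, H.h_one σ⟩, fun t x hx => ?_⟩⟩
    cases n with
    | zero => exact isEmptyElim x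
    | succ n =>
      obtain ⟨j, hj⟩ := hx
      obtain ⟨z, rfl⟩ := exists_faceMap_eq hj
      change H.h σ (t, faceMap j z) = E.app σ (faceMap j z)
      have hc : σ.comp (faceMap j) = ContinuousMap.const _ y₀ :=
        ContinuousMap.ext fun z => hσ _ ⟨j, faceMap_self j z⟩
      rw [← H.h_zero, ← H.h_face, ← H.h_face, hc, hH]
      rfl

/-! ### Killing spherical simplices by self-maps that multiply homology -/

/-- A pointed self-map acting on the reduced integral homology as a positive integer. -/
def IsMult (y₀ : Y) (g : C(Y, Y)) : Prop :=
  g y₀ = y₀ ∧ ∃ N : ℕ, 1 ≤ N ∧ ∀ n, ∀ c ∈ cyc ℤ (Sing Y) n,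
    (push g).map ℤ n c - (N : ℤ) • c ∈ bdry ℤ (Sing Y) n

lemma IsMult.refl (y₀ : Y) : IsMult y₀ (ContinuousMap.id Y) :=
  ⟨rfl, 1, le_rfl, fun n c _ => by simp [push_id_map]⟩

lemma IsMult.comp {y₀ : Y} {g g' : C(Y, Y)} (h' : IsMult y₀ g') (h : IsMult y₀ g) :
    IsMult y₀ (g'.comp g) := by
  obtain ⟨h1, N, hN, hc⟩ := h
  obtain ⟨h1', N', hN', hc'⟩ := h'
  refine ⟨by rw [ContinuousMap.comp_apply, h1, h1'], N' * N, Nat.mul_pos hN' hN, fun n c hz => ?_⟩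
  have e1 := map_mem_bdry (push g') (hc n c hz)
  have e2 := Submodule.smul_mem _ (N : ℤ) (hc' n c hz)
  have := Submodule.add_mem _ e1 e2
  rw [map_sub, map_smul, smul_sub, sub_add_sub_cancel, smul_smul, ← push_comp_map] at this
  push_cast
  rwa [mul_comm]

/-- Every spherical simplex with `n` vertices becomes null homotopic after a self-map as above. -/
def Kills (y₀ : Y) (n : ℕ) : Prop :=
  ∀ σ : C(Splx n, Y), Spherical y₀ σ → ∃ g, IsMult y₀ g ∧
    (g.comp σ).HomotopicRel (ContinuousMap.const _ y₀) (bd n)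

/-- A null homotopy survives composition with a further pointed self-map, so the simplices can be
killed one after the other. -/
lemma Kills.finite {y₀ : Y} {n : ℕ} (h : Kills y₀ n) {T : Set C(Splx n, Y)} (hT : T.Finite)
    (hs : ∀ σ ∈ T, Spherical y₀ σ) : ∃ g, IsMult y₀ g ∧ ∀ σ ∈ T,
      (g.comp σ).HomotopicRel (ContinuousMap.const _ y₀) (bd n) := by
  induction T, hT using Set.Finite.induction_on with
  | empty => exact ⟨_, IsMult.refl y₀, by simp⟩
  | @insert τ T _ _ ih =>
    obtain ⟨g, hg, hgT⟩ := ih fun σ hσ => hs σ (Set.mem_insert_of_mem _ hσ)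
    obtain ⟨g', hg', hgτ⟩ := h (g.comp τ) ((hs τ (Set.mem_insert _ _)).comp hg.1)
    refine ⟨g'.comp g, hg'.comp hg, ?_⟩
    rintro σ (rfl | hσ)
    · rwa [ContinuousMap.comp_assoc]
    · have := (hgT σ hσ).comp_continuousMap g'
      rw [ContinuousMap.comp_assoc]
      rwa [ContinuousMap.comp_const, hg'.1] at this

/-- Induction on `m`. Once the members of `S` with at most `m` vertices are constant, those with `m
+ 1` vertices are spherical, because `S` is closed under faces. One more self-map makes these
finitely many simplices null homotopic, and `exists_natHomotopy` extends their null homotopies to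
all simplices. -/
lemma exists_deforms {y₀ : Y} (m : ℕ) (hK : ∀ n, 1 ≤ n → n ≤ m → Kills y₀ n)
    (S : ∀ n, Set C(Splx n, Y)) (hfin : ∀ n, (S n).Finite)
    (hface : ∀ n (j : Fin (n + 1)), ∀ σ ∈ S (n + 1), σ.comp (faceMap j) ∈ S n) :
    ∃ g E, IsMult y₀ g ∧ Deforms y₀ g E ∧ ∀ n ≤ m, ∀ σ ∈ S n,
      E.app σ = ContinuousMap.const _ y₀ := by
  classical
  induction m with
  | zero =>
    refine ⟨_, _, IsMult.refl y₀, Deforms.refl y₀, fun n hn σ _ => ?_⟩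
    obtain rfl : n = 0 := by omega
    exact ContinuousMap.ext fun x => isEmptyElim x
  | succ m ih =>
    obtain ⟨g, E, hg, hE, hm⟩ := ih fun n h1 h2 => hK n h1 (by omega)
    obtain ⟨g', hg', hkill⟩ := (hK (m + 1) (by omega) le_rfl).finite
      (T := (fun σ => E.app σ) '' S (m + 1)) ((hfin _).image _) (by
        rintro _ ⟨σ, hσ, rfl⟩ x ⟨j, hj⟩
        obtain ⟨z, rfl⟩ := exists_faceMap_eq hj
        refine (DFunLike.congr_fun (E.comm j σ) z).trans ?_
        change E.app (σ.comp (faceMap j)) z = _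
        rw [hm m le_rfl _ (hface m j σ hσ)]
        rfl)
    have hE' := hE.comp hg'.1
    set E₀ := (push g').comp E with hE₀
    -- A null homotopy is chosen wherever one exists; constant simplices are held fixed, and all
    -- others stay where they are by default.
    let k : ∀ {n : ℕ}, C(Splx n, Y) → C(I × Splx n, Y) := fun {n} σ =>
      if σ = ContinuousMap.const _ y₀ then ContinuousMap.const _ y₀ else
      if h : (E₀.app σ).HomotopicRel (ContinuousMap.const _ y₀) (bd n) then h.some.toContinuousMap
      else (E₀.app σ).comp ContinuousMap.snd
    have k_const : ∀ n, k (ContinuousMap.const (Splx n) y₀) = ContinuousMap.const _ y₀ :=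
      fun n => if_pos rfl
    have k_spec : ∀ {n : ℕ} (σ : C(Splx n, Y)), (∀ x, k σ (0, x) = E₀.app σ x) ∧
        (∀ t, ∀ x ∈ bd n, k σ (t, x) = E₀.app σ x) ∧
        ((E₀.app σ).HomotopicRel (ContinuousMap.const _ y₀) (bd n) → ∀ x, k σ (1, x) = y₀) := by
      intro n σ
      by_cases hσ : σ = ContinuousMap.const _ y₀
      · subst hσ
        rw [k_const, hE'.const]
        exact ⟨fun _ => rfl, fun _ _ _ => rfl, fun _ _ => rfl⟩
      · by_cases h : (E₀.app σ).HomotopicRel (ContinuousMap.const _ y₀) (bd n)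
        · have e : k σ = h.some.toContinuousMap := (if_neg hσ).trans (dif_pos h)
          rw [e]
          exact ⟨fun x => h.some.apply_zero x, fun t x hx => h.some.eq_fst t hx,
            fun _ x => h.some.apply_one x⟩
        · have e : k σ = (E₀.app σ).comp ContinuousMap.snd := (if_neg hσ).trans (dif_neg h)
          rw [e]
          exact ⟨fun _ => rfl, fun _ _ _ => rfl, fun h' => absurd h' h⟩
    obtain ⟨E', H, h1, h2, h3⟩ := exists_natHomotopy E₀ hE'.const m k (fun σ => (k_spec σ).1)
      (fun σ t j x => ((k_spec σ).2.1 t _ ⟨j, faceMap_self j x⟩).trans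
        (DFunLike.congr_fun (E₀.comm j σ) x)) (k_const _)
    refine ⟨g'.comp g, E', hg'.comp hg, hE'.trans H h3, fun n hn σ hσ => ?_⟩
    rcases Nat.lt_or_eq_of_le hn with hlt | rfl
    · rw [h1 n (by omega)]
      change g'.comp (E.app σ) = _
      rw [hm n (by omega) σ hσ]
      exact ContinuousMap.ext fun x => hg'.1
    · refine ContinuousMap.ext fun x => ?_
      rw [h2]
      exact (k_spec σ).2.2 (hkill _ ⟨σ, hσ, rfl⟩) x

/-- The finite face-closed family generated by finitely many simplices. -/
lemma exists_faceClosed {N : ℕ} {T : Set C(Splx N, Y)} (hT : T.Finite) :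
    ∃ S : ∀ n, Set C(Splx n, Y), (∀ n, (S n).Finite) ∧
      (∀ n (j : Fin (n + 1)), ∀ σ ∈ S (n + 1), σ.comp (faceMap j) ∈ S n) ∧ T ⊆ S N := by
  -- All maps of vertices are allowed, degenerate ones included: there are finitely many for each
  -- `n`, and they are closed under composition with face maps.
  let sm : ∀ {n : ℕ} (f : Fin n → Fin N), C(Splx n, Splx N) := fun f =>
    ⟨stdSimplex.map f, stdSimplex.continuous_map _⟩
  refine ⟨fun n => {τ | ∃ σ ∈ T, ∃ f : Fin n → Fin N, τ = σ.comp (sm f)}, fun n => ?_, ?_, ?_⟩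
  · have : {τ | ∃ σ ∈ T, ∃ f : Fin n → Fin N, τ = σ.comp (sm f)} =
        (fun p : C(Splx N, Y) × (Fin n → Fin N) => p.1.comp (sm p.2)) '' (T ×ˢ Set.univ) := by
      ext τ
      constructor
      · rintro ⟨σ, hσ, f, rfl⟩
        exact ⟨(σ, f), ⟨hσ, trivial⟩, rfl⟩
      · rintro ⟨⟨σ, f⟩, ⟨hσ, -⟩, rfl⟩
        exact ⟨σ, hσ, f, rfl⟩
    change {τ | ∃ σ ∈ T, ∃ f : Fin n → Fin N, τ = σ.comp (sm f)}.Finite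
    rw [this]
    exact (hT.prod Set.finite_univ).image _
  · rintro n j _ ⟨σ, hσ, f, rfl⟩
    refine ⟨σ, hσ, f ∘ j.succAbove, ContinuousMap.ext fun x => ?_⟩
    exact congrArg σ (stdSimplex.map_comp_apply _ _ x)
  · intro σ hσ
    refine ⟨σ, hσ, id, ContinuousMap.ext fun x => ?_⟩
    exact congrArg σ (stdSimplex.map_id_apply x).symm

end

end

section

/-! ### The homotopy addition theorem for cubes -/

section
variable {Y : Type} [TopologicalSpace Y] (y₀ : Y)

/-- Being an end point of the unit interval. -/
def IsEnd (a : I) : Prop := a = 0 ∨ a = 1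

/-- The class of a generalized loop. -/
def hmk {y₀ : Y} {N : Type} (f : GenLoop N Y y₀) : HomotopyGroup N Y y₀ := Quotient.mk _ f

open Classical in
/-- The class of a map in the homotopy group, zero if the map is not a generalized loop. -/
def glClass {N : Type} [DecidableEq N] [Nontrivial N] (f : C(N → I, Y)) :
    Additive (HomotopyGroup N Y y₀) :=
  if h : f ∈ GenLoop N Y y₀ then Additive.ofMul (hmk ⟨f, h⟩) else 0

section
variable {y₀} {N : Type} [DecidableEq N] [Nontrivial N]

lemma hmk_transAt (i : N) (p q : GenLoop N Y y₀) :
    hmk (GenLoop.transAt i q p) = hmk p * hmk q := HomotopyGroup.mul_spec.symm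

lemma hmk_symmAt (i : N) (p : GenLoop N Y y₀) : hmk (GenLoop.symmAt i p) = (hmk p)⁻¹ :=
  HomotopyGroup.inv_spec.symm

lemma glClass_of_mem {f : C(N → I, Y)} (h : f ∈ GenLoop N Y y₀) :
    glClass y₀ f = Additive.ofMul (hmk ⟨f, h⟩) := dif_pos h

lemma glClass_eq_of_homotopicRel {f g : C(N → I, Y)} (hf : f ∈ GenLoop N Y y₀)
    (h : f.HomotopicRel g (Cube.boundary N)) : glClass y₀ f = glClass y₀ g := by
  have hg : g ∈ GenLoop N Y y₀ := fun y hy => by rw [← h.fst_eq_snd hy]; exact hf y hy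
  rw [glClass_of_mem hf, glClass_of_mem hg]
  exact congrArg Additive.ofMul (Quotient.sound h)

lemma glClass_const : glClass y₀ (ContinuousMap.const (N → I) y₀) = 0 := by
  rw [glClass_of_mem fun _ _ => rfl]
  exact congrArg Additive.ofMul (HomotopyGroup.one_def (N := N) (x := y₀)).symm

lemma homotopicRel_const_of_glClass {f : C(N → I, Y)} (hf : f ∈ GenLoop N Y y₀)
    (h : glClass y₀ f = 0) :
    f.HomotopicRel (ContinuousMap.const _ y₀) (Cube.boundary N) := by
  rw [glClass_of_mem hf] at h
  have h' : hmk ⟨f, hf⟩ = (1 : HomotopyGroup N Y y₀) := h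
  exact Quotient.exact h'

lemma glClass_sub {f f₁ f₂ : C(N → I, Y)} (h₁ : f₁ ∈ GenLoop N Y y₀)
    (h₂ : f₂ ∈ GenLoop N Y y₀) (l : N)
    (hf : ∀ t, f t = if (t l : ℝ) ≤ 1 / 2
      then f₁ (Function.update t l (Set.projIcc 0 1 zero_le_one (2 * t l : ℝ)))
      else f₂ (Function.update t l (Set.projIcc 0 1 zero_le_one (2 - 2 * t l : ℝ)))) :
    glClass y₀ f = glClass y₀ f₁ - glClass y₀ f₂ := by
  have e : f = (GenLoop.transAt l ⟨f₁, h₁⟩ (GenLoop.symmAt l ⟨f₂, h₂⟩)).1 := by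
    refine ContinuousMap.ext fun t => (hf t).trans ?_
    change _ = if (t l : ℝ) ≤ 1 / 2
      then f₁ (Function.update t l (Set.projIcc 0 1 zero_le_one (2 * t l : ℝ)))
      else f₂ (fun j => if j = l then unitInterval.symm (Function.update t l
        (Set.projIcc 0 1 zero_le_one (2 * t l - 1 : ℝ)) l) else Function.update t l
        (Set.projIcc 0 1 zero_le_one (2 * t l - 1 : ℝ)) j)
    split_ifs with h
    · rfl
    · congr 1
      funext j
      by_cases hj : j = l
      · subst hj
        rw [Function.update_self, Function.update_self, if_pos rfl]
        refine Subtype.ext ?_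
        have h0 : (0 : ℝ) ≤ t j := (t j).2.1
        have h1 : (t j : ℝ) ≤ 1 := (t j).2.2
        push Not at h
        rw [Set.projIcc_of_mem _ (by constructor <;> linarith), unitInterval.coe_symm_eq,
          Set.projIcc_of_mem _ (by constructor <;> linarith)]
        simp only
        ring
      · rw [if_neg hj, Function.update_of_ne hj, Function.update_of_ne hj]
  have hm : f ∈ GenLoop N Y y₀ := by rw [e]; exact Subtype.property _
  have e' : (⟨f, hm⟩ : GenLoop N Y y₀) = GenLoop.transAt l ⟨f₁, h₁⟩ (GenLoop.symmAt l ⟨f₂, h₂⟩) :=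
    Subtype.ext e
  rw [glClass_of_mem hm, glClass_of_mem h₁, glClass_of_mem h₂, sub_eq_add_neg, add_comm, e',
    hmk_transAt, hmk_symmAt]
  rfl

end

variable {k : ℕ}

/-- A face of a singular cube. -/
def cubeFace (u : C(Fin (k + 1) → I, Y)) (j : Fin (k + 1)) (e : I) : C(Fin k → I, Y) :=
  u.comp ⟨fun t => j.insertNth e t, by fun_prop⟩

lemma cubeFace_apply (u : C(Fin (k + 1) → I, Y)) (j : Fin (k + 1)) (e : I) (t : Fin k → I) :
    cubeFace u j e t = u (j.insertNth e t) := rfl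

/-- The faces of codimension two are mapped to the base point. -/
def CodimTwo (u : C(Fin (k + 1) → I, Y)) : Prop :=
  ∀ t : Fin (k + 1) → I, ∀ a b, a ≠ b → IsEnd (t a) → IsEnd (t b) → u t = y₀

variable {y₀}

lemma CodimTwo.mem_genLoop {u : C(Fin (k + 1) → I, Y)} (hu : CodimTwo y₀ u) (j : Fin (k + 1))
    {e : I} (he : IsEnd e) : cubeFace u j e ∈ GenLoop (Fin k) Y y₀ := by
  rintro t ⟨i, hi⟩
  exact hu _ j (j.succAbove i) (Fin.succAbove_ne _ _).symm (by simpa using he) (by simpa [IsEnd] using hi)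

/-- The first coordinate of the rotation of a square pushing one side onto the next. -/
def rotFst : C(I × I × I, I) where
  toFun p := ⟨(1 - p.2.2) * p.2.1 + p.2.2 * min 1 (((1 : ℝ) + p.1) * p.2.1), by
    obtain ⟨⟨r, hr, hr'⟩, ⟨s, hs, hs'⟩, ⟨t, ht, ht'⟩⟩ := p
    have h0 : 0 ≤ min 1 ((1 + r) * s) := le_min zero_le_one (by positivity)
    have h1 : min 1 ((1 + r) * s) ≤ 1 := min_le_left _ _
    constructor
    · have := mul_nonneg (sub_nonneg.2 ht') hs
      have := mul_nonneg ht h0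
      simp only
      linarith
    · simp only
      nlinarith⟩
  continuous_toFun := by
    refine Continuous.subtype_mk ?_ _
    fun_prop

/-- The second coordinate of the rotation of a square pushing one side onto the next. -/
def rotSnd : C(I × I × I, I) where
  toFun p := ⟨p.2.2 * min 1 (((1 : ℝ) + p.1) * (1 - p.2.1) + (1 - p.1)), by
    obtain ⟨⟨r, hr, hr'⟩, ⟨s, hs, hs'⟩, ⟨t, ht, ht'⟩⟩ := p
    have h0 : 0 ≤ min 1 ((1 + r) * (1 - s) + (1 - r)) := le_min zero_le_one
      (by have := mul_nonneg (by linarith : 0 ≤ 1 + r) (sub_nonneg.2 hs'); linarith)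
    have h1 : min 1 ((1 + r) * (1 - s) + (1 - r)) ≤ 1 := min_le_left _ _
    exact ⟨mul_nonneg ht h0, mul_le_one₀ ht' h0 h1⟩⟩
  continuous_toFun := by
    refine Continuous.subtype_mk ?_ _
    fun_prop

/-- For `r = 0` the rotation is the identity. For `r = 1` the top side of the square runs along the
top up to `s = 1 / 2` and then down the right side, while the right side collapses to the corner
`(1, 0)`. The left and bottom sides are fixed at all times. -/
lemma coe_rotFst (r s t : I) :
    (rotFst (r, s, t) : ℝ) = (1 - t) * s + t * min 1 (((1 : ℝ) + r) * s) := rfl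

lemma coe_rotSnd (r s t : I) :
    (rotSnd (r, s, t) : ℝ) = t * min 1 (((1 : ℝ) + r) * (1 - s) + (1 - r)) := rfl

lemma rotFst_zero (s t : I) : rotFst (0, s, t) = s := by
  refine Subtype.ext ?_
  rw [coe_rotFst, min_eq_right (by simpa using s.2.2)]
  simp
  ring

lemma rotSnd_zero (s t : I) : rotSnd (0, s, t) = t := by
  refine Subtype.ext ?_
  rw [coe_rotSnd, min_eq_left (by have := s.2.2; simp; linarith), mul_one]

lemma rotFst_left (r t : I) : rotFst (r, 0, t) = 0 := by
  refine Subtype.ext ?_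
  rw [coe_rotFst]
  simp

lemma rotSnd_left (r t : I) : rotSnd (r, 0, t) = t := by
  refine Subtype.ext ?_
  rw [coe_rotSnd, min_eq_left (by have := r.2.2; simp), mul_one]

lemma rotFst_right (r t : I) : rotFst (r, 1, t) = 1 := by
  refine Subtype.ext ?_
  rw [coe_rotFst, min_eq_left (by have := r.2.1; simp; linarith)]
  simp

lemma rotSnd_right (t : I) : rotSnd (1, 1, t) = 0 := by
  refine Subtype.ext ?_
  rw [coe_rotSnd]
  simp

lemma rotFst_bot (r s : I) : rotFst (r, s, 0) = s := by
  refine Subtype.ext ?_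
  rw [coe_rotFst]
  simp

lemma rotSnd_bot (r s : I) : rotSnd (r, s, 0) = 0 := by
  refine Subtype.ext ?_
  rw [coe_rotSnd]
  simp

lemma rot_top (r s : I) : rotFst (r, s, 1) = 1 ∨ rotSnd (r, s, 1) = 1 := by
  rcases le_total 1 ((1 + (r : ℝ)) * s) with h | h
  · left
    refine Subtype.ext ?_
    rw [coe_rotFst, min_eq_left h]
    simp
  · right
    refine Subtype.ext ?_
    rw [coe_rotSnd, min_eq_left (by linarith)]
    simp

lemma isEnd_rot (r : I) {s t : I} (h : IsEnd s ∨ IsEnd t) :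
    IsEnd (rotFst (r, s, t)) ∨ IsEnd (rotSnd (r, s, t)) := by
  rcases h with (rfl | rfl) | (rfl | rfl)
  · exact Or.inl (Or.inl (rotFst_left _ _))
  · exact Or.inl (Or.inr (rotFst_right _ _))
  · exact Or.inr (Or.inl (rotSnd_bot _ _))
  · exact (rot_top r s).imp Or.inr Or.inr

lemma isEnd_rot_one {s t : I} (hs : IsEnd s) (ht : IsEnd t) :
    IsEnd (rotFst (1, s, t)) ∧ IsEnd (rotSnd (1, s, t)) := by
  rcases hs with rfl | rfl
  · rw [rotFst_left, rotSnd_left]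
    exact ⟨Or.inl rfl, ht⟩
  · rw [rotFst_right, rotSnd_right]
    exact ⟨Or.inr rfl, Or.inl rfl⟩

/-- The rotation in two consecutive coordinates of a cube. -/
def rot (l : Fin k) : C(I × (Fin (k + 1) → I), Fin (k + 1) → I) where
  toFun p j := if j = l.castSucc then rotFst (p.1, p.2 l.castSucc, p.2 l.succ) else
    if j = l.succ then rotSnd (p.1, p.2 l.castSucc, p.2 l.succ) else p.2 j
  continuous_toFun := by
    refine continuous_pi fun j => ?_
    split_ifs <;> fun_prop

lemma castSucc_ne_succ (l : Fin k) : l.castSucc ≠ l.succ := (Fin.castSucc_lt_succ (i := l)).ne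

lemma rot_castSucc (l : Fin k) (r : I) (t : Fin (k + 1) → I) :
    rot l (r, t) l.castSucc = rotFst (r, t l.castSucc, t l.succ) := if_pos rfl

lemma rot_succ (l : Fin k) (r : I) (t : Fin (k + 1) → I) :
    rot l (r, t) l.succ = rotSnd (r, t l.castSucc, t l.succ) :=
  (if_neg (castSucc_ne_succ l).symm).trans (if_pos rfl)

lemma rot_of_ne (l : Fin k) (r : I) (t : Fin (k + 1) → I) {j : Fin (k + 1)} (h : j ≠ l.castSucc)
    (h' : j ≠ l.succ) : rot l (r, t) j = t j := (if_neg h).trans (if_neg h')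

lemma rot_zero (l : Fin k) (t : Fin (k + 1) → I) : rot l (0, t) = t := by
  funext j
  by_cases h : j = l.castSucc
  · rw [h, rot_castSucc, rotFst_zero]
  by_cases h' : j = l.succ
  · rw [h', rot_succ, rotSnd_zero]
  · rw [rot_of_ne l _ _ h h']

lemma rot_isEnd (l : Fin k) (r : I) {t : Fin (k + 1) → I} {j a : Fin (k + 1)}
    (h : j ≠ l.castSucc) (h' : j ≠ l.succ) (hj : IsEnd (t j)) (hne : j ≠ a) (ha : IsEnd (t a)) :
    ∃ a, j ≠ a ∧ IsEnd (rot l (r, t) j) ∧ IsEnd (rot l (r, t) a) := by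
  have key : IsEnd (t l.castSucc) ∨ IsEnd (t l.succ) →
      ∃ a, j ≠ a ∧ IsEnd (rot l (r, t) j) ∧ IsEnd (rot l (r, t) a) := by
    intro hend
    rcases isEnd_rot r hend with h1 | h1
    · exact ⟨_, h, by rwa [rot_of_ne l r t h h'], by rwa [rot_castSucc]⟩
    · exact ⟨_, h', by rwa [rot_of_ne l r t h h'], by rwa [rot_succ]⟩
  by_cases h1 : a = l.castSucc
  · exact key (Or.inl (h1 ▸ ha))
  by_cases h2 : a = l.succ
  · exact key (Or.inr (h2 ▸ ha))
  · exact ⟨a, hne, by rwa [rot_of_ne l r t h h'], by rwa [rot_of_ne l r t h1 h2]⟩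

/-- The singular cube after rotation. -/
def rotCube (u : C(Fin (k + 1) → I, Y)) (l : Fin k) : C(Fin (k + 1) → I, Y) :=
  u.comp ((rot l).comp ((ContinuousMap.const _ 1).prodMk (ContinuousMap.id _)))

lemma rotCube_apply (u : C(Fin (k + 1) → I, Y)) (l : Fin k) (t : Fin (k + 1) → I) :
    rotCube u l t = u (rot l (1, t)) := rfl

lemma CodimTwo.rotCube {u : C(Fin (k + 1) → I, Y)} (hu : CodimTwo y₀ u) (l : Fin k) :
    CodimTwo y₀ (rotCube u l) := by
  have key : ∀ (t : Fin (k + 1) → I) a b, a ≠ b → IsEnd (t a) → IsEnd (t b) →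
      a ≠ l.castSucc → a ≠ l.succ → RationalCell.rotCube u l t = y₀ := by
    intro t a b hab ha hb h h'
    obtain ⟨c, hc, h1, h2⟩ := rot_isEnd l 1 h h' ha hab hb
    exact hu _ a c hc h1 h2
  have key2 : ∀ (t : Fin (k + 1) → I), IsEnd (t l.castSucc) → IsEnd (t l.succ) →
      RationalCell.rotCube u l t = y₀ := by
    intro t h h'
    have := isEnd_rot_one h h'
    refine hu _ l.castSucc l.succ (castSucc_ne_succ l) ?_ ?_
    · change IsEnd (rot l (1, t) l.castSucc)
      rw [rot_castSucc]
      exact this.1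
    · change IsEnd (rot l (1, t) l.succ)
      rw [rot_succ]
      exact this.2
  intro t a b hab ha hb
  by_cases h1 : a = l.castSucc
  · by_cases h2 : b = l.succ
    · subst h1 h2
      exact key2 t ha hb
    · exact key t b a hab.symm hb ha (fun h => hab (h1.trans h.symm)) h2
  by_cases h2 : a = l.succ
  · by_cases h3 : b = l.castSucc
    · subst h2 h3
      exact key2 t hb ha
    · exact key t b a hab.symm hb ha h3 fun h => hab (h2.trans h.symm)
  · exact key t a b hab ha hb h1 h2

/-- For a face in a third direction the rotation is a homotopy of generalized loops: by `rot_isEnd`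
its boundary points keep two end coordinates at all times, and `u` sends such points to the base
point. -/
lemma cubeFace_rotCube_homotopic {u : C(Fin (k + 1) → I, Y)} (hu : CodimTwo y₀ u) (l : Fin k)
    {j : Fin (k + 1)} (h : j ≠ l.castSucc) (h' : j ≠ l.succ) {e : I} (he : IsEnd e) :
    (cubeFace u j e).HomotopicRel (cubeFace (rotCube u l) j e) (Cube.boundary (Fin k)) := by
  refine ⟨⟨⟨⟨fun p => u (rot l (p.1, j.insertNth e p.2)), by fun_prop⟩, fun t => ?_, fun t => ?_⟩,
    fun r t ht => ?_⟩⟩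
  · change u (rot l (0, _)) = _
    rw [rot_zero]
    rfl
  · rfl
  · change u (rot l (r, j.insertNth e t)) = cubeFace u j e t
    obtain ⟨i, hi⟩ := ht
    obtain ⟨c, hc, h1, h2⟩ := rot_isEnd l r (t := j.insertNth e t) h h' (by simpa using he)
      (Fin.succAbove_ne j i).symm (by simpa [IsEnd] using hi)
    rw [hu _ j c hc h1 h2, hu.mem_genLoop j he t ⟨i, hi⟩]

lemma cubeFace_eq_const {u : C(Fin (k + 1) → I, Y)} {j : Fin (k + 1)} {e : I}
    (h : ∀ t : Fin (k + 1) → I, t j = e → u t = y₀) :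
    cubeFace u j e = ContinuousMap.const _ y₀ :=
  ContinuousMap.ext fun t => h (j.insertNth e t) (by simp)

variable [Nontrivial (Fin k)]

/-- After the rotation the face `l + 1` follows the old face `l + 1` and then, backwards, the old
face `l`. This is a concatenation in the coordinate `l`. -/
lemma glClass_rotCube_face {u : C(Fin (k + 1) → I, Y)} (hu : CodimTwo y₀ u) (l : Fin k) :
    glClass y₀ (cubeFace (rotCube u l) l.succ 1) =
      glClass y₀ (cubeFace u l.succ 1) - glClass y₀ (cubeFace u l.castSucc 1) := by
  refine glClass_sub (hu.mem_genLoop _ (Or.inr rfl)) (hu.mem_genLoop _ (Or.inr rfl)) l fun t => ?_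
  have e1 : (l.succ.insertNth 1 t : Fin (k + 1) → I) l.castSucc = t l := by
    have : l.succ.succAbove l = l.castSucc :=
      Fin.succAbove_of_castSucc_lt _ _ (Fin.castSucc_lt_succ)
    rw [← this, Fin.insertNth_apply_succAbove]
  have e2 : (l.succ.insertNth 1 t : Fin (k + 1) → I) l.succ = 1 := Fin.insertNth_apply_same _ _ _
  have h0 : (0 : ℝ) ≤ t l := (t l).2.1
  have h1 : (t l : ℝ) ≤ 1 := (t l).2.2
  have hfst : (rotFst (1, t l, 1) : ℝ) = min 1 ((2 : ℝ) * t l) := by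
    rw [coe_rotFst]
    norm_num
  have hsnd : (rotSnd (1, t l, 1) : ℝ) = min 1 ((2 : ℝ) - 2 * t l) := by
    rw [coe_rotSnd]
    norm_num
    congr 1
    ring
  rw [cubeFace_apply, rotCube_apply]
  split_ifs with h
  · rw [cubeFace_apply]
    congr 1
    funext j
    rcases Fin.eq_self_or_eq_succAbove l.succ j with rfl | ⟨i, rfl⟩
    · rw [rot_succ, e1, e2, Fin.insertNth_apply_same]
      refine Subtype.ext ?_
      rw [hsnd, min_eq_left (by linarith)]
      rfl
    · rw [Fin.insertNth_apply_succAbove]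
      by_cases hi : i = l
      · subst hi
        rw [Function.update_self, Fin.succAbove_of_castSucc_lt _ _ (Fin.castSucc_lt_succ),
          rot_castSucc, e1, e2]
        refine Subtype.ext ?_
        rw [hfst, Set.projIcc_of_mem _ (by constructor <;> linarith), min_eq_right (by linarith)]
      · rw [Function.update_of_ne hi, rot_of_ne, Fin.insertNth_apply_succAbove]
        · rw [← Fin.succAbove_of_castSucc_lt _ _ (Fin.castSucc_lt_succ (i := l))]
          exact fun h => hi (Fin.succAbove_right_injective h)
        · exact Fin.succAbove_ne _ _
  · push Not at h
    rw [cubeFace_apply]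
    congr 1
    funext j
    have e3 : l.castSucc.succAbove l = l.succ := Fin.succAbove_of_le_castSucc _ _ le_rfl
    rcases Fin.eq_self_or_eq_succAbove l.castSucc j with rfl | ⟨i, rfl⟩
    · rw [rot_castSucc, e1, e2, Fin.insertNth_apply_same]
      refine Subtype.ext ?_
      rw [hfst, min_eq_left (by linarith)]
      rfl
    · rw [Fin.insertNth_apply_succAbove]
      by_cases hi : i = l
      · subst hi
        rw [Function.update_self, e3, rot_succ, e1, e2]
        refine Subtype.ext ?_
        rw [hsnd, Set.projIcc_of_mem _ (by constructor <;> linarith), min_eq_right (by linarith)]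
      · have hne : l.castSucc.succAbove i ≠ l.succ := by
          rw [← e3]
          exact fun h => hi (Fin.succAbove_right_injective h)
        rw [Function.update_of_ne hi, rot_of_ne _ _ _ (Fin.succAbove_ne _ _) hne]
        have e4 : l.castSucc.succAbove i = l.succ.succAbove i := by
          rcases lt_or_gt_of_ne hi with hlt | hlt
          · rw [Fin.succAbove_of_castSucc_lt _ _ (Fin.castSucc_lt_castSucc_iff.2 hlt),
              Fin.succAbove_of_castSucc_lt _ _ ((Fin.castSucc_lt_castSucc_iff.2 hlt).trans
                Fin.castSucc_lt_succ)]
          · rw [Fin.succAbove_of_le_castSucc _ _ (Fin.castSucc_le_castSucc_iff.2 hlt.le),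
              Fin.succAbove_of_le_castSucc _ _ (Fin.le_def.2 (by
                have := Fin.lt_def.1 hlt
                simp
                omega))]
        rw [e4, Fin.insertNth_apply_succAbove]

/-- The homotopy addition theorem for a cube with few non-trivial faces. -/
theorem sum_glClass_cubeFace {u : C(Fin (k + 1) → I, Y)} (hu : CodimTwo y₀ u)
    (h0 : ∀ j : Fin (k + 1), j ≠ Fin.last k → ∀ t : Fin (k + 1) → I, t j = 0 → u t = y₀) :
    ∑ j : Fin (k + 1), (-1 : ℤ) ^ (j : ℕ) • glClass y₀ (cubeFace u j 1) =
      (-1 : ℤ) ^ k • glClass y₀ (cubeFace u (Fin.last k) 0) := by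
  -- The faces `t j = 1` with `j < m` are already trivial, and `n` counts the remaining ones apart
  -- from the last. Each rotation makes one more face trivial.
  suffices H : ∀ (n m : ℕ), m + n = k → ∀ u : C(Fin (k + 1) → I, Y), CodimTwo y₀ u →
      (∀ j : Fin (k + 1), j ≠ Fin.last k → ∀ t : Fin (k + 1) → I, t j = 0 → u t = y₀) →
      (∀ j : Fin (k + 1), (j : ℕ) < m → ∀ t : Fin (k + 1) → I, t j = 1 → u t = y₀) →
      ∑ j : Fin (k + 1), (-1 : ℤ) ^ (j : ℕ) • glClass y₀ (cubeFace u j 1) =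
        (-1 : ℤ) ^ k • glClass y₀ (cubeFace u (Fin.last k) 0) from
    H k 0 (by omega) u hu h0 fun j hj => absurd hj (by omega)
  intro n
  induction n with
  | zero =>
    rintro m hm u hu h0 h1
    obtain rfl : m = k := by omega
    rw [Finset.sum_eq_single (Fin.last m)]
    · rw [Fin.val_last]
      congr 1
      -- Only the two faces in the last direction are left, and sliding the last coordinate from `0`
      -- to `1` is a homotopy between them.
      refine (glClass_eq_of_homotopicRel (hu.mem_genLoop _ (Or.inl rfl))
        ⟨⟨⟨⟨fun p => u ((Fin.last m).insertNth p.1 p.2), by fun_prop⟩, fun t => rfl, fun t => rfl⟩,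
          fun r t ht => ?_⟩⟩).symm
      change u _ = cubeFace u (Fin.last m) 0 t
      rw [hu.mem_genLoop _ (Or.inl rfl) t ht]
      obtain ⟨i, hi⟩ := ht
      have hlt : (Fin.last m).succAbove i ≠ Fin.last m := Fin.succAbove_ne _ _
      rcases hi with hi | hi
      · exact h0 _ hlt _ (by rw [Fin.insertNth_apply_succAbove]; exact hi)
      · exact h1 _ (Fin.lt_last_iff_ne_last.2 hlt) _ (by rw [Fin.insertNth_apply_succAbove]; exact hi)
    · intro j _ hj
      rw [cubeFace_eq_const (h1 j (Fin.lt_last_iff_ne_last.2 hj)), glClass_const, smul_zero]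
    · simp
  | succ n ih =>
    rintro m hm u hu h0 h1
    let l : Fin k := ⟨m, by omega⟩
    have hne := castSucc_ne_succ l
    have hface : ∀ t : Fin (k + 1) → I, t l.castSucc = 1 → rotCube u l t = y₀ := by
      intro t ht
      refine hu _ l.castSucc l.succ hne ?_ ?_
      · change IsEnd (rot l (1, t) l.castSucc)
        rw [rot_castSucc, ht, rotFst_right]
        exact Or.inr rfl
      · change IsEnd (rot l (1, t) l.succ)
        rw [rot_succ, ht, rotSnd_right]
        exact Or.inl rfl
    have hsum := ih (m + 1) (by omega) (rotCube u l) (hu.rotCube l) (fun j hj t ht => ?_)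
      (fun j hj t ht => ?_)
    · have hg : glClass y₀ (cubeFace (rotCube u l) (Fin.last k) 0) =
          glClass y₀ (cubeFace u (Fin.last k) 0) := by
        by_cases hq : Fin.last k = l.succ
        · congr 1
          refine ContinuousMap.ext fun t => ?_
          rw [cubeFace_apply, rotCube_apply, cubeFace_apply]
          congr 1
          have e : ((Fin.last k).insertNth 0 t : Fin (k + 1) → I) l.succ = 0 := by
            rw [← hq, Fin.insertNth_apply_same]
          funext j
          by_cases hj : j = l.castSucc
          · rw [hj, rot_castSucc, e, rotFst_bot]
          by_cases hj' : j = l.succ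
          · rw [hj', rot_succ, e, rotSnd_bot]
          · rw [rot_of_ne l _ _ hj hj']
        · exact (glClass_eq_of_homotopicRel (hu.mem_genLoop _ (Or.inl rfl))
            (cubeFace_rotCube_homotopic hu l (Fin.ne_of_gt (Fin.castSucc_lt_last l)) hq
              (Or.inl rfl))).symm
      rw [hg] at hsum
      rw [← hsum, ← Finset.add_sum_erase _ _ (Finset.mem_univ l.castSucc),
        ← Finset.add_sum_erase _ _ (Finset.mem_erase.2 ⟨hne.symm, Finset.mem_univ l.succ⟩),
        ← Finset.add_sum_erase (a := l.castSucc) _ _ (Finset.mem_univ l.castSucc),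
        ← Finset.add_sum_erase (a := l.succ) _ _
          (Finset.mem_erase.2 ⟨hne.symm, Finset.mem_univ l.succ⟩), ← add_assoc, ← add_assoc]
      congr 1
      -- If `a` and `b` are the classes of the faces `l` and `l + 1`, the pair contributes `(-1)^l
      -- (a - b)` before the rotation, and `0` together with `(-1)^(l+1) (b - a)` after it.
      · rw [cubeFace_eq_const hface, glClass_const, glClass_rotCube_face hu, Fin.val_succ,
          Fin.val_castSucc, pow_succ]
        simp only [mul_neg, mul_one, neg_smul, smul_sub, smul_zero]
        abel
      · refine Finset.sum_congr rfl fun j hj => ?_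
        rw [Finset.mem_erase, Finset.mem_erase] at hj
        congr 1
        exact glClass_eq_of_homotopicRel (hu.mem_genLoop _ (Or.inr rfl))
            (cubeFace_rotCube_homotopic hu l hj.2.1 hj.1 (Or.inr rfl))
    · refine h0 j hj (rot l (1, t)) ?_
      by_cases h : j = l.castSucc
      · rw [h] at ht
        rw [h, rot_castSucc, ht, rotFst_left]
      by_cases h' : j = l.succ
      · rw [h'] at ht
        rw [h', rot_succ, ht, rotSnd_bot]
      · rw [rot_of_ne l _ _ h h', ht]
    · rcases Nat.lt_succ_iff_lt_or_eq.1 hj with hlt | heq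
      · refine h1 j hlt (rot l (1, t)) ?_
        rw [rot_of_ne l, ht]
        · exact Fin.ne_of_lt (Fin.lt_def.2 hlt)
        · exact Fin.ne_of_lt (Fin.lt_def.2 (by simp [l]; omega))
      · obtain rfl : j = l.castSucc := Fin.ext heq
        exact hface t ht

end

end

section

/-! ### The homotopy addition theorem for simplices -/

/-- The coordinates of the map from the cube to the simplex. -/
def cubeCoord : ∀ k : ℕ, (Fin k → I) → Fin (k + 1) → ℝ
  | 0, _ => fun _ => 1
  | k + 1, t => Fin.cons (1 - (t 0 : ℝ)) fun i => t 0 * cubeCoord k (Fin.tail t) i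

/-- The coordinates are `1 - t₀`, `t₀ (1 - t₁)`, and so on up to the product of all `t_j`. The face
`t_j = 1` of the cube goes to the `j`-th face of the simplex and the face where the last `t_j` is
zero to the last face; every other face `t_j = 0` collapses into codimension at least two. This is
the shape required by `sum_glClass_cubeFace`. -/
lemma cubeCoord_zero {k : ℕ} (t : Fin (k + 1) → I) : cubeCoord (k + 1) t 0 = 1 - (t 0 : ℝ) := rfl

lemma cubeCoord_succ {k : ℕ} (t : Fin (k + 1) → I) (i : Fin (k + 1)) :
    cubeCoord (k + 1) t i.succ = t 0 * cubeCoord k (Fin.tail t) i := rfl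

lemma cubeCoord_nonneg : ∀ {k : ℕ} (t : Fin k → I) (i : Fin (k + 1)), 0 ≤ cubeCoord k t i
  | 0, _, _ => zero_le_one
  | k + 1, t, i => by
    refine Fin.cases ?_ (fun i => ?_) i
    · exact sub_nonneg.2 (t 0).2.2
    · exact mul_nonneg (t 0).2.1 (cubeCoord_nonneg _ i)

lemma sum_cubeCoord : ∀ {k : ℕ} (t : Fin k → I), ∑ i, cubeCoord k t i = 1
  | 0, _ => by simp [cubeCoord]
  | k + 1, t => by
    rw [Fin.sum_univ_succ]
    simp only [cubeCoord_zero, cubeCoord_succ]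
    rw [← Finset.mul_sum, sum_cubeCoord]
    ring

lemma continuous_cubeCoord : ∀ {k : ℕ} (i : Fin (k + 1)),
    Continuous fun t : Fin k → I => cubeCoord k t i
  | 0, _ => continuous_const
  | k + 1, i => by
    refine Fin.cases ?_ (fun i => ?_) i
    · simp only [cubeCoord_zero]
      fun_prop
    · simp only [cubeCoord_succ]
      refine Continuous.mul (by fun_prop) ((continuous_cubeCoord i).comp ?_)
      exact continuous_pi fun j => continuous_apply j.succ

/-- The map from the cube to the simplex. -/
def cubeMap (k : ℕ) : C(Fin k → I, Splx (k + 1)) where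
  toFun t := ⟨cubeCoord k t, fun i => cubeCoord_nonneg t i, sum_cubeCoord t⟩
  continuous_toFun := Continuous.subtype_mk (continuous_pi fun i => continuous_cubeCoord i) _

lemma cubeCoord_of_eq_one : ∀ {k : ℕ} (t : Fin k → I) (j : Fin k), t j = 1 →
    cubeCoord k t j.castSucc = 0
  | 0, _, j, _ => j.elim0
  | k + 1, t, j, h => by
    induction j using Fin.cases with
    | zero => rw [Fin.castSucc_zero, cubeCoord_zero, h]; simp
    | succ j =>
      rw [← Fin.succ_castSucc, cubeCoord_succ, cubeCoord_of_eq_one (Fin.tail t) j h, mul_zero]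

lemma cubeCoord_of_eq_zero : ∀ {k : ℕ} (t : Fin k → I) (j : Fin k), t j = 0 →
    ∀ i, j.castSucc < i → cubeCoord k t i = 0
  | 0, _, j, _ => j.elim0
  | k + 1, t, j, h => by
    intro i hi
    obtain ⟨i, rfl⟩ := Fin.exists_succ_eq.2 (Fin.ne_of_gt (lt_of_le_of_lt (Fin.zero_le _) hi))
    rw [cubeCoord_succ]
    induction j using Fin.cases with
    | zero => rw [h]; simp
    | succ j =>
      rw [cubeCoord_of_eq_zero (Fin.tail t) j h i (by
        rw [← Fin.succ_castSucc] at hi; exact Fin.succ_lt_succ_iff.1 hi), mul_zero]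

lemma cubeMap_mem_bd {k : ℕ} {t : Fin k → I} (h : t ∈ Cube.boundary (Fin k)) :
    cubeMap k t ∈ bd (k + 1) := by
  obtain ⟨j, h | h⟩ := h
  · exact ⟨Fin.last k, cubeCoord_of_eq_zero t j h _ (Fin.castSucc_lt_last j)⟩
  · exact ⟨j.castSucc, cubeCoord_of_eq_one t j h⟩

lemma cubeMap_injective : ∀ {k : ℕ} {t t' : Fin k → I}, t ∉ Cube.boundary (Fin k) →
    cubeCoord k t = cubeCoord k t' → t = t'
  | 0, _, _, _, _ => Subsingleton.elim _ _
  | k + 1, t, t', h, e => by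
    have h0 : (t 0 : ℝ) = t' 0 := by
      have := congrFun e 0
      rw [cubeCoord_zero, cubeCoord_zero] at this
      linarith
    have hne : (t 0 : ℝ) ≠ 0 := fun h0 => h ⟨0, Or.inl (Subtype.ext h0)⟩
    have ht : Fin.tail t = Fin.tail t' := by
      refine cubeMap_injective (fun ⟨j, hj⟩ => h ⟨j.succ, hj⟩) (funext fun i => ?_)
      have := congrFun e i.succ
      rw [cubeCoord_succ, cubeCoord_succ, ← h0] at this
      exact mul_left_cancel₀ hne this
    funext j
    induction j using Fin.cases with
    | zero => exact Subtype.ext h0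
    | succ j => exact congrFun ht j

lemma exists_cubeCoord_eq : ∀ {k : ℕ} (x : Fin (k + 1) → ℝ), (∀ i, 0 ≤ x i) → ∑ i, x i = 1 →
    ∃ t, cubeCoord k t = x
  | 0, x, _, hs => ⟨fun _ => 0, funext fun i => by
      rw [Fin.sum_univ_one] at hs
      rw [Fin.fin_one_eq_zero i, hs]
      rfl⟩
  | k + 1, x, h0, hs => by
    rw [Fin.sum_univ_succ] at hs
    have hle : 0 ≤ ∑ i : Fin (k + 1), x i.succ := Finset.sum_nonneg fun i _ => h0 _
    by_cases h : ∑ i : Fin (k + 1), x i.succ = 0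
    · have hz := (Finset.sum_eq_zero_iff_of_nonneg fun i _ => h0 _).1 h
      refine ⟨fun _ => 0, funext fun i => ?_⟩
      induction i using Fin.cases with
      | zero =>
        rw [cubeCoord_zero]
        simp
        linarith
      | succ i =>
        rw [cubeCoord_succ, hz i (Finset.mem_univ i)]
        simp
    · obtain ⟨t, ht⟩ := exists_cubeCoord_eq (fun i => x i.succ / ∑ i : Fin (k + 1), x i.succ)
        (fun i => div_nonneg (h0 _) hle) (by rw [← Finset.sum_div, div_self h])
      refine ⟨Fin.cons ⟨∑ i : Fin (k + 1), x i.succ, hle, by have := h0 0; linarith⟩ t,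
        funext fun i => ?_⟩
      induction i using Fin.cases with
      | zero =>
        rw [cubeCoord_zero, Fin.cons_zero]
        simp only
        linarith
      | succ i =>
        rw [cubeCoord_succ, Fin.cons_zero, Fin.tail_cons, ht]
        exact mul_div_cancel₀ _ h

lemma cubeMap_surjective (k : ℕ) : Function.Surjective (cubeMap k) := fun x => by
  obtain ⟨t, ht⟩ := exists_cubeCoord_eq (fun i => x i) x.2.1 x.2.2
  exact ⟨t, stdSimplex.ext ht⟩

lemma tail_insertNth_succ {k : ℕ} (j : Fin (k + 1)) (e : I) (s : Fin (k + 1) → I) :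
    Fin.tail (j.succ.insertNth e s : Fin (k + 2) → I) = j.insertNth e (Fin.tail s) := by
  funext i
  rcases Fin.eq_self_or_eq_succAbove j i with rfl | ⟨i, rfl⟩
  · rw [Fin.insertNth_apply_same]
    exact Fin.insertNth_apply_same (α := fun _ => I) i.succ e s
  · rw [Fin.insertNth_apply_succAbove, Fin.tail, ← Fin.succ_succAbove_succ,
      Fin.insertNth_apply_succAbove]
    rfl

lemma insertNth_succ_zero {k : ℕ} (j : Fin (k + 1)) (e : I) (s : Fin (k + 1) → I) :
    (j.succ.insertNth e s : Fin (k + 2) → I) 0 = s 0 := by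
  have := Fin.insertNth_apply_succAbove (α := fun _ => I) j.succ e s 0
  rwa [Fin.succ_succAbove_zero] at this

lemma cubeCoord_insertNth_one : ∀ {k : ℕ} (j : Fin (k + 1)) (s : Fin k → I) (i : Fin (k + 1)),
    cubeCoord (k + 1) (j.insertNth 1 s) (j.castSucc.succAbove i) = cubeCoord k s i
  | k, j, s, i => by
    induction j using Fin.cases with
    | zero =>
      rw [Fin.castSucc_zero, Fin.zero_succAbove, cubeCoord_succ]
      simp
    | succ j =>
      cases k with
      | zero => exact j.elim0
      | succ k =>
        induction i using Fin.cases with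
        | zero =>
          rw [← Fin.succ_castSucc, Fin.succ_succAbove_zero, cubeCoord_zero, cubeCoord_zero,
            insertNth_succ_zero]
        | succ i =>
          rw [← Fin.succ_castSucc, Fin.succ_succAbove_succ, cubeCoord_succ, cubeCoord_succ,
            tail_insertNth_succ, cubeCoord_insertNth_one, insertNth_succ_zero]

lemma cubeCoord_insertNth_last : ∀ {k : ℕ} (s : Fin k → I) (i : Fin (k + 1)),
    cubeCoord (k + 1) ((Fin.last k).insertNth 0 s) i.castSucc = cubeCoord k s i
  | 0, s, i => by
    rw [Fin.fin_one_eq_zero i, Fin.castSucc_zero, cubeCoord_zero]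
    simp [cubeCoord]
  | k + 1, s, i => by
    rw [← Fin.succ_last]
    induction i using Fin.cases with
    | zero => rw [Fin.castSucc_zero, cubeCoord_zero, cubeCoord_zero, insertNth_succ_zero]
    | succ i =>
      rw [← Fin.succ_castSucc, cubeCoord_succ, cubeCoord_succ, tail_insertNth_succ,
        cubeCoord_insertNth_last, insertNth_succ_zero]

lemma cubeMap_insertNth_one {k : ℕ} (j : Fin (k + 1)) (s : Fin k → I) :
    cubeMap (k + 1) (j.insertNth 1 s) = faceMap j.castSucc (cubeMap k s) := by
  refine stdSimplex.ext (funext fun i => ?_)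
  rcases Fin.eq_self_or_eq_succAbove j.castSucc i with rfl | ⟨i, rfl⟩
  · rw [faceMap_self]
    exact cubeCoord_of_eq_one _ j (by simp)
  · rw [faceMap_succAbove]
    exact cubeCoord_insertNth_one j s i

lemma cubeMap_insertNth_last {k : ℕ} (s : Fin k → I) :
    cubeMap (k + 1) ((Fin.last k).insertNth 0 s) = faceMap (Fin.last (k + 1)) (cubeMap k s) := by
  refine stdSimplex.ext (funext fun i => ?_)
  rcases Fin.eq_self_or_eq_succAbove (Fin.last (k + 1)) i with rfl | ⟨i, rfl⟩
  · rw [faceMap_self]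
    exact cubeCoord_of_eq_zero _ (Fin.last k) (by simp) _ (Fin.castSucc_lt_last _)
  · rw [faceMap_succAbove, Fin.succAbove_last]
    exact cubeCoord_insertNth_last s i

/-! ### Homotopy classes of spherical simplices -/

section
variable {Y : Type} [TopologicalSpace Y] (y₀ : Y) {k : ℕ}

/-- A simplex whose faces of codimension two are mapped to the base point. -/
def SphericalFaces {n : ℕ} (w : C(Splx n, Y)) : Prop :=
  ∀ x, ∀ a b, a ≠ b → x a = 0 → x b = 0 → w x = y₀

variable {y₀}

lemma cubeMap_two_zero {t : Fin (k + 1) → I} {j : Fin (k + 1)} (hj : j ≠ Fin.last k)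
    (h : t j = 0) : ∃ a b, a ≠ b ∧ cubeMap (k + 1) t a = 0 ∧ cubeMap (k + 1) t b = 0 := by
  refine ⟨Fin.last (k + 1), (Fin.last k).castSucc, (Fin.castSucc_lt_last _).ne', ?_, ?_⟩
  · exact cubeCoord_of_eq_zero t j h _ (Fin.castSucc_lt_last j)
  · exact cubeCoord_of_eq_zero t j h _ (Fin.castSucc_lt_castSucc_iff.2
      (Fin.lt_last_iff_ne_last.2 hj))

lemma SphericalFaces.codimTwo {w : C(Splx (k + 2), Y)} (hw : SphericalFaces y₀ w) :
    CodimTwo y₀ (w.comp (cubeMap (k + 1))) := by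
  have key : ∀ (t : Fin (k + 1) → I) a b, t a = 1 → t b = 0 →
      w.comp (cubeMap (k + 1)) t = y₀ := fun t a b ha hb =>
    hw _ a.castSucc (Fin.last (k + 1)) (Fin.castSucc_lt_last a).ne (cubeCoord_of_eq_one t a ha)
      (cubeCoord_of_eq_zero t b hb _ (Fin.castSucc_lt_last b))
  have key2 : ∀ (t : Fin (k + 1) → I) a, a ≠ Fin.last k → t a = 0 →
      w.comp (cubeMap (k + 1)) t = y₀ := by
    intro t a ha h
    obtain ⟨i, j, hij, hi, hj⟩ := cubeMap_two_zero ha h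
    exact hw _ i j hij hi hj
  rintro t a b hab (ha | ha) (hb | hb)
  · by_cases h : a = Fin.last k
    · exact key2 t b (fun h' => hab (h.trans h'.symm)) hb
    · exact key2 t a h ha
  · exact key t b a hb ha
  · exact key t a b ha hb
  · exact hw _ a.castSucc b.castSucc (fun h => hab (Fin.castSucc_injective _ h))
      (cubeCoord_of_eq_one t a ha) (cubeCoord_of_eq_one t b hb)

variable [Nontrivial (Fin k)]

variable (y₀) in
/-- The class of a spherical simplex in the homotopy group. -/
def splxClass (τ : C(Splx (k + 1), Y)) : Additive (HomotopyGroup (Fin k) Y y₀) :=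
  glClass y₀ (τ.comp (cubeMap k))

/-- The homotopy addition theorem for a simplex. -/
theorem sum_splxClass_face {w : C(Splx (k + 2), Y)} (hw : SphericalFaces y₀ w) :
    ∑ j : Fin (k + 2), (-1 : ℤ) ^ (j : ℕ) • splxClass y₀ (w.comp (faceMap j)) = 0 := by
  have h := sum_glClass_cubeFace hw.codimTwo fun _ hj _ ht => by
    obtain ⟨a, b, hab, ha, hb⟩ := cubeMap_two_zero hj ht
    exact hw _ a b hab ha hb
  have h1 : ∀ j : Fin (k + 1), cubeFace (w.comp (cubeMap (k + 1))) j 1 =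
      (w.comp (faceMap j.castSucc)).comp (cubeMap k) := fun j =>
    ContinuousMap.ext fun t => congrArg w (cubeMap_insertNth_one j t)
  have h2 : cubeFace (w.comp (cubeMap (k + 1))) (Fin.last k) 0 =
      (w.comp (faceMap (Fin.last (k + 1)))).comp (cubeMap k) :=
    ContinuousMap.ext fun t => congrArg w (cubeMap_insertNth_last t)
  rw [Fin.sum_univ_castSucc]
  simp only [h1, h2] at h
  simp only [splxClass, Fin.val_castSucc, Fin.val_last]
  rw [h, pow_succ]
  simp

omit [Nontrivial (Fin k)] in
lemma Spherical.mem_genLoop {τ : C(Splx (k + 1), Y)} (h : Spherical y₀ τ) :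
    τ.comp (cubeMap k) ∈ GenLoop (Fin k) Y y₀ := fun _ ht => h _ (cubeMap_mem_bd ht)

lemma splxClass_const : splxClass y₀ (ContinuousMap.const (Splx (k + 1)) y₀) = 0 :=
  glClass_const

/-- `cubeMap` identifies boundary points of the cube only, and there the null homotopy is constant.
So it descends along the quotient map from `I × cube` to `I × simplex`. -/
lemma homotopicRel_const_of_splxClass {τ : C(Splx (k + 1), Y)} (hτ : Spherical y₀ τ)
    (h : splxClass y₀ τ = 0) : τ.HomotopicRel (ContinuousMap.const _ y₀) (bd (k + 1)) := by
  obtain ⟨H⟩ := homotopicRel_const_of_glClass hτ.mem_genLoop h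
  let q : C(I × (Fin k → I), I × Splx (k + 1)) := (ContinuousMap.id I).prodMap (cubeMap k)
  have hq : IsQuotientMap q := IsQuotientMap.of_surjective_continuous
    (Function.surjective_id.prodMap (cubeMap_surjective k)) q.continuous
  have hbd : ∀ (r : I) t, t ∈ Cube.boundary (Fin k) → H (r, t) = y₀ := fun r t ht =>
    (H.eq_fst r ht).trans (hτ.mem_genLoop t ht)
  have hfac : Function.FactorsThrough H.toContinuousMap q := by
    rintro ⟨r, t⟩ ⟨r', t'⟩ e
    obtain ⟨e1, e2⟩ := Prod.ext_iff.1 e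
    change r = r' at e1
    subst e1
    have e3 : cubeCoord k t = cubeCoord k t' := congrArg (fun x : Splx (k + 1) => ⇑x) e2
    by_cases ht : t ∈ Cube.boundary (Fin k)
    · by_cases ht' : t' ∈ Cube.boundary (Fin k)
      · exact (hbd r t ht).trans (hbd r t' ht').symm
      · rw [cubeMap_injective ht' e3.symm]
    · rw [cubeMap_injective ht e3]
  have hL : ∀ r t, hq.lift H.toContinuousMap hfac (r, cubeMap k t) = H (r, t) := fun r t =>
    DFunLike.congr_fun (hq.lift_comp H.toContinuousMap hfac) (r, t)
  refine ⟨⟨⟨hq.lift H.toContinuousMap hfac, fun x => ?_, fun x => ?_⟩, fun r x hx => ?_⟩⟩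
  · obtain ⟨t, rfl⟩ := cubeMap_surjective k x
    change hq.lift H.toContinuousMap hfac (0, cubeMap k t) = _
    rw [hL, H.apply_zero]
    rfl
  · obtain ⟨t, rfl⟩ := cubeMap_surjective k x
    change hq.lift H.toContinuousMap hfac (1, cubeMap k t) = _
    rw [hL, H.apply_one]
    rfl
  · obtain ⟨t, rfl⟩ := cubeMap_surjective k x
    change hq.lift H.toContinuousMap hfac (r, cubeMap k t) = _
    rw [hL, hτ _ hx]
    by_cases ht : t ∈ Cube.boundary (Fin k)
    · exact hbd r t ht
    · exfalso
      obtain ⟨i, hi⟩ := hx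
      -- Interior points of the cube have no zero barycentric coordinate, so only boundary points
      -- are mapped to `bd`.
      have hpos : ∀ {k : ℕ} {t : Fin k → I}, t ∉ Cube.boundary (Fin k) →
          ∀ i, cubeCoord k t i ≠ 0 := by
        intro k
        induction k with
        | zero => exact fun _ _ => one_ne_zero
        | succ k ih =>
          intro t ht i
          induction i using Fin.cases with
          | zero =>
            rw [cubeCoord_zero, sub_ne_zero]
            exact fun h => ht ⟨0, Or.inr (Subtype.ext h.symm)⟩
          | succ i =>
            rw [cubeCoord_succ]
            exact mul_ne_zero (fun h => ht ⟨0, Or.inl (Subtype.ext h)⟩)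
              (ih (fun ⟨j, hj⟩ => ht ⟨j.succ, hj⟩) i)
      exact hpos ht i hi

end

end

section

/-! ### Integral and rational chains -/

section
variable {Y Z : Type} [TopologicalSpace Y] [TopologicalSpace Z]

/-- The rational chain of an integral chain. -/
def toRat (S : FaceSet) (n : ℕ) : S.Chain ℤ n →ₗ[ℤ] S.Chain ℚ n :=
  lift ℤ fun s => of ℚ s

@[simp] lemma toRat_of {S : FaceSet} {n : ℕ} (s : S.obj n) : toRat S n (of ℤ s) = of ℚ s := by
  simp [toRat]

lemma toRat_apply {S : FaceSet} {n : ℕ} (c : S.Chain ℤ n) (s : S.obj n) :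
    toRat S n c s = (c s : ℚ) := by
  classical
  refine chain_induction (p := fun c => toRat S n c s = (c s : ℚ)) c (by simp) ?_ ?_
  · intro a b ha hb
    rw [map_add, Finsupp.add_apply, ha, hb, Finsupp.add_apply, Int.cast_add]
  · intro r t
    rw [map_smul, toRat_of]
    simp [of, Finsupp.single_apply]

lemma toRat_injective {S : FaceSet} {n : ℕ} : Function.Injective (toRat S n) := by
  intro c c' h
  refine Finsupp.ext fun s => ?_
  have := DFunLike.congr_fun h s
  rw [toRat_apply, toRat_apply] at this
  exact_mod_cast this

lemma toRat_map {S T : FaceSet} (f : Hom S T) {n : ℕ} (c : S.Chain ℤ n) :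
    toRat T n (f.map ℤ n c) = f.map ℚ n (toRat S n c) := by
  have : (toRat T n).comp (f.map ℤ n) = ((f.map ℚ n).restrictScalars ℤ).comp (toRat S n) :=
    chain_hom_ext fun s => by simp
  exact LinearMap.congr_fun this c

lemma toRat_d {S : FaceSet} {n : ℕ} (c : S.Chain ℤ (n + 1)) :
    toRat S n (d ℤ n c) = d ℚ n (toRat S (n + 1) c) := by
  have : (toRat S n).comp (d ℤ n) = ((d ℚ n).restrictScalars ℤ).comp (toRat S (n + 1)) := by
    refine chain_hom_ext fun s => ?_
    simp only [LinearMap.comp_apply, LinearMap.coe_restrictScalars, toRat_of, d_of, map_sum,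
      map_smul]
    refine Finset.sum_congr rfl fun j _ => ?_
    rcases Nat.even_or_odd (j : ℕ) with hj | hj <;> simp [hj.neg_one_pow]
  exact LinearMap.congr_fun this c

lemma exists_smul_eq_toRat {S : FaceSet} {n : ℕ} (q : S.Chain ℚ n) :
    ∃ N : ℕ, 1 ≤ N ∧ ∃ c, (N : ℚ) • q = toRat S n c := by
  refine chain_induction (p := fun q => ∃ N : ℕ, 1 ≤ N ∧ ∃ c, (N : ℚ) • q = toRat S n c) q
    ⟨1, le_rfl, 0, by simp⟩ ?_ ?_
  · rintro a b ⟨N, hN, c, hc⟩ ⟨M, hM, e, he⟩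
    refine ⟨N * M, Nat.mul_pos hN hM, (M : ℤ) • c + (N : ℤ) • e, ?_⟩
    rw [map_add, map_smul, map_smul, ← hc, ← he]
    push_cast
    rw [smul_add, natCast_zsmul, natCast_zsmul, ← Nat.cast_smul_eq_nsmul ℚ,
      ← Nat.cast_smul_eq_nsmul ℚ, smul_smul, smul_smul, mul_comm (N : ℚ)]
  · intro r s
    refine ⟨r.den, r.den_pos, r.num • of ℤ s, ?_⟩
    rw [map_smul, toRat_of, smul_smul, ← Int.cast_smul_eq_zsmul ℚ, mul_comm, Rat.mul_den_eq_num]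

lemma toRat_mem_cyc {S : FaceSet} {n : ℕ} {c : S.Chain ℤ n} :
    toRat S n c ∈ cyc ℚ S n ↔ c ∈ cyc ℤ S n := by
  cases n with
  | zero => exact Iff.rfl
  | succ n =>
    change d ℚ n _ = 0 ↔ d ℤ n _ = 0
    rw [← toRat_d, ← map_zero (toRat S n), toRat_injective.eq_iff]

lemma toRat_mem_bdry {S : FaceSet} {n : ℕ} {c : S.Chain ℤ n} (h : c ∈ bdry ℤ S n) :
    toRat S n c ∈ bdry ℚ S n := by
  obtain ⟨w, rfl⟩ := h
  exact ⟨toRat S (n + 1) w, (toRat_d w).symm⟩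

/-- Clearing the denominators of a rational filling: an integral class which vanishes rationally is
torsion. -/
lemma exists_smul_mem_bdry {S : FaceSet} {n : ℕ} {c : S.Chain ℤ n}
    (h : toRat S n c ∈ bdry ℚ S n) : ∃ N : ℕ, 1 ≤ N ∧ (N : ℤ) • c ∈ bdry ℤ S n := by
  obtain ⟨q, hq⟩ := h
  obtain ⟨N, hN, w, hw⟩ := exists_smul_eq_toRat q
  refine ⟨N, hN, w, toRat_injective ?_⟩
  rw [toRat_d, ← hw, map_smul, hq, map_smul, natCast_zsmul, Nat.cast_smul_eq_nsmul]

/-! ### Killing homotopy groups -/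

variable {y₀ : Y}

lemma Spherical.face {n : ℕ} {σ : C(Splx (n + 1), Y)} (h : Spherical y₀ σ) (j : Fin (n + 1)) :
    σ.comp (faceMap j) = ContinuousMap.const _ y₀ :=
  ContinuousMap.ext fun x => h _ ⟨j, faceMap_self j x⟩

lemma spherical_of_face {n : ℕ} {σ : C(Splx (n + 1), Y)}
    (h : ∀ j, σ.comp (faceMap j) = ContinuousMap.const _ y₀) : Spherical y₀ σ := by
  rintro x ⟨j, hj⟩
  obtain ⟨z, rfl⟩ := exists_faceMap_eq hj
  exact DFunLike.congr_fun (h j) z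

/-- The boundary of a spherical simplex is an alternating sum of constant simplices, which need not
cancel. The constant simplex has the same boundary, so it is subtracted. -/
lemma Spherical.sub_mem_cyc {R : Type} [CommRing R] {n : ℕ} {σ : C(Splx n, Y)}
    (h : Spherical y₀ σ) :
    of R (S := Sing Y) σ - of R (S := Sing Y) (ContinuousMap.const _ y₀) ∈ cyc R (Sing Y) n := by
  cases n with
  | zero => trivial
  | succ n =>
    change d R n _ = 0
    rw [map_sub, d_of, d_of, sub_eq_zero]
    refine Finset.sum_congr rfl fun j _ => ?_
    change _ • of R (S := Sing Y) (σ.comp (faceMap j)) = _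
    rw [h.face j]
    rfl

lemma sphericalFaces_of_face {n : ℕ} {w : C(Splx (n + 2), Y)}
    (h : ∀ j, Spherical y₀ (w.comp (faceMap j))) : SphericalFaces y₀ w := by
  intro x a b hab ha hb
  obtain ⟨z, rfl⟩ := exists_faceMap_eq ha
  refine h a z ?_
  obtain ⟨b, rfl⟩ := Fin.exists_succAbove_eq hab.symm
  exact ⟨b, by rwa [faceMap_succAbove] at hb⟩

/-- Extending the class in the homotopy group to chains. -/
lemma lift_splxClass_d {k : ℕ} [Nontrivial (Fin k)] {c : (Sing Y).Chain ℤ (k + 2)}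
    (hc : ∀ σ ∈ c.support, SphericalFaces y₀ (σ : C(Splx (k + 2), Y))) :
    lift ℤ (S := Sing Y) (splxClass (k := k) y₀) (d ℤ (k + 1) c) = 0 := by
  have : c ∈ Finsupp.supported ℤ ℤ {σ : C(Splx (k + 2), Y) | SphericalFaces y₀ σ} :=
    (Finsupp.mem_supported _ _).2 hc
  refine (Submodule.mem_bot ℤ).1 (map_mem_of_supported
    ((lift ℤ (S := Sing Y) (splxClass (k := k) y₀)).comp (d ℤ (k + 1))) ⊥ (fun σ hσ => ?_) this)
  rw [Submodule.mem_bot, LinearMap.comp_apply, d_of, map_sum]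
  simp only [map_smul, lift_of]
  exact sum_splxClass_face hσ

variable (y₀) in
/-- There are self-maps acting on reduced homology as any given positive integer. -/
def HasMult : Prop := ∀ N : ℕ, 1 ≤ N → ∃ g : C(Y, Y), g y₀ = y₀ ∧
  ∀ n, ∀ c ∈ cyc ℤ (Sing Y) n, (push g).map ℤ n c - (N : ℤ) • c ∈ bdry ℤ (Sing Y) n

lemma exists_deforms_of_finite (m : ℕ) (hK : ∀ n, 1 ≤ n → n ≤ m → Kills y₀ n) {N : ℕ}
    {T : Set C(Splx N, Y)} (hT : T.Finite) : ∃ g E, IsMult y₀ g ∧ Deforms y₀ g E ∧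
      (N = m + 1 → ∀ σ ∈ T, Spherical y₀ (E.app σ)) ∧
      (N = m + 2 → ∀ σ ∈ T, SphericalFaces y₀ (E.app σ)) := by
  obtain ⟨S, hfin, hface, hTS⟩ := exists_faceClosed hT
  obtain ⟨g, E, hg, hE, h⟩ := exists_deforms m hK S hfin hface
  have key : ∀ σ ∈ S (m + 1), Spherical y₀ (E.app σ) := fun σ hσ => spherical_of_face fun j =>
    (E.comm j σ).trans (h m le_rfl _ (hface m j σ hσ))
  refine ⟨g, E, hg, hE, ?_, ?_⟩
  · rintro rfl σ hσ
    exact key σ (hTS hσ)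
  · rintro rfl σ hσ
    refine sphericalFaces_of_face fun j => ?_
    have : (E.app σ).comp (faceMap j) = E.app (σ.comp (faceMap j)) := E.comm j σ
    rw [this]
    exact key _ (hface _ j σ (hTS hσ))

lemma support_map_subset {S T : FaceSet} (f : Hom S T) {n : ℕ} (c : S.Chain ℤ n) {t : T.obj n}
    (ht : t ∈ (f.map ℤ n c).support) : ∃ s ∈ c.support, t = f.app s := by
  have h : f.map ℤ n c ∈ Finsupp.supported ℤ ℤ {t | ∃ s ∈ c.support, t = f.app s} :=
    map_mem_of_supported (s := (c.support : Set (S.obj n))) (f.map ℤ n) _ (fun s hs => by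
      rw [Hom.map_of]
      exact Finsupp.single_mem_supported ℤ 1 ⟨s, hs, rfl⟩)
      ((Finsupp.mem_supported _ _).2 (le_refl (c.support : Set (S.obj n))))
  exact (Finsupp.mem_supported _ _).1 h ht

/-- The cycle `τ - const` is torsion in integral homology, so a self-map acting as a suitable `N`
makes it the boundary of an integral chain `w`. After one more self-map, the finitely many simplices
of `w` can be deformed to have spherical faces. Applying the homotopy addition theorem to each of
them shows that the class of the deformed `τ` in the homotopy group is zero. -/
lemma Kills.succ {k : ℕ} [Nontrivial (Fin k)] (hM : HasMult y₀)
    (hK : ∀ n, 1 ≤ n → n ≤ k → Kills y₀ n) (hA : Acyc ℚ Y (k + 1)) : Kills y₀ (k + 1) := by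
  intro τ hτ
  obtain ⟨N, hN, hz⟩ := exists_smul_mem_bdry
    (c := of ℤ (S := Sing Y) τ - of ℤ (S := Sing Y) (ContinuousMap.const _ y₀))
    (hA _ (toRat_mem_cyc.2 hτ.sub_mem_cyc))
  obtain ⟨F, hF, hFN⟩ := hM N hN
  obtain ⟨w, hw⟩ : (push F).map ℤ (k + 1)
      (of ℤ (S := Sing Y) τ - of ℤ (S := Sing Y) (ContinuousMap.const _ y₀)) ∈
      bdry ℤ (Sing Y) (k + 1) := by
    have := Submodule.add_mem _ (hFN _ _ hτ.sub_mem_cyc) hz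
    rwa [sub_add_cancel] at this
  obtain ⟨g, E, hg, hE, -, hsph⟩ := exists_deforms_of_finite k hK (N := k + 2)
    (T := (w.support : Set ((Sing Y).obj (k + 2)))) w.support.finite_toSet
  have hFτ : Spherical y₀ (F.comp τ) := hτ.comp hF
  refine ⟨g.comp F, hg.comp ⟨hF, N, hN, hFN⟩, ?_⟩
  rw [ContinuousMap.comp_assoc]
  refine (hE.rel _ hFτ).trans (homotopicRel_const_of_splxClass ?_ ?_)
  · intro x hx
    rw [← (hE.rel _ hFτ).fst_eq_snd hx]
    exact (hFτ.comp hg.1) x hx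
  · have h := lift_splxClass_d (y₀ := y₀) (c := E.map ℤ (k + 2) w) (fun t ht => by
      obtain ⟨s, hs, rfl⟩ := support_map_subset E w ht
      exact hsph rfl s hs)
    rw [Hom.d_map, hw, map_sub, map_sub, map_sub, Hom.map_of, Hom.map_of, Hom.map_of, Hom.map_of,
      lift_of, lift_of] at h
    have hc : E.app ((push F).app (ContinuousMap.const (Splx (k + 1)) y₀)) =
        ContinuousMap.const _ y₀ := by
      have : (push F).app (ContinuousMap.const (Splx (k + 1)) y₀) =
          ContinuousMap.const (Splx (k + 1)) y₀ := ContinuousMap.ext fun x => hF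
      rw [this, hE.const]
    rw [hc, splxClass_const, sub_zero] at h
    exact h

lemma kills_one [PathConnectedSpace Y] : Kills y₀ 1 := by
  intro σ _
  have hu : ∀ x : Splx 1, x = vert 1 0 := by
    intro x
    refine stdSimplex.ext (funext fun i => ?_)
    have h1 : ∀ x : Splx 1, x 0 = 1 := fun x => by
      have hs : ∑ i, x i = 1 := x.2.2
      rwa [Fin.sum_univ_one] at hs
    rw [Fin.fin_one_eq_zero i, h1, h1]
  obtain ⟨γ⟩ := PathConnectedSpace.joined (σ (vert 1 0)) y₀
  refine ⟨_, IsMult.refl y₀, ⟨⟨⟨γ.toContinuousMap.comp ContinuousMap.fst, fun x => ?_, fun x => ?_⟩,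
    fun t x hx => ?_⟩⟩⟩
  · rw [hu x]
    exact γ.source
  · exact γ.target
  · obtain ⟨i, hi⟩ := hx
    have hs : ∑ i, x i = 1 := x.2.2
    rw [Fin.sum_univ_one] at hs
    rw [Fin.fin_one_eq_zero i, hs] at hi
    exact absurd hi one_ne_zero

/-- The point of the segment with given second coordinate. -/
def segPoint : C(I, Splx 2) where
  toFun t := ⟨![1 - t, t], fun i => by
    fin_cases i
    · exact sub_nonneg.2 t.2.2
    · exact t.2.1, by simp⟩
  continuous_toFun := Continuous.subtype_mk (continuous_pi fun i => by
    fin_cases i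
    · exact continuous_const.sub continuous_subtype_val
    · exact continuous_subtype_val) _

lemma kills_two [SimplyConnectedSpace Y] : Kills y₀ 2 := by
  intro σ hσ
  let s : C(Splx 2, I) := ⟨fun x => ⟨x 1, x.2.1 1, splx_le_one x 1⟩,
    (continuous_splx_apply 1).subtype_mk _⟩
  have hs : ∀ x, segPoint (s x) = x := fun x => by
    have hx : ∑ i, x i = 1 := x.2.2
    rw [Fin.sum_univ_two] at hx
    refine stdSimplex.ext (funext fun i => ?_)
    fin_cases i
    · change 1 - x 1 = x 0
      linarith
    · rfl
  let γ : Path y₀ y₀ := ⟨σ.comp segPoint, hσ _ ⟨1, rfl⟩, hσ _ ⟨0, sub_self _⟩⟩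
  obtain ⟨H⟩ := SimplyConnectedSpace.paths_homotopic γ (Path.refl y₀)
  refine ⟨_, IsMult.refl y₀, ⟨⟨⟨H.toContinuousMap.comp ((ContinuousMap.id I).prodMap s), fun x => ?_,
    fun x => ?_⟩, fun t x hx => ?_⟩⟩⟩
  · exact (H.apply_zero (s x)).trans (congrArg σ (hs x))
  · exact H.apply_one (s x)
  · refine Eq.trans ?_ (hσ x hx).symm
    obtain ⟨i, hi⟩ := hx
    have hx : ∑ i, x i = 1 := x.2.2
    rw [Fin.sum_univ_two] at hx
    change H (t, s x) = y₀
    fin_cases i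
    · have : s x = 1 := Subtype.ext (by
        change x 1 = 1
        change x 0 = 0 at hi
        linarith)
      rw [this]
      exact H.target t
    · have : s x = 0 := Subtype.ext hi
      rw [this]
      exact H.source t

lemma kills_of_acyc [SimplyConnectedSpace Y] (hM : HasMult y₀) {m : ℕ}
    (hA : ∀ n, n ≤ m → Acyc ℚ Y n) : ∀ n, 1 ≤ n → n ≤ m → Kills y₀ n := by
  intro n
  induction n using Nat.strong_induction_on with
  | _ n ih =>
    intro h1 h2
    rcases lt_or_ge 2 n with h | h
    · obtain ⟨k, rfl⟩ : ∃ k, n = k + 1 := ⟨n - 1, by omega⟩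
      have : Nontrivial (Fin k) := Fin.nontrivial_iff_two_le.2 (by omega)
      exact Kills.succ hM (fun n hn hn' => ih n (by omega) hn (by omega)) (hA _ h2)
    · interval_cases n
      · exact kills_one
      · exact kills_two

/-- A rational Hurewicz theorem: the homology is detected by a spherical simplex. -/
theorem exists_spherical [SimplyConnectedSpace Y] (hM : HasMult y₀) {m : ℕ}
    (hA : ∀ n, n ≤ m → Acyc ℚ Y n) (hL : HomLine ℚ Y (m + 1)) :
    ∃ τ : C(Splx (m + 1), Y), Spherical y₀ τ ∧
      of ℚ (S := Sing Y) τ - of ℚ (S := Sing Y) (ContinuousMap.const _ y₀) ∉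
        bdry ℚ (Sing Y) (m + 1) := by
  obtain ⟨z, hz, hzn, -⟩ := hL
  obtain ⟨N, hN, c, hc⟩ := exists_smul_eq_toRat z
  have hcz : c ∈ cyc ℤ (Sing Y) (m + 1) := by
    rw [← toRat_mem_cyc, ← hc]
    exact Submodule.smul_mem _ _ hz
  obtain ⟨g, E, ⟨hg0, M, hM1, hgM⟩, hE, hsph, -⟩ := exists_deforms_of_finite m
    (kills_of_acyc hM hA) (N := m + 1) (T := (c.support : Set ((Sing Y).obj (m + 1))))
    c.support.finite_toSet
  -- Suppose all spherical simplices are rationally trivial. Then so is the deformed cycle `E c`, up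
  -- to a multiple of the constant simplex. But `E c` is homologous to `M • c`, and `c` is a nonzero
  -- multiple of `z`, which does not bound.
  by_contra! hcon
  have h1 : toRat _ _ (E.map ℤ (m + 1) c - (M : ℤ) • c) ∈ bdry ℚ (Sing Y) (m + 1) := by
    have := Submodule.add_mem _ (hE.sub_mem ℤ _ c hcz) (hgM _ c hcz)
    rw [sub_add_sub_cancel] at this
    exact toRat_mem_bdry this
  have h2 : ∀ b : (Sing Y).Chain ℤ (m + 1), (∀ σ ∈ b.support, σ ∈ c.support) → ∃ a : ℚ,
      toRat _ _ (E.map ℤ (m + 1) b) - a • of ℚ (S := Sing Y) (ContinuousMap.const _ y₀) ∈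
        bdry ℚ (Sing Y) (m + 1) := by
    intro b hb
    rw [toRat_map]
    have hb' : b ∈ Finsupp.supported ℤ ℤ (c.support : Set ((Sing Y).obj (m + 1))) :=
      (Finsupp.mem_supported _ _).2 hb
    let P : Submodule ℚ ((Sing Y).Chain ℚ (m + 1)) := bdry ℚ (Sing Y) (m + 1) ⊔
      Submodule.span ℚ {of ℚ (S := Sing Y) (ContinuousMap.const (Splx (m + 1)) y₀)}
    have hP : E.map ℚ (m + 1) (toRat _ _ b) ∈ P := by
      refine map_mem_of_supported (((E.map ℚ (m + 1)).restrictScalars ℤ).comp (toRat _ _))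
        (P.restrictScalars ℤ) (fun σ hσ => ?_) hb'
      change E.map ℚ (m + 1) (toRat _ _ (of ℤ σ)) ∈ P
      rw [toRat_of, Hom.map_of, ← sub_add_cancel (of ℚ (E.app σ))
        (of ℚ (S := Sing Y) (ContinuousMap.const (Splx (m + 1)) y₀))]
      exact Submodule.add_mem_sup (hcon _ (hsph rfl σ hσ))
        (Submodule.mem_span_singleton_self _)
    obtain ⟨u, hu, v, hv, huv⟩ := Submodule.mem_sup.1 hP
    obtain ⟨a, rfl⟩ := Submodule.mem_span_singleton.1 hv
    exact ⟨a, by rwa [← huv, add_sub_cancel_right]⟩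
  obtain ⟨a, ha⟩ := h2 c fun σ hσ => hσ
  -- The leftover multiple of the constant simplex is a cycle fixed by the constant self-map, hence
  -- a boundary.
  have h3 : a • of ℚ (S := Sing Y) (ContinuousMap.const (Splx (m + 1)) y₀) ∈
      bdry ℚ (Sing Y) (m + 1) := by
    have hcyc : a • of ℚ (S := Sing Y) (ContinuousMap.const (Splx (m + 1)) y₀) ∈
        cyc ℚ (Sing Y) (m + 1) := by
      have e := Submodule.sub_mem _ (toRat_mem_cyc.2 (map_mem_cyc E hcz)) (bdry_le_cyc ha)
      rwa [sub_sub_cancel] at e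
    have := map_const_mem_bdry (X := Y) y₀ hcyc
    rwa [map_smul, Hom.map_of] at this
  have h4 := Submodule.sub_mem _ (Submodule.add_mem _ ha h3) h1
  rw [sub_add_cancel, map_sub, sub_sub_cancel, map_smul, ← hc, natCast_zsmul,
    ← Nat.cast_smul_eq_nsmul ℚ, smul_smul] at h4
  refine hzn ((Submodule.smul_mem_iff _ ?_).1 h4)
  have : (M : ℚ) ≠ 0 := by exact_mod_cast (by omega : M ≠ 0)
  have : (N : ℚ) ≠ 0 := by exact_mod_cast (by omega : N ≠ 0)
  positivity

end

end

section

/-! ### A union of two simply connected open sets -/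

section
variable {Y : Type} [TopologicalSpace Y]

lemma path_homotopic_of_range_subset {U : Set Y} [SimplyConnectedSpace U] {a b : Y}
    {p q : Path a b} (hp : Set.range p ⊆ U) (hq : Set.range q ⊆ U) : p.Homotopic q := by
  have ha : a ∈ U := hp ⟨0, p.source⟩
  have hb : b ∈ U := hp ⟨1, p.target⟩
  have key : ∀ r : Path a b, Set.range r ⊆ U →
      ∃ r' : Path (⟨a, ha⟩ : U) ⟨b, hb⟩, r'.map continuous_subtype_val = r := fun r hr =>
    ⟨{ toFun := fun t => ⟨r t, hr ⟨t, rfl⟩⟩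
       continuous_toFun := by fun_prop
       source' := Subtype.ext r.source
       target' := Subtype.ext r.target }, by ext; rfl⟩
  obtain ⟨p', rfl⟩ := key p hp
  obtain ⟨q', rfl⟩ := key q hq
  exact (SimplyConnectedSpace.paths_homotopic p' q').map ⟨_, continuous_subtype_val⟩

/-- The simply connected case of van Kampen's theorem. -/
theorem simplyConnectedSpace_of_cover {U V : Set Y} (hU : IsOpen U) (hV : IsOpen V)
    (hUV : U ∪ V = Set.univ) [SimplyConnectedSpace U] [SimplyConnectedSpace V]
    (hI : IsPathConnected (U ∩ V)) : SimplyConnectedSpace Y := by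
  obtain ⟨o, ho, hoI⟩ := hI
  -- Reference paths from `o` to every point, inside `U` or `V` whenever the end point is. For end
  -- points in both sets this uses path connectedness of the intersection.
  have hc : ∀ y : Y, ∃ c : Path o y, (y ∈ U → Set.range c ⊆ U) ∧ (y ∈ V → Set.range c ⊆ V) := by
    have aux : ∀ (W : Set Y) [SimplyConnectedSpace W], o ∈ W → ∀ y ∈ W, ∃ c : Path o y,
        Set.range c ⊆ W := fun W _ hoW y hy => by
      let p := (PathConnectedSpace.somePath (⟨o, hoW⟩ : W) ⟨y, hy⟩).map continuous_subtype_val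
      refine ⟨p, ?_⟩
      rintro - ⟨t, rfl⟩
      exact Subtype.prop (PathConnectedSpace.somePath (⟨o, hoW⟩ : W) ⟨y, hy⟩ t)
    intro y
    by_cases hyU : y ∈ U
    · by_cases hyV : y ∈ V
      · obtain ⟨c, hc⟩ := hoI ⟨hyU, hyV⟩
        exact ⟨c, fun _ => by rintro - ⟨t, rfl⟩; exact (hc t).1,
          fun _ => by rintro - ⟨t, rfl⟩; exact (hc t).2⟩
      · obtain ⟨c, hc⟩ := aux U ho.1 y hyU
        exact ⟨c, fun _ => hc, fun h => (hyV h).elim⟩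
    · have hyV : y ∈ V := ((hUV ▸ Set.mem_univ y : y ∈ U ∪ V)).resolve_left hyU
      obtain ⟨c, hc⟩ := aux V ho.2 y hyV
      exact ⟨c, fun h => (hyU h).elim, fun _ => hc⟩
  choose c hcU hcV using hc
  have local_eq : ∀ {a b : Y} (p : Path a b), (Set.range p ⊆ U ∨ Set.range p ⊆ V) →
      ((c a).trans p).Homotopic (c b) := by
    intro a b p hp
    rcases hp with hp | hp
    · have ha : a ∈ U := hp ⟨0, p.source⟩
      have hb : b ∈ U := hp ⟨1, p.target⟩
      exact path_homotopic_of_range_subset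
        (by rw [Path.trans_range]; exact Set.union_subset (hcU a ha) hp) (hcU b hb)
    · have ha : a ∈ V := hp ⟨0, p.source⟩
      have hb : b ∈ V := hp ⟨1, p.target⟩
      exact path_homotopic_of_range_subset
        (by rw [Path.trans_range]; exact Set.union_subset (hcV a ha) hp) (hcV b hb)
  -- Cut `γ` into pieces lying in `U` or in `V` and absorb them into the reference path one at a
  -- time by `local_eq`. Consequently the class of a path depends on its end points only.
  have main : ∀ {a b : Y} (γ : Path a b), ((c a).trans γ).Homotopic (c b) := by
    intro a b γ
    obtain ⟨t, ht0, htm, ⟨N, htN⟩, ht⟩ := exists_monotone_Icc_subset_open_cover_unitInterval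
      (c := fun i : Bool => γ ⁻¹' (if i then U else V))
      (fun i => by cases i <;> exact IsOpen.preimage γ.continuous (by assumption))
      (fun s _ => by
        rcases (hUV ▸ Set.mem_univ (γ s) : γ s ∈ U ∪ V) with h | h
        · exact Set.mem_iUnion.2 ⟨true, h⟩
        · exact Set.mem_iUnion.2 ⟨false, h⟩)
    have hstep : ∀ n, ((c (γ 0)).trans (γ.subpath 0 (t n))).Homotopic (c (γ (t n))) := by
      intro n
      induction n with
      | zero =>
        rw [ht0, Path.subpath_self]
        exact ⟨Path.Homotopy.transRefl _⟩
      | succ n ih =>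
        have h1 : (γ.subpath 0 (t (n + 1))).Homotopic
            ((γ.subpath 0 (t n)).trans (γ.subpath (t n) (t (n + 1)))) :=
          ⟨(Path.Homotopy.subpathTransSubpath γ 0 (t n) (t (n + 1))).symm⟩
        refine ((Path.Homotopic.refl _).hcomp h1).trans ?_
        refine Path.Homotopic.trans ⟨(Path.Homotopy.transAssoc _ _ _).symm⟩ ?_
        refine (ih.hcomp (Path.Homotopic.refl _)).trans (local_eq _ ?_)
        rw [Path.range_subpath_of_le _ _ _ (htm n.le_succ)]
        obtain ⟨i, hi⟩ := ht n
        cases i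
        · exact Or.inr (Set.image_subset_iff.2 hi)
        · exact Or.inl (Set.image_subset_iff.2 hi)
    have h := hstep N
    rw [htN N le_rfl] at h
    have h' : ∀ {a' b' : Y} (ha : a = a') (hb : b = b') (p : Path a' b'),
        ((c a').trans p).Homotopic (c b') → ((c a).trans (p.cast ha hb)).Homotopic (c b) := by
      rintro a' b' rfl rfl p hp
      exact hp
    have := h' γ.source.symm γ.target.symm _ h
    rw [Path.subpath_zero_one] at this
    exact this
  refine simply_connected_iff_paths_homotopic'.2 ⟨⟨⟨o⟩, fun x y => ⟨(c x).symm.trans (c y)⟩⟩, ?_⟩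
  intro a b p q
  have h := (main p).trans (main q).symm
  have h2 := (Path.Homotopic.refl (c a).symm).hcomp h
  have cancel : ∀ r : Path a b, ((c a).symm.trans ((c a).trans r)).Homotopic r := fun r =>
    (Path.Homotopic.trans ⟨(Path.Homotopy.transAssoc _ _ _).symm⟩
      ((Path.Homotopic.hcomp ⟨(Path.Homotopy.reflSymmTrans (c a)).symm⟩
        (Path.Homotopic.refl r)).trans ⟨Path.Homotopy.reflTrans r⟩))
  exact (cancel p).symm.trans (h2.trans (cancel q))

end

end

section

/-! ### Suspensions -/

section
variable {L Y Z T : Type} [TopologicalSpace L] [TopologicalSpace Y] [TopologicalSpace Z]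
  [TopologicalSpace T]

/-- The map `θ : L × [0, 1] ⟶ Y` exhibits `Y` as the unreduced suspension of `L`. -/
structure IsSusp (θ : C(L × I, Y)) : Prop where
  surjective : Function.Surjective θ
  eq_iff : ∀ p q, θ p = θ q ↔ p = q ∨ (p.2 = 0 ∧ q.2 = 0) ∨ (p.2 = 1 ∧ q.2 = 1)

namespace IsSusp
variable {θ : C(L × I, Y)}

lemma flip (h : IsSusp θ) :
    IsSusp (θ.comp ⟨fun p : L × I => (p.1, unitInterval.symm p.2), by fun_prop⟩) where
  surjective y := by
    obtain ⟨p, rfl⟩ := h.surjective y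
    exact ⟨(p.1, unitInterval.symm p.2), by simp⟩
  eq_iff p q := by
    simp only [ContinuousMap.comp_apply, ContinuousMap.coe_mk, h.eq_iff, Prod.ext_iff,
      unitInterval.symm_inj, unitInterval.symm_eq_zero, unitInterval.symm_eq_one]
    tauto

/-- By compactness `id × θ` is closed, hence a quotient map, and it remains one over an open set.
The parameter space `T` makes it possible to construct homotopies as well: `T` is a point for maps
and the interval for homotopies. -/
lemma exists_lift (h : IsSusp θ) [CompactSpace L] [T2Space Y] [CompactSpace T] [T2Space T]
    {U : Set Y} (hU : IsOpen U) (f : C({q : T × (L × I) // θ q.2 ∈ U}, Z))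
    (hf : ∀ q q', q.1.1 = q'.1.1 → θ q.1.2 = θ q'.1.2 → f q = f q') :
    ∃ F : C(T × U, Z), ∀ q : {q : T × (L × I) // θ q.2 ∈ U},
      F (q.1.1, ⟨θ q.1.2, q.2⟩) = f q := by
  let Θ : C(T × (L × I), T × Y) := (ContinuousMap.id T).prodMap θ
  have hQ : IsQuotientMap Θ := Θ.continuous.isClosedMap.isQuotientMap Θ.continuous
    (Function.surjective_id.prodMap h.surjective)
  have hQU := hQ.restrictPreimage_isOpen (hU.preimage (continuous_snd (X := T)))
  let pre : C(Θ ⁻¹' (Prod.snd ⁻¹' U), (Prod.snd ⁻¹' U : Set (T × Y))) := ⟨_, hQU.continuous⟩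
  have hpre : IsQuotientMap pre := hQU
  let f' : C(Θ ⁻¹' (Prod.snd ⁻¹' U), Z) := f
  have hfac : Function.FactorsThrough f' pre := fun q q' hqq => by
    have : Θ q.1 = Θ q'.1 := congrArg Subtype.val hqq
    exact hf q q' (Prod.ext_iff.1 this).1 (Prod.ext_iff.1 this).2
  let F' := hpre.lift f' hfac
  refine ⟨F'.comp ⟨fun x => ⟨(x.1, x.2.1), x.2.2⟩, by fun_prop⟩, fun q => ?_⟩
  exact DFunLike.congr_fun (hpre.lift_comp f' hfac) q

lemma exists_lift_univ (h : IsSusp θ) [CompactSpace L] [T2Space Y] (f : C(L × I, Z))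
    (h0 : ∀ l l', f (l, 0) = f (l', 0)) (h1 : ∀ l l', f (l, 1) = f (l', 1)) :
    ∃ F : C(Y, Z), ∀ p, F (θ p) = f p := by
  obtain ⟨F, hF⟩ := h.exists_lift (T := PUnit) isOpen_univ
    (f.comp ⟨fun q => q.1.2, by fun_prop⟩) (by
      rintro ⟨⟨t, l, s⟩, hq⟩ ⟨⟨t', l', s'⟩, hq'⟩ - he
      rcases (h.eq_iff _ _).1 he with he | ⟨he, he'⟩ | ⟨he, he'⟩
      · exact congrArg f he
      · dsimp only at he he'; subst he he'; exact h0 _ _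
      · dsimp only at he he'; subst he he'; exact h1 _ _)
  exact ⟨F.comp ⟨fun y => (PUnit.unit, ⟨y, trivial⟩), by fun_prop⟩,
    fun p => hF ⟨(PUnit.unit, p), trivial⟩⟩

lemma homotopic (h : IsSusp θ) [CompactSpace L] [T2Space Y] {f g : C(Y, Z)}
    (H : C(I × (L × I), Z)) (h0 : ∀ t l l', H (t, l, 0) = H (t, l', 0))
    (h1 : ∀ t l l', H (t, l, 1) = H (t, l', 1)) (hf : ∀ p, H (0, p) = f (θ p))
    (hg : ∀ p, H (1, p) = g (θ p)) : f.Homotopic g := by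
  obtain ⟨F, hF⟩ := h.exists_lift (T := I) isOpen_univ
    (H.comp ⟨fun q => q.1, by fun_prop⟩) (by
      rintro ⟨⟨t, l, s⟩, hq⟩ ⟨⟨t', l', s'⟩, hq'⟩ ht he
      dsimp only at ht; subst ht
      rcases (h.eq_iff _ _).1 he with he | ⟨he, he'⟩ | ⟨he, he'⟩
      · dsimp only at he; rw [Prod.ext_iff] at he; dsimp only at he
        obtain ⟨rfl, rfl⟩ := he; rfl
      · dsimp only at he he'; subst he he'; exact h0 _ _ _
      · dsimp only at he he'; subst he he'; exact h1 _ _ _)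
  refine ⟨⟨F.comp ⟨fun y => (y.1, ⟨y.2, trivial⟩), by fun_prop⟩, fun y => ?_, fun y => ?_⟩⟩
  · obtain ⟨p, rfl⟩ := h.surjective y
    exact (hF ⟨(0, p), trivial⟩).trans (hf p)
  · obtain ⟨p, rfl⟩ := h.surjective y
    exact (hF ⟨(1, p), trivial⟩).trans (hg p)

lemma apply_zero (h : IsSusp θ) (l l' : L) : θ (l, 0) = θ (l', 0) :=
  (h.eq_iff _ _).2 (Or.inr (Or.inl ⟨rfl, rfl⟩))

lemma apply_one (h : IsSusp θ) (l l' : L) : θ (l, 1) = θ (l', 1) :=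
  (h.eq_iff _ _).2 (Or.inr (Or.inr ⟨rfl, rfl⟩))

lemma eq_apply_zero_iff (h : IsSusp θ) (l : L) (p : L × I) : θ p = θ (l, 0) ↔ p.2 = 0 := by
  rw [h.eq_iff]
  refine ⟨?_, fun hp => Or.inr (Or.inl ⟨hp, rfl⟩)⟩
  rintro (rfl | ⟨hp, -⟩ | ⟨-, hp⟩)
  · rfl
  · exact hp
  · exact absurd hp zero_ne_one

lemma eq_apply_one_iff (h : IsSusp θ) (l : L) (p : L × I) : θ p = θ (l, 1) ↔ p.2 = 1 := by
  rw [h.eq_iff]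
  refine ⟨?_, fun hp => Or.inr (Or.inr ⟨hp, rfl⟩)⟩
  rintro (rfl | ⟨-, hp⟩ | ⟨hp, -⟩)
  · rfl
  · exact absurd hp one_ne_zero
  · exact hp

lemma mem_inter (h : IsSusp θ) (l₀ : L) (p : L × I) :
    θ p ∈ ({θ (l₀, 1)}ᶜ ∩ {θ (l₀, 0)}ᶜ : Set Y) ↔ p.2 ≠ 1 ∧ p.2 ≠ 0 := by
  rw [Set.mem_inter_iff, Set.mem_compl_singleton_iff, Set.mem_compl_singleton_iff, Ne, Ne,
    h.eq_apply_zero_iff, h.eq_apply_one_iff]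

lemma union_eq_univ (h : IsSusp θ) (l₀ : L) :
    ({θ (l₀, 1)}ᶜ ∪ {θ (l₀, 0)}ᶜ : Set Y) = Set.univ := by
  refine Set.eq_univ_of_forall fun y => ?_
  by_contra hy
  simp only [Set.mem_union, Set.mem_compl_singleton_iff, not_or, not_not] at hy
  have := hy.1.symm.trans hy.2
  rw [h.eq_apply_zero_iff] at this
  exact one_ne_zero this

/-- Pushing the height `s` towards `1 / 2`. -/
def midpoint : C(I × I, I) :=
  ⟨fun p => Set.projIcc (0 : ℝ) 1 zero_le_one ((1 - p.1) * p.2 + p.1 / 2),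
    continuous_projIcc.comp (by fun_prop)⟩

lemma coe_midpoint (t s : I) : (midpoint (t, s) : ℝ) = (1 - t) * s + t / 2 := by
  have := t.2.1; have := t.2.2; have := s.2.1; have := s.2.2
  change (Set.projIcc (0 : ℝ) 1 zero_le_one _ : ℝ) = _
  rw [Set.projIcc_of_mem zero_le_one]
  constructor <;> nlinarith

variable [CompactSpace L] [T2Space Y]

/-- Multiplying the height by `1 - t` shrinks everything below the upper pole to the lower pole. -/
lemma contractible_compl_one (h : IsSusp θ) (l₀ : L) :
    ContractibleSpace ({θ (l₀, 1)}ᶜ : Set Y) := by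
  obtain ⟨F, hF⟩ := h.exists_lift (T := I) (U := {θ (l₀, 1)}ᶜ) (Z := ({θ (l₀, 1)}ᶜ : Set Y))
    isOpen_compl_singleton
    ⟨fun q => ⟨θ (q.1.2.1, unitInterval.symm q.1.1 * q.1.2.2), by
      obtain ⟨⟨t, l, s⟩, hq⟩ := q
      rw [Set.mem_compl_singleton_iff, Ne, h.eq_apply_one_iff] at hq ⊢
      dsimp only at hq ⊢
      intro he
      exact hq (le_antisymm unitInterval.le_one' (he ▸ unitInterval.mul_le_right))⟩,
      by fun_prop⟩ (by
      rintro ⟨⟨t, l, s⟩, hq⟩ ⟨⟨t', l', s'⟩, hq'⟩ ht he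
      dsimp only at ht; subst ht
      refine Subtype.ext ((h.eq_iff _ _).2 ?_)
      rcases (h.eq_iff _ _).1 he with he | ⟨he, he'⟩ | ⟨he, he'⟩
      · dsimp only at he; rw [Prod.ext_iff] at he; dsimp only at he
        obtain ⟨rfl, rfl⟩ := he; exact Or.inl rfl
      · dsimp only at he he'; subst he he'; simp
      · exact absurd ((h.eq_apply_one_iff l₀ _).2 he) hq)
  refine (contractible_iff_id_nullhomotopic _).2 ⟨⟨θ (l₀, 0), ?_⟩, ⟨⟨F, ?_, ?_⟩⟩⟩
  · rw [Set.mem_compl_singleton_iff, Ne, h.eq_apply_one_iff]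
    exact zero_ne_one
  · rintro ⟨y, hy⟩
    obtain ⟨p, rfl⟩ := h.surjective y
    refine (hF ⟨(0, p), hy⟩).trans (Subtype.ext ?_)
    simp
  · rintro ⟨y, hy⟩
    obtain ⟨p, rfl⟩ := h.surjective y
    refine (hF ⟨(1, p), hy⟩).trans (Subtype.ext ?_)
    simpa using h.apply_zero _ _

lemma contractible_compl_zero (h : IsSusp θ) (l₀ : L) :
    ContractibleSpace ({θ (l₀, 0)}ᶜ : Set Y) := by
  have e : ({θ (l₀, 0)}ᶜ : Set Y) = {θ (l₀, unitInterval.symm 1)}ᶜ := by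
    rw [unitInterval.symm_one]
  rw [e]
  exact h.flip.contractible_compl_one l₀

/-- Away from both poles the height can be pushed to `1 / 2`, which leaves a copy of `L`. -/
lemma exists_equiv_inter (h : IsSusp θ) (l₀ : L) :
    ∃ (i : C(L, ({θ (l₀, 1)}ᶜ ∩ {θ (l₀, 0)}ᶜ : Set Y)))
      (r : C(({θ (l₀, 1)}ᶜ ∩ {θ (l₀, 0)}ᶜ : Set Y), L)),
      (r.comp i).Homotopic (ContinuousMap.id L) ∧ (i.comp r).Homotopic (ContinuousMap.id _) := by
  have hopen : IsOpen ({θ (l₀, 1)}ᶜ ∩ {θ (l₀, 0)}ᶜ : Set Y) :=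
    isOpen_compl_singleton.inter isOpen_compl_singleton
  obtain ⟨r, hr⟩ := h.exists_lift (T := PUnit) hopen ⟨fun q => q.1.2.1, by fun_prop⟩ (by
    rintro ⟨⟨t, l, s⟩, hq⟩ ⟨⟨t', l', s'⟩, hq'⟩ - he
    rw [h.mem_inter] at hq
    rcases (h.eq_iff _ _).1 he with he | ⟨he, he'⟩ | ⟨he, he'⟩
    · exact congrArg Prod.fst he
    · exact absurd he hq.2
    · exact absurd he hq.1)
  have hmid : ∀ (t s : I), s ≠ 1 ∧ s ≠ 0 → midpoint (t, s) ≠ 1 ∧ midpoint (t, s) ≠ 0 := by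
    intro t s hs
    have h0 : (0 : ℝ) < s := lt_of_le_of_ne s.2.1 fun e => hs.2 (Subtype.ext e.symm)
    have h1 : (s : ℝ) < 1 := lt_of_le_of_ne s.2.2 fun e => hs.1 (Subtype.ext e)
    have := t.2.1; have := t.2.2
    constructor
    · intro e
      have := congrArg Subtype.val e
      rw [coe_midpoint] at this
      change _ = (1 : ℝ) at this
      nlinarith
    · intro e
      have := congrArg Subtype.val e
      rw [coe_midpoint] at this
      change _ = (0 : ℝ) at this
      nlinarith
  let half : I := midpoint (1, 1)
  have hhalf : half ≠ 1 ∧ half ≠ 0 := by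
    have e : (half : ℝ) = 1 / 2 := by rw [coe_midpoint]; norm_num
    constructor <;> intro e' <;> rw [e'] at e <;> norm_num at e
  have hhalf' : ∀ s, midpoint (1, s) = half := fun s => Subtype.ext <| by
    simp [half, coe_midpoint]
  let i : C(L, ({θ (l₀, 1)}ᶜ ∩ {θ (l₀, 0)}ᶜ : Set Y)) :=
    ⟨fun l => ⟨θ (l, half), (h.mem_inter _ _).2 hhalf⟩, by fun_prop⟩
  obtain ⟨F, hF⟩ := h.exists_lift (T := I) hopen
    (Z := ({θ (l₀, 1)}ᶜ ∩ {θ (l₀, 0)}ᶜ : Set Y))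
    ⟨fun q => ⟨θ (q.1.2.1, midpoint (q.1.1, q.1.2.2)),
      (h.mem_inter _ _).2 (hmid _ _ ((h.mem_inter _ _).1 q.2))⟩, by fun_prop⟩ (by
      rintro ⟨⟨t, l, s⟩, hq⟩ ⟨⟨t', l', s'⟩, hq'⟩ ht he
      dsimp only at ht; subst ht
      rw [h.mem_inter] at hq
      rcases (h.eq_iff _ _).1 he with he | ⟨he, he'⟩ | ⟨he, he'⟩
      · dsimp only at he; rw [Prod.ext_iff] at he; dsimp only at he
        obtain ⟨rfl, rfl⟩ := he; rfl
      · exact absurd he hq.2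
      · exact absurd he hq.1)
  let r' : C(({θ (l₀, 1)}ᶜ ∩ {θ (l₀, 0)}ᶜ : Set Y), L) :=
    r.comp ⟨fun y => (PUnit.unit, y), by fun_prop⟩
  have hr' : ∀ p hp, r' ⟨θ p, hp⟩ = p.1 := fun p hp => hr ⟨(PUnit.unit, p), hp⟩
  refine ⟨i, r', ?_, ContinuousMap.Homotopic.symm ⟨⟨F, ?_, ?_⟩⟩⟩
  · have : r'.comp i = ContinuousMap.id L := ContinuousMap.ext fun l => hr' _ _
    rw [this]
  · rintro ⟨y, hy⟩
    obtain ⟨p, rfl⟩ := h.surjective y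
    refine (hF ⟨(0, p), hy⟩).trans (Subtype.ext ?_)
    have : midpoint (0, p.2) = p.2 := Subtype.ext (by rw [coe_midpoint]; simp)
    simp [this]
  · rintro ⟨y, hy⟩
    obtain ⟨p, rfl⟩ := h.surjective y
    refine (hF ⟨(1, p), hy⟩).trans (Subtype.ext ?_)
    change θ (p.1, midpoint (1, p.2)) = θ (r' _, half)
    rw [hr', hhalf']

variable {R : Type} [CommRing R]

lemma acyc (h : IsSusp θ) [Nonempty L] {n : ℕ} (hL : Acyc R L n) : Acyc R Y (n + 1) := by
  let l₀ := Classical.arbitrary L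
  have := h.contractible_compl_zero l₀
  have := h.contractible_compl_one l₀
  obtain ⟨i, r, -, hir⟩ := h.exists_equiv_inter l₀
  exact acyc_of_cover isOpen_compl_singleton isOpen_compl_singleton (h.union_eq_univ l₀)
    (fun n => Acyc.of_contractible n) (fun n => Acyc.of_contractible n) (Acyc.of_retract hir hL)

lemma homLine (h : IsSusp θ) [Nonempty L] {n : ℕ} (hL : HomLine R L n) : HomLine R Y (n + 1) := by
  let l₀ := Classical.arbitrary L
  have := h.contractible_compl_zero l₀
  have := h.contractible_compl_one l₀
  obtain ⟨i, r, hri, hir⟩ := h.exists_equiv_inter l₀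
  exact homLine_of_cover isOpen_compl_singleton isOpen_compl_singleton (h.union_eq_univ l₀)
    (fun n => Acyc.of_contractible n) (fun n => Acyc.of_contractible n)
    (HomLine.of_equiv hir hri hL)

/-- The suspension of a path connected space is simply connected. -/
theorem simplyConnectedSpace (h : IsSusp θ) [PathConnectedSpace L] : SimplyConnectedSpace Y := by
  let l₀ := Classical.arbitrary L
  have := h.contractible_compl_zero l₀
  have := h.contractible_compl_one l₀
  refine simplyConnectedSpace_of_cover isOpen_compl_singleton isOpen_compl_singleton
    (h.union_eq_univ l₀) ?_
  have : PathConnectedSpace (Set.Ioo (0 : ℝ) 1) :=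
    isPathConnected_iff_pathConnectedSpace.1
      ((convex_Ioo 0 1).isPathConnected (Set.nonempty_Ioo.2 one_pos))
  let e : L × Set.Ioo (0 : ℝ) 1 → Y := fun p => θ (p.1, ⟨p.2.1, p.2.2.1.le, p.2.2.2.le⟩)
  have he : Continuous e := by fun_prop
  convert isPathConnected_range he
  ext y
  obtain ⟨⟨l, s⟩, rfl⟩ := h.surjective y
  rw [h.mem_inter]
  constructor
  · intro hs
    exact ⟨(l, ⟨s, lt_of_le_of_ne s.2.1 fun e => hs.2 (Subtype.ext e.symm),
      lt_of_le_of_ne s.2.2 fun e => hs.1 (Subtype.ext e)⟩), rfl⟩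
  · rintro ⟨⟨l', s', hs0, hs1⟩, hp⟩
    rw [← h.mem_inter l₀, ← hp, h.mem_inter]
    exact ⟨fun e => hs1.ne (congrArg Subtype.val e), fun e => hs0.ne' (congrArg Subtype.val e)⟩

end IsSusp
end

end

section

/-! ### Multiplication on suspensions -/

section
variable {R : Type} [CommRing R] {Y Z : Type} [TopologicalSpace Y] [TopologicalSpace Z]

/-- On simplices in `U` or in `V` the operator `f - f₁ - f₂ + const` is zero on the nose. A cycle is
homologous to a sum of chains in `U` and in `V`, and the constant map sends cycles to boundaries. -/
lemma map_sub_sub_mem_bdry_of_cover {U V : Set Y} (hU : IsOpen U) (hV : IsOpen V)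
    (hUV : U ∪ V = Set.univ) (f f₁ f₂ : C(Y, Z)) (z₀ : Z) (h₁ : ∀ y ∈ U, f y = f₁ y)
    (h₂ : ∀ y ∈ U, f₂ y = z₀) (h₃ : ∀ y ∈ V, f y = f₂ y) (h₄ : ∀ y ∈ V, f₁ y = z₀) {n : ℕ}
    {c : (Sing Y).Chain R n} (hc : c ∈ cyc R (Sing Y) n) :
    (push f).map R n c - (push f₁).map R n c - (push f₂).map R n c ∈ bdry R (Sing Z) n := by
  let k : C(Y, Z) := ContinuousMap.const Y z₀
  let T : (Sing Y).Chain R n →ₗ[R] (Sing Z).Chain R n :=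
    (push f).map R n - (push f₁).map R n - (push f₂).map R n
  let T' := T + (push k).map R n
  have hTU : ∀ a ∈ supp R U n, T' a = 0 := fun a ha => by
    refine (Submodule.mem_bot R).1 (mem_of_supp T' ⊥ (fun σ hσ => ?_) ha)
    have e₁ : f.comp σ = f₁.comp σ := ContinuousMap.ext fun x => h₁ _ (hσ x)
    have e₂ : f₂.comp σ = k.comp σ := ContinuousMap.ext fun x => h₂ _ (hσ x)
    simp only [T', T, LinearMap.add_apply, LinearMap.sub_apply, Hom.map_of, e₁, e₂]
    simp
  have hTV : ∀ a ∈ supp R V n, T' a = 0 := fun a ha => by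
    refine (Submodule.mem_bot R).1 (mem_of_supp T' ⊥ (fun σ hσ => ?_) ha)
    have e₁ : f.comp σ = f₂.comp σ := ContinuousMap.ext fun x => h₃ _ (hσ x)
    have e₂ : f₁.comp σ = k.comp σ := ContinuousMap.ext fun x => h₄ _ (hσ x)
    simp only [T', T, LinearMap.add_apply, LinearMap.sub_apply, Hom.map_of, e₁, e₂]
    simp
  obtain ⟨a, ha, b, hb, hab⟩ := exists_small_cycle hU hV hUV hc
  have h1 : T' (c - (a + b)) ∈ bdry R (Sing Z) n :=
    Submodule.add_mem _ (Submodule.sub_mem _ (Submodule.sub_mem _ (map_mem_bdry _ hab)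
      (map_mem_bdry _ hab)) (map_mem_bdry _ hab)) (map_mem_bdry _ hab)
  rw [map_sub, map_add, hTU a ha, hTV b hb, add_zero, sub_zero] at h1
  have h2 := Submodule.sub_mem _ h1 (map_const_mem_bdry z₀ hc)
  have h3 : T' c - (push k).map R n c = T c := by simp [T']
  rwa [h3] at h2

end

/-- The projection to the unit interval. -/
def clamp : C(ℝ, I) := ⟨Set.projIcc 0 1 zero_le_one, continuous_projIcc⟩

lemma clamp_of_le {x : ℝ} (h : x ≤ 0) : clamp x = 0 := Set.projIcc_of_le_left zero_le_one h

lemma clamp_of_ge {x : ℝ} (h : 1 ≤ x) : clamp x = 1 := Set.projIcc_of_right_le zero_le_one h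

lemma clamp_coe (s : I) : clamp s = s := Set.projIcc_val zero_le_one s

namespace IsSusp
variable {L Y Z : Type} [TopologicalSpace L] [TopologicalSpace Y] [TopologicalSpace Z]
  {θ : C(L × I, Y)} [CompactSpace L] [T2Space Y]

lemma exists_reparam (h : IsSusp θ) (φ : C(I, I)) (h0 : φ 0 = 0) (h1 : φ 1 = 1) :
    ∃ p : C(Y, Y), (∀ l s, p (θ (l, s)) = θ (l, φ s)) ∧ p.Homotopic (ContinuousMap.id Y) := by
  obtain ⟨p, hp⟩ := h.exists_lift_univ (θ.comp ((ContinuousMap.id L).prodMap φ))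
    (fun l l' => by simpa [h0] using h.apply_zero l l')
    (fun l l' => by simpa [h1] using h.apply_one l l')
  refine ⟨p, fun l s => hp (l, s), ContinuousMap.Homotopic.symm (h.homotopic
    ⟨fun q => θ (q.2.1, clamp ((1 - q.1) * q.2.2 + q.1 * φ q.2.2)), by fun_prop⟩ ?_ ?_ ?_ ?_)⟩
  · intro t l l'
    have : clamp ((1 - t) * (0 : I) + t * φ 0) = 0 := clamp_of_le (by simp [h0])
    simp only [ContinuousMap.coe_mk, this]
    exact h.apply_zero l l'
  · intro t l l'
    have : clamp ((1 - t) * (1 : I) + t * φ 1) = 1 := clamp_of_ge (by simp [h1])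
    simp only [ContinuousMap.coe_mk, this]
    exact h.apply_one l l'
  · rintro ⟨l, s⟩
    have : clamp ((1 - (0 : I)) * s + (0 : I) * φ s) = s := by simp [clamp_coe]
    simp only [ContinuousMap.coe_mk, this]
    rfl
  · rintro ⟨l, s⟩
    have : clamp ((1 - (1 : I)) * s + (1 : I) * φ s) = φ s := by simp [clamp_coe]
    simp only [ContinuousMap.coe_mk, this]
    exact (hp (l, s)).symm

lemma exists_height (h : IsSusp θ) : ∃ H : C(Y, ℝ), ∀ p, H (θ p) = p.2 :=
  h.exists_lift_univ ⟨fun p => (p.2 : ℝ), by fun_prop⟩ (fun _ _ => rfl) fun _ _ => rfl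

/-- `G` performs `f₁` on the lower third and `f₂` on the upper third, and is constant in between; so
it acts on reduced homology as their sum. The constant middle third is the overlap of the two open
sets to which the preceding additivity lemma applies. -/
lemma exists_pinch (h : IsSusp θ) (l₀ : L) (f₁ f₂ : C(Y, Z))
    (hf : f₁ (θ (l₀, 1)) = f₂ (θ (l₀, 0))) {R : Type} [CommRing R] :
    ∃ G : C(Y, Z), G (θ (l₀, 0)) = f₁ (θ (l₀, 0)) ∧ ∀ n, ∀ c ∈ cyc R (Sing Y) n,
      (push G).map R n c - (push f₁).map R n c - (push f₂).map R n c ∈ bdry R (Sing Z) n := by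
  let φ₁ : C(I, I) := clamp.comp ⟨fun s => 3 * (s : ℝ), by fun_prop⟩
  let φ₂ : C(I, I) := clamp.comp ⟨fun s => 3 * (s : ℝ) - 2, by fun_prop⟩
  have φ₁0 : φ₁ 0 = 0 := clamp_of_le (by simp)
  have φ₂1 : φ₂ 1 = 1 := clamp_of_ge (by norm_num)
  have φ₁1 : ∀ s : I, 1 / 3 ≤ (s : ℝ) → φ₁ s = 1 := fun s hs => clamp_of_ge (by
    simp only [ContinuousMap.coe_mk]; linarith)
  have φ₂0 : ∀ s : I, (s : ℝ) ≤ 2 / 3 → φ₂ s = 0 := fun s hs => clamp_of_le (by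
    simp only [ContinuousMap.coe_mk]; linarith)
  obtain ⟨p₁, hp₁, Hp₁⟩ := h.exists_reparam φ₁ φ₁0 (φ₁1 1 (by norm_num))
  obtain ⟨p₂, hp₂, Hp₂⟩ := h.exists_reparam φ₂ (φ₂0 0 (by norm_num)) φ₂1
  let g₁ := f₁.comp p₁
  let g₂ := f₂.comp p₂
  set c₀ := f₁ (θ (l₀, 1)) with hc₀
  have hg₁ : ∀ l (s : I), 1 / 3 ≤ (s : ℝ) → g₁ (θ (l, s)) = c₀ := fun l s hs => by
    simp only [g₁, ContinuousMap.comp_apply, hp₁, φ₁1 s hs, hc₀, h.apply_one l l₀]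
  have hg₂ : ∀ l (s : I), (s : ℝ) ≤ 2 / 3 → g₂ (θ (l, s)) = c₀ := fun l s hs => by
    simp only [g₂, ContinuousMap.comp_apply, hp₂, φ₂0 s hs, hf, h.apply_zero l l₀]
  let G' : C(L × I, Z) :=
    ⟨fun p => if (p.2 : ℝ) ≤ 1 / 2 then g₁ (θ p) else g₂ (θ p),
      Continuous.if_le (by fun_prop) (by fun_prop) (by fun_prop) (by fun_prop) fun p hp => by
        rw [hg₁ p.1 p.2 (by rw [hp]; norm_num), hg₂ p.1 p.2 (by rw [hp]; norm_num)]⟩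
  have hG'1 : ∀ l (s : I), (s : ℝ) < 2 / 3 → G' (l, s) = g₁ (θ (l, s)) := fun l s hs => by
    change (if (s : ℝ) ≤ 1 / 2 then _ else _) = _
    split_ifs with hs'
    · rfl
    · rw [hg₁ l s (by linarith), hg₂ l s hs.le]
  have hG'2 : ∀ l (s : I), 1 / 3 < (s : ℝ) → G' (l, s) = g₂ (θ (l, s)) := fun l s hs => by
    change (if (s : ℝ) ≤ 1 / 2 then _ else _) = _
    split_ifs with hs'
    · rw [hg₁ l s hs.le, hg₂ l s (by linarith)]
    · rfl
  obtain ⟨G, hG⟩ := h.exists_lift_univ G'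
    (fun l l' => by
      rw [hG'1 _ _ (by norm_num), hG'1 _ _ (by norm_num), h.apply_zero l l'])
    (fun l l' => by
      rw [hG'2 _ _ (by norm_num), hG'2 _ _ (by norm_num), h.apply_one l l'])
  obtain ⟨H, hH⟩ := h.exists_height
  refine ⟨G, ?_, fun n c hc => ?_⟩
  · rw [hG, hG'1 _ _ (by norm_num)]
    simp only [g₁, ContinuousMap.comp_apply, hp₁, φ₁0]
  have h1 := map_sub_sub_mem_bdry_of_cover (U := H ⁻¹' Set.Iio (2 / 3)) (V := H ⁻¹' Set.Ioi (1 / 3))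
    (isOpen_Iio.preimage H.continuous) (isOpen_Ioi.preimage H.continuous)
    (Set.eq_univ_of_forall fun y => by
      rcases lt_or_ge (H y) (2 / 3) with hy | hy
      · exact Or.inl hy
      · exact Or.inr (show 1 / 3 < H y by linarith)) G g₁ g₂ c₀
    (fun y hy => by
      obtain ⟨⟨l, s⟩, rfl⟩ := h.surjective y
      rw [Set.mem_preimage, hH] at hy
      rw [hG, hG'1 l s hy])
    (fun y hy => by
      obtain ⟨⟨l, s⟩, rfl⟩ := h.surjective y
      rw [Set.mem_preimage, hH] at hy
      exact hg₂ l s (le_of_lt hy))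
    (fun y hy => by
      obtain ⟨⟨l, s⟩, rfl⟩ := h.surjective y
      rw [Set.mem_preimage, hH] at hy
      rw [hG, hG'2 l s hy])
    (fun y hy => by
      obtain ⟨⟨l, s⟩, rfl⟩ := h.surjective y
      rw [Set.mem_preimage, hH] at hy
      exact hg₁ l s (le_of_lt hy)) hc
  have hom : ∀ (f : C(Y, Z)) (p : C(Y, Y)), p.Homotopic (ContinuousMap.id Y) →
      (push (f.comp p)).map R n c - (push f).map R n c ∈ bdry R (Sing Z) n := fun f p hp =>
    map_sub_map_mem_bdry (g := f) ((ContinuousMap.Homotopic.refl f).comp hp) hc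
  have := Submodule.add_mem _ (Submodule.add_mem _ h1 (hom f₁ p₁ Hp₁)) (hom f₂ p₂ Hp₂)
  convert this using 1
  simp only [g₁, g₂]
  abel

/-- For a pinch the first map must send the upper pole to the value of the second map at the lower
pole. Therefore the identity is replaced by a homotopic map which climbs each meridian at double
speed and comes back down along the meridian of `l₀`, so that both poles go to the base point. -/
lemma exists_folded_id (h : IsSusp θ) (l₀ : L) : ∃ g : C(Y, Y),
    g (θ (l₀, 0)) = θ (l₀, 0) ∧ g (θ (l₀, 1)) = θ (l₀, 0) ∧ g.Homotopic (ContinuousMap.id Y) := by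
  let H : C(I × (L × I), Y) :=
    ⟨fun q => if (1 + q.1) * (q.2.2 : ℝ) ≤ 1 then θ (q.2.1, clamp ((1 + q.1) * (q.2.2 : ℝ)))
        else θ (l₀, clamp (2 - (1 + q.1) * (q.2.2 : ℝ))),
      Continuous.if_le (by fun_prop) (by fun_prop) (by fun_prop) (by fun_prop) fun q hq => by
        rw [hq, clamp_of_ge le_rfl, clamp_of_ge (by norm_num)]
        exact h.apply_one _ _⟩
  have hH0 : ∀ t l, H (t, l, 0) = θ (l₀, 0) := fun t l => by
    change (if (1 + (t : ℝ)) * ((0 : I) : ℝ) ≤ 1 then _ else _) = _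
    rw [if_pos (by simp), clamp_of_le (by simp)]
    exact h.apply_zero _ _
  have hH1 : ∀ t l l', H (t, l, 1) = H (t, l', 1) := fun t l l' => by
    change (if (1 + (t : ℝ)) * ((1 : I) : ℝ) ≤ 1 then θ (l, clamp _) else _) =
      (if (1 + (t : ℝ)) * ((1 : I) : ℝ) ≤ 1 then θ (l', clamp _) else _)
    split_ifs
    · rw [clamp_of_ge (by simpa using t.2.1)]
      exact h.apply_one _ _
    · rfl
  obtain ⟨g, hg⟩ := h.exists_lift_univ (H.comp ⟨fun p => (1, p), by fun_prop⟩)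
    (fun l l' => (hH0 1 l).trans (hH0 1 l').symm) (fun l l' => hH1 1 l l')
  refine ⟨g, (hg _).trans (hH0 _ _), (hg _).trans ?_, ContinuousMap.Homotopic.symm
    (h.homotopic H (fun t l l' => (hH0 t l).trans (hH0 t l').symm) hH1 ?_ fun p => (hg p).symm)⟩
  · change (if (1 + ((1 : I) : ℝ)) * ((1 : I) : ℝ) ≤ 1 then _ else _) = _
    rw [if_neg (by norm_num), clamp_of_le (by norm_num)]
  · rintro ⟨l, s⟩
    change (if (1 + ((0 : I) : ℝ)) * (s : ℝ) ≤ 1 then θ (l, clamp _) else _) = _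
    have : (1 + ((0 : I) : ℝ)) * (s : ℝ) = s := by simp
    rw [this, if_pos s.2.2, clamp_coe]
    rfl

/-- Pinching the folded identity with a map acting as `N` gives a map acting as `N + 1`. -/
theorem hasMult (h : IsSusp θ) (l₀ : L) : HasMult (θ (l₀, 0)) := by
  intro N hN
  induction N, hN using Nat.le_induction with
  | base => exact ⟨ContinuousMap.id Y, rfl, fun n c hc => by simp⟩
  | succ N hN ih =>
    obtain ⟨f, hf0, hf⟩ := ih
    obtain ⟨g, hg0, hg1, hg⟩ := h.exists_folded_id l₀
    obtain ⟨G, hG0, hG⟩ := h.exists_pinch (R := ℤ) l₀ g f (hg1.trans hf0.symm)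
    refine ⟨G, hG0.trans hg0, fun n c hc => ?_⟩
    have h1 := map_sub_map_mem_bdry (R := ℤ) hg hc
    rw [push_id_map] at h1
    have := Submodule.add_mem _ (Submodule.add_mem _ (hG n c hc) h1) (hf n c hc)
    convert this using 1
    push_cast
    rw [add_smul, one_smul]
    abel

end IsSusp

end

section
open OnePoint

/-! ### Cones -/

section
variable {X Z : Type} [TopologicalSpace X] [TopologicalSpace Z]

lemma continuous_of_onePoint {f : Z → OnePoint X}
    (h : ∀ z (x : X), f z = x → ContinuousAt f z)
    (h' : ∀ z, f z = ∞ → ∀ K : Set X, IsClosed K → IsCompact K →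
      ∀ᶠ z' in 𝓝 z, f z' ∉ ((↑) '' K : Set (OnePoint X))) : Continuous f := by
  refine continuous_iff_continuousAt.2 fun z => ?_
  rcases hz : f z with _ | x
  · rw [ContinuousAt, hz]
    refine (hasBasis_nhds_infty).tendsto_right_iff.2 fun K hK => ?_
    filter_upwards [h' z hz K hK.1 hK.2] with z' hz'
    rw [← compl_image_coe]
    exact hz'
  · exact h z x hz

/-- `X` is a cone with vertex `x₀`: the multiplicative monoid `[0, ∞)` acts on it by `μ`, and `ρ`
is a proper function, homogeneous of degree one, which vanishes at `x₀` only. -/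
structure IsCone (μ : C(NNReal × X, X)) (ρ : C(X, NNReal)) (x₀ : X) : Prop where
  one : ∀ x, μ (1, x) = x
  mul : ∀ s t x, μ (s * t, x) = μ (s, μ (t, x))
  zero : ∀ x, μ (0, x) = x₀
  homogeneous : ∀ t x, ρ (μ (t, x)) = t * ρ x
  eq_of_eq_zero : ∀ x, ρ x = 0 → x = x₀
  isCompact : ∀ R, IsCompact (ρ ⁻¹' Set.Iic R)

namespace IsCone
variable {μ : C(NNReal × X, X)} {ρ : C(X, NNReal)} {x₀ : X}

lemma eq_zero (h : IsCone μ ρ x₀) : ρ x₀ = 0 := by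
  rw [← h.zero x₀, h.homogeneous, zero_mul]

/-- The link of the vertex of a cone. -/
abbrev link (ρ : C(X, NNReal)) : Type := {x : X // ρ x = 1}

lemma compactSpace_link (h : IsCone μ ρ x₀) : CompactSpace (link ρ) :=
  isCompact_iff_compactSpace.1 ((h.isCompact 1).of_isClosed_subset
    (isClosed_singleton.preimage ρ.continuous) fun x (hx : ρ x = 1) => hx.le)

lemma contractibleSpace (h : IsCone μ ρ x₀) : ContractibleSpace X :=
  (contractible_iff_id_nullhomotopic _).2 ⟨x₀, ContinuousMap.Homotopic.symm
    ⟨⟨μ.comp ⟨fun p : I × X => (⟨p.1, p.1.2.1⟩, p.2), by fun_prop⟩,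
      fun x => h.zero x, fun x => h.one x⟩⟩⟩

lemma ne_iff (h : IsCone μ ρ x₀) {x : X} : x ≠ x₀ ↔ ρ x ≠ 0 :=
  not_congr ⟨fun e => e ▸ h.eq_zero, h.eq_of_eq_zero x⟩

/-- The retraction scales `x` by `(ρ x)⁻¹`; the homotopy moves the scaling factor linearly from `1`
to `(ρ x)⁻¹`, so it never vanishes. -/
lemma exists_equiv_link (h : IsCone μ ρ x₀) :
    ∃ (i : C(link ρ, ({x₀}ᶜ : Set X))) (r : C(({x₀}ᶜ : Set X), link ρ)),
      r.comp i = ContinuousMap.id _ ∧ (i.comp r).Homotopic (ContinuousMap.id _) := by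
  have hne : ∀ x : ({x₀}ᶜ : Set X), ρ x ≠ 0 := fun x => h.ne_iff.1 x.2
  let i : C(link ρ, ({x₀}ᶜ : Set X)) :=
    ⟨fun x => ⟨x, h.ne_iff.2 (by rw [x.2]; exact one_ne_zero)⟩, by fun_prop⟩
  have hinv : Continuous fun x : ({x₀}ᶜ : Set X) => (ρ x)⁻¹ :=
    (ρ.continuous.comp continuous_subtype_val).inv₀ hne
  let r : C(({x₀}ᶜ : Set X), link ρ) :=
    ⟨fun x => ⟨μ ((ρ x)⁻¹, x), by rw [h.homogeneous, inv_mul_cancel₀ (hne x)]⟩, by fun_prop⟩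
  refine ⟨i, r, ?_, ContinuousMap.Homotopic.symm ⟨⟨⟨fun p => ⟨μ
    (⟨1 - p.1, sub_nonneg.2 p.1.2.2⟩ + ⟨p.1, p.1.2.1⟩ * (ρ p.2)⁻¹, p.2), h.ne_iff.2 ?_⟩, ?_⟩,
    fun x => Subtype.ext ?_, fun x => Subtype.ext ?_⟩⟩⟩
  · refine ContinuousMap.ext fun x => Subtype.ext ?_
    change μ ((ρ x.1)⁻¹, x.1) = x.1
    rw [x.2, inv_one, h.one]
  · rw [h.homogeneous]
    refine mul_ne_zero (fun e => ?_) (hne _)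
    have e' : ((1 - p.1) + p.1 * ((ρ p.2)⁻¹ : NNReal) : ℝ) = 0 := congrArg NNReal.toReal e
    have h1 : (0 : ℝ) < ((ρ p.2)⁻¹ : NNReal) := NNReal.coe_pos.2 (inv_pos.2 (pos_iff_ne_zero.2 (hne _)))
    have h2 := p.1.2.1
    have h3 := p.1.2.2
    have h4 := mul_nonneg h2 h1.le
    have h5 : (p.1 : ℝ) = 1 := by linarith
    rw [h5] at e'
    linarith
  · have : Continuous fun p : I × ({x₀}ᶜ : Set X) => (ρ p.2)⁻¹ := hinv.comp continuous_snd
    fun_prop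
  · change μ (⟨1 - ((0 : I) : ℝ), _⟩ + ⟨((0 : I) : ℝ), _⟩ * (ρ x)⁻¹, x.1) = x.1
    convert h.one x.1 using 3
    refine NNReal.eq ?_
    change (1 - (0 : ℝ)) + (0 : ℝ) * ((ρ x)⁻¹ : NNReal) = 1
    simp
  · change μ (⟨1 - ((1 : I) : ℝ), _⟩ + ⟨((1 : I) : ℝ), _⟩ * (ρ x)⁻¹, x.1) = μ ((ρ x)⁻¹, x.1)
    congr 2
    refine NNReal.eq ?_
    change (1 - (1 : ℝ)) + (1 : ℝ) * ((ρ x)⁻¹ : NNReal) = ((ρ x)⁻¹ : NNReal)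
    simp

/-- The radius at the height `s`. -/
def radius (s : I) : NNReal := ⟨s / (1 - s), div_nonneg s.2.1 (sub_nonneg.2 s.2.2)⟩

lemma continuousAt_radius {s : I} (hs : s ≠ 1) : ContinuousAt radius s := by
  refine NNReal.isEmbedding_coe.continuousAt_iff.2 ?_
  have : (1 - s : ℝ) ≠ 0 := fun e => hs (Subtype.ext (show _ = (1 : ℝ) by linarith))
  exact ContinuousAt.div (by fun_prop) (by fun_prop) this

lemma radius_injective {s t : I} (hs : s ≠ 1) (ht : t ≠ 1) (h : radius s = radius t) : s = t := by
  have h1 : (1 - s : ℝ) ≠ 0 := fun e => hs (Subtype.ext (show _ = (1 : ℝ) by linarith))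
  have h2 : (1 - t : ℝ) ≠ 0 := fun e => ht (Subtype.ext (show _ = (1 : ℝ) by linarith))
  have h3 : (s / (1 - s) : ℝ) = t / (1 - t) := congrArg NNReal.toReal h
  rw [div_eq_div_iff h1 h2] at h3
  exact Subtype.ext (by linarith)

lemma exists_radius (t : NNReal) : ∃ s : I, s ≠ 1 ∧ radius s = t := by
  have ht : (0 : ℝ) < 1 + t := by positivity
  refine ⟨⟨t / (1 + t), by positivity, by rw [div_le_one ht]; linarith⟩, fun e => ?_, ?_⟩
  · have : (t / (1 + t) : ℝ) = 1 := congrArg Subtype.val e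
    rw [div_eq_one_iff_eq ht.ne'] at this
    linarith
  · refine NNReal.eq ?_
    change (t / (1 + t) / (1 - t / (1 + t)) : ℝ) = t
    field_simp
    ring

lemma radius_zero : radius 0 = 0 := NNReal.eq (show ((0 : ℝ) / (1 - 0)) = 0 by simp)

lemma eventually_lt_radius (R : NNReal) : ∀ᶠ s : I in 𝓝 1, s ≠ 1 → R < radius s := by
  have : ∀ᶠ s : I in 𝓝 1, (R / (1 + R) : ℝ) < (s : ℝ) := by
    refine (isOpen_lt continuous_const continuous_subtype_val).mem_nhds ?_
    change (R / (1 + R) : ℝ) < 1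
    rw [div_lt_one (by positivity)]
    linarith
  filter_upwards [this] with s hs h1
  have hs1 : (s : ℝ) < 1 := lt_of_le_of_ne s.2.2 fun e => h1 (Subtype.ext e)
  change (R : ℝ) < s / (1 - s)
  rw [div_lt_iff₀ (by positivity)] at hs
  rw [lt_div_iff₀ (by linarith)]
  linarith

lemma eq_and_eq (h : IsCone μ ρ x₀) {l l' : link ρ} {s t : NNReal}
    (e : μ (s, l.1) = μ (t, l'.1)) : s = t ∧ (s ≠ 0 → l = l') := by
  have e1 := congrArg ρ e
  rw [h.homogeneous, h.homogeneous, l.2, l'.2, mul_one, mul_one] at e1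
  subst e1
  refine ⟨rfl, fun hs => Subtype.ext ?_⟩
  have := congrArg (fun x => μ (s⁻¹, x)) e
  simpa only [← h.mul, inv_mul_cancel₀ hs, h.one] using this

/-- The one-point compactification of a cone is the suspension of the link. -/
theorem exists_isSusp (h : IsCone μ ρ x₀) [Nonempty (link ρ)] [T2Space X] :
    ∃ θ : C(link ρ × I, OnePoint X), IsSusp θ ∧ (∀ l, θ (l, 0) = x₀) ∧ ∀ l, θ (l, 1) = ∞ := by
  classical
  let f : link ρ × I → OnePoint X := fun p =>
    if p.2 = 1 then ∞ else ((μ (radius p.2, p.1.1) : X) : OnePoint X)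
  have f1 : ∀ l, f (l, 1) = ∞ := fun l => if_pos rfl
  have f2 : ∀ l s, s ≠ 1 → f (l, s) = (μ (radius s, l.1) : X) := fun l s hs => if_neg hs
  have hf : Continuous f := by
    refine continuous_of_onePoint ?_ ?_
    · rintro ⟨l, s⟩ x hx
      have hs : s ≠ 1 := fun e => by rw [e, f1] at hx; exact infty_ne_coe x hx
      have h1 : ContinuousAt (fun p : link ρ × I => (radius p.2, p.1.1)) (l, s) :=
        ContinuousAt.prodMk (ContinuousAt.comp (f := Prod.snd) (continuousAt_radius hs)
          continuousAt_snd) (continuous_subtype_val.comp continuous_fst).continuousAt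
      have h2 : ContinuousAt (fun p : link ρ × I => ((μ (radius p.2, p.1.1) : X) : OnePoint X))
          (l, s) :=
        (continuous_coe.comp μ.continuous).continuousAt.comp (x := (l, s)) h1
      refine h2.congr ?_
      filter_upwards [(isOpen_compl_singleton (x := (1 : I))).preimage continuous_snd |>.mem_nhds
        (show (l, s) ∈ _ from hs)] with p hp
      exact (f2 p.1 p.2 hp).symm
    · rintro ⟨l, s⟩ hx K - hK
      have hs : s = 1 := by_contra fun e => by rw [f2 _ _ e] at hx; exact coe_ne_infty _ hx
      subst hs
      -- `ρ` is bounded on `K`, while the radius tends to infinity as the height tends to `1`.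
      obtain ⟨R, hR⟩ := (hK.image ρ.continuous).bddAbove
      filter_upwards [continuousAt_snd.eventually (eventually_lt_radius R)] with p hp
      rintro ⟨x, hxK, hxp⟩
      have hp1 : p.2 ≠ 1 := fun e => by
        rw [show p = (p.1, 1) from Prod.ext rfl e, f1] at hxp
        exact coe_ne_infty _ hxp
      have e := hxp.trans (f2 p.1 p.2 hp1)
      rw [coe_eq_coe] at e
      have h3 : ρ x ≤ R := hR ⟨x, hxK, rfl⟩
      rw [e, h.homogeneous, p.1.2, mul_one] at h3
      exact absurd (hp hp1) (not_lt.2 h3)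
  have f0 : ∀ l, f (l, 0) = x₀ := fun l => by
    rw [f2 _ _ zero_ne_one, radius_zero, h.zero]
  refine ⟨⟨f, hf⟩, ⟨fun y => ?_, fun p q => ?_⟩, f0, f1⟩
  · rcases y with _ | x
    · exact ⟨(Classical.arbitrary _, 1), f1 _⟩
    · by_cases hx : ρ x = 0
      · exact ⟨(Classical.arbitrary _, 0), by rw [h.eq_of_eq_zero x hx]; exact f0 _⟩
      · obtain ⟨s, hs, hst⟩ := exists_radius (ρ x)
        refine ⟨(⟨μ ((ρ x)⁻¹, x), by rw [h.homogeneous, inv_mul_cancel₀ hx]⟩, s), ?_⟩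
        refine (f2 _ _ hs).trans ?_
        rw [hst, ← h.mul, mul_inv_cancel₀ hx, h.one]
        rfl
  · obtain ⟨l, s⟩ := p
    obtain ⟨l', t⟩ := q
    change f (l, s) = f (l', t) ↔ _
    by_cases hs : s = 1
    · by_cases ht : t = 1
      · subst hs ht
        simp [f1]
      · subst hs
        rw [f1, f2 _ _ ht]
        refine ⟨fun e => (infty_ne_coe _ e).elim, ?_⟩
        rintro (e | ⟨e, -⟩ | ⟨-, e⟩)
        · exact (ht (Prod.ext_iff.1 e).2.symm).elim
        · exact (one_ne_zero e).elim
        · exact (ht e).elim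
    · by_cases ht : t = 1
      · subst ht
        rw [f1, f2 _ _ hs]
        refine ⟨fun e => (coe_ne_infty _ e).elim, ?_⟩
        rintro (e | ⟨-, e⟩ | ⟨e, -⟩)
        · exact (hs (Prod.ext_iff.1 e).2).elim
        · exact (one_ne_zero e).elim
        · exact (hs e).elim
      · rw [f2 _ _ hs, f2 _ _ ht, coe_eq_coe]
        constructor
        · intro e
          obtain ⟨e1, e2⟩ := h.eq_and_eq e
          have est := radius_injective hs ht e1
          subst est
          by_cases h0 : s = 0
          · exact Or.inr (Or.inl ⟨h0, h0⟩)
          · refine Or.inl (Prod.ext (e2 fun e3 => h0 ?_) rfl)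
            exact radius_injective hs zero_ne_one (e3.trans radius_zero.symm)
        · rintro (e | ⟨e, e'⟩ | ⟨e, -⟩)
          · rw [Prod.ext_iff] at e
            obtain ⟨rfl, rfl⟩ := e
            rfl
          · dsimp only at e e'
            rw [e, e', radius_zero, h.zero, h.zero]
          · exact (hs e).elim

end IsCone
end

end

section
open OnePoint

/-! ### The homology of spheres -/

section
variable {R : Type} [CommRing R] {X Y : Type} [TopologicalSpace X] [TopologicalSpace Y]

lemma Acyc.of_homeomorph (e : X ≃ₜ Y) {n : ℕ} (h : Acyc R Y n) : Acyc R X n :=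
  Acyc.of_retract (f := (e : C(X, Y))) (g := (e.symm : C(Y, X)))
    (by rw [show (e.symm : C(Y, X)).comp (e : C(X, Y)) = ContinuousMap.id X from by ext; simp]) h

lemma HomLine.of_homeomorph (e : X ≃ₜ Y) {n : ℕ} (h : HomLine R Y n) : HomLine R X n :=
  HomLine.of_equiv (f := (e : C(X, Y))) (g := (e.symm : C(Y, X)))
    (by rw [show (e.symm : C(Y, X)).comp (e : C(X, Y)) = ContinuousMap.id X from by ext; simp])
    (by rw [show (e : C(X, Y)).comp (e.symm : C(Y, X)) = ContinuousMap.id Y from by ext; simp]) h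

lemma acyc_zero [Nonempty Y] : Acyc R Y 0 := fun c _ => by
  let y := Classical.arbitrary Y
  obtain ⟨a, rfl⟩ := chain_zero_eq c
  exact Submodule.smul_mem _ _ ⟨of R (pt y), d_pt y⟩

instance isEmpty_simplex [IsEmpty Y] (n : ℕ) : IsEmpty ((Sing Y).obj (n + 1)) :=
  ⟨fun σ => isEmptyElim (σ (stdSimplex.vertex 0))⟩

lemma acyc_of_isEmpty [IsEmpty Y] (n : ℕ) : Acyc R Y (n + 1) := fun c _ => by
  rw [Subsingleton.elim c 0]
  exact Submodule.zero_mem _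

lemma homLine_of_isEmpty [Nontrivial R] [IsEmpty Y] : HomLine R Y 0 := by
  refine ⟨of R (emptySimplex Y), trivial, ?_, fun c _ => ?_⟩
  · rintro ⟨w, hw⟩
    rw [Subsingleton.elim w 0, map_zero] at hw
    exact one_ne_zero (Finsupp.single_eq_zero.1 hw.symm)
  · obtain ⟨a, rfl⟩ := chain_zero_eq c
    exact ⟨a, by rw [sub_self]; exact Submodule.zero_mem _⟩

end

/-- The norm of Euclidean space. -/
def normMap (d : ℕ) : C(EuclideanSpace ℝ (Fin d), NNReal) := ⟨fun x => ‖x‖₊, continuous_nnnorm⟩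

/-- Euclidean spaces are cones. -/
lemma isCone_euclideanSpace (d : ℕ) :
    IsCone (X := EuclideanSpace ℝ (Fin d)) ⟨fun p => (p.1 : ℝ) • p.2, by fun_prop⟩ (normMap d) 0 where
  one x := by simp
  mul s t x := by simp [mul_smul]
  zero x := by simp
  homogeneous t x := by simp [normMap, nnnorm_smul]
  eq_of_eq_zero x hx := by simpa [normMap] using hx
  isCompact R := by
    have : (normMap d) ⁻¹' Set.Iic R = Metric.closedBall 0 R := by
      ext x
      rw [mem_closedBall_zero_iff]
      rfl
    rw [this]
    exact isCompact_closedBall (0 : EuclideanSpace ℝ (Fin d)) R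

/-- The link of the vertex of Euclidean space is a sphere. -/
def linkHomeomorph (d : ℕ) :
    IsCone.link (normMap (d + 1)) ≃ₜ sphere d :=
  (Homeomorph.refl _).subtype fun x => by
    simp [normMap, ← NNReal.coe_inj]

/-- A sphere is the one-point compactification of a vector space. -/
def sphereHomeomorph {d : ℕ} {V : Type} [NormedAddCommGroup V] [NormedSpace ℝ V]
    [FiniteDimensional ℝ V] (h : Module.finrank ℝ V = d) : OnePoint V ≃ₜ sphere d :=
  onePointEquivSphereOfFinrankEq (by simp [h])

instance nonempty_sphere (d : ℕ) : Nonempty (sphere d) :=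
  ⟨sphereHomeomorph (V := EuclideanSpace ℝ (Fin d)) (by simp) ∞⟩

section
variable {R : Type} [CommRing R]

/-- The two points of this sphere form a cover by contractible open sets with empty intersection.
The empty space has reduced homology in index `0` only, spanned by the empty simplex. -/
lemma sphere_zero_homology [Nontrivial R] :
    HomLine R (sphere 0) 1 ∧ ∀ n, n ≠ 1 → Acyc R (sphere 0) n := by
  let U : Set (sphere 0) := {x | 0 < x.1 0}
  let V : Set (sphere 0) := {x | x.1 0 < 0}
  have hcont : Continuous fun x : sphere 0 => x.1 0 := by
    have : Continuous fun x : EuclideanSpace ℝ (Fin 1) => x 0 := by fun_prop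
    exact this.comp continuous_subtype_val
  have hU : IsOpen U := isOpen_lt continuous_const hcont
  have hV : IsOpen V := isOpen_lt hcont continuous_const
  have hsq : ∀ x : sphere 0, x.1 0 = 1 ∨ x.1 0 = -1 := fun x => by
    have := EuclideanSpace.norm_sq_eq x.1
    rw [show ‖x.1‖ = 1 from mem_sphere_zero_iff_norm.1 x.2] at this
    have h2 : x.1 0 ^ 2 = 1 := by simpa using this.symm
    exact (sq_eq_sq_iff_eq_or_eq_neg.1 (h2.trans (one_pow 2).symm))
  have hext : ∀ x y : sphere 0, x.1 0 = y.1 0 → x = y := fun x y h => by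
    refine Subtype.ext (PiLp.ext fun i => ?_)
    rw [Fin.fin_one_eq_zero i]
    exact h
  have hUV : U ∪ V = Set.univ := Set.eq_univ_of_forall fun x => by
    rcases hsq x with h | h
    · exact Or.inl (show 0 < x.1 0 by rw [h]; norm_num)
    · exact Or.inr (show x.1 0 < 0 by rw [h]; norm_num)
  have hp : ∀ a : ℝ, a ^ 2 = 1 → ∃ x : sphere 0, x.1 0 = a := fun a ha =>
    ⟨⟨!₂[a], mem_sphere_zero_iff_norm.2 (by
      rw [← sq_eq_sq₀ (norm_nonneg _) zero_le_one, EuclideanSpace.norm_sq_eq]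
      simp [ha])⟩, rfl⟩
  obtain ⟨u, hu⟩ := hp 1 (by norm_num)
  obtain ⟨v, hv⟩ := hp (-1) (by norm_num)
  have : Unique U := ⟨⟨⟨u, show 0 < u.1 0 by rw [hu]; norm_num⟩⟩, fun x => Subtype.ext (hext _ _ (by
    have hx : 0 < x.1.1 0 := x.2
    rcases hsq x.1 with h | h
    · exact h.trans hu.symm
    · linarith))⟩
  have : Unique V := ⟨⟨⟨v, show v.1 0 < 0 by rw [hv]; norm_num⟩⟩, fun x => Subtype.ext (hext _ _ (by
    have hx : x.1.1 0 < 0 := x.2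
    rcases hsq x.1 with h | h
    · linarith
    · exact h.trans hv.symm))⟩
  have : IsEmpty ↥(U ∩ V) := ⟨fun x => by
    have h1 : 0 < x.1.1 0 := x.2.1
    have h2 : x.1.1 0 < 0 := x.2.2
    linarith⟩
  refine ⟨homLine_of_cover hU hV hUV (fun n => Acyc.of_contractible n)
    (fun n => Acyc.of_contractible n) homLine_of_isEmpty, fun n hn => ?_⟩
  match n, hn with
  | 0, _ => exact acyc_zero
  | 1, h => exact (h rfl).elim
  | n + 2, _ =>
    exact acyc_of_cover hU hV hUV (fun n => Acyc.of_contractible n)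
      (fun n => Acyc.of_contractible n) (acyc_of_isEmpty n)

lemma exists_isSusp_sphere (d : ℕ) :
    ∃ θ : C(sphere d × I, OnePoint (EuclideanSpace ℝ (Fin (d + 1)))), IsSusp θ := by
  have hne : Nonempty (IsCone.link (normMap (d + 1))) :=
    ⟨(linkHomeomorph d).symm (Classical.arbitrary _)⟩
  obtain ⟨θ, hθ, -⟩ := (isCone_euclideanSpace (d + 1)).exists_isSusp
  refine ⟨θ.comp (((linkHomeomorph d).symm : C(_, _)).prodMap (ContinuousMap.id I)), ?_, ?_⟩
  · intro y
    obtain ⟨p, rfl⟩ := hθ.surjective y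
    exact ⟨(linkHomeomorph d p.1, p.2), by simp⟩
  · rintro ⟨l, s⟩ ⟨l', t⟩
    simp [hθ.eq_iff]

/-- Induction by suspension: the one-point compactification of Euclidean space of dimension `d + 1`
is a sphere of dimension `d + 1` and also the suspension of the unit sphere, of dimension `d`. -/
theorem sphere_homology [Nontrivial R] (d : ℕ) :
    HomLine R (sphere d) (d + 1) ∧ ∀ n, n ≠ d + 1 → Acyc R (sphere d) n := by
  induction d with
  | zero => exact sphere_zero_homology
  | succ d ih =>
    have : CompactSpace (sphere d) := isCompact_iff_compactSpace.1 (isCompact_sphere _ _)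
    obtain ⟨θ, hθ⟩ := exists_isSusp_sphere d
    let e : OnePoint (EuclideanSpace ℝ (Fin (d + 1))) ≃ₜ sphere (d + 1) := sphereHomeomorph (by simp)
    refine ⟨HomLine.of_homeomorph e.symm (hθ.homLine ih.1), fun n hn => ?_⟩
    cases n with
    | zero => exact acyc_zero
    | succ n => exact Acyc.of_homeomorph e.symm (hθ.acyc (ih.2 n (by omega)))

theorem simplyConnectedSpace_sphere (d : ℕ) : SimplyConnectedSpace (sphere (d + 2)) := by
  have : CompactSpace (sphere (d + 1)) := isCompact_iff_compactSpace.1 (isCompact_sphere _ _)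
  have : PathConnectedSpace (sphere (d + 1)) :=
    isPathConnected_iff_pathConnectedSpace.1 (isPathConnected_sphere (by
      rw [← Module.finrank_eq_rank, finrank_euclideanSpace_fin]
      exact_mod_cast (by omega : 1 < d + 1 + 1)) _ zero_le_one)
  obtain ⟨θ, hθ⟩ := exists_isSusp_sphere (d + 1)
  have := hθ.simplyConnectedSpace
  let e : OnePoint (EuclideanSpace ℝ (Fin (d + 2))) ≃ₜ sphere (d + 2) := sphereHomeomorph (by simp)
  exact e.symm.toHomotopyEquiv.simplyConnectedSpace

end

end

section
open OnePoint

/-! ### Spheres as quotients of simplices -/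

section
variable {d : ℕ}

/-- The interior of the simplex, in logarithmic coordinates. -/
def softmax (v : Fin d → ℝ) : Splx (d + 1) :=
  ⟨fun i => Real.exp (Fin.snoc (α := fun _ => ℝ) v 0 i) /
      ∑ k, Real.exp (Fin.snoc (α := fun _ => ℝ) v 0 k),
    fun i => div_nonneg (Real.exp_pos _).le (Finset.sum_nonneg fun _ _ => (Real.exp_pos _).le), by
    rw [← Finset.sum_div]
    exact div_self (Finset.sum_pos (fun _ _ => Real.exp_pos _) Finset.univ_nonempty).ne'⟩

lemma softmax_apply (v : Fin d → ℝ) (i : Fin (d + 1)) :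
    softmax v i = Real.exp (Fin.snoc (α := fun _ => ℝ) v 0 i) /
      ∑ k, Real.exp (Fin.snoc (α := fun _ => ℝ) v 0 k) := rfl

lemma softmax_pos (v : Fin d → ℝ) (i : Fin (d + 1)) : 0 < softmax v i :=
  div_pos (Real.exp_pos _) (Finset.sum_pos (fun _ _ => Real.exp_pos _) Finset.univ_nonempty)

lemma continuous_softmax : Continuous (softmax (d := d)) := by
  have h : ∀ i : Fin (d + 1), Continuous fun v : Fin d → ℝ =>
      Real.exp (Fin.snoc (α := fun _ => ℝ) v 0 i) := fun i => by
    refine Real.continuous_exp.comp ?_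
    refine Fin.lastCases ?_ (fun i => ?_) i
    · simpa using continuous_const
    · simpa using continuous_apply i
  exact Continuous.subtype_mk (continuous_pi fun i => (h i).div
    (continuous_finsetSum _ fun k _ => h k) fun v =>
      (Finset.sum_pos (fun _ _ => Real.exp_pos _) Finset.univ_nonempty).ne') _

/-- Logarithmic coordinates on the interior of the simplex. -/
def logCoord (x : Splx (d + 1)) (i : Fin d) : ℝ :=
  Real.log (x i.castSucc) - Real.log (x (Fin.last d))

lemma logCoord_softmax (v : Fin d → ℝ) : logCoord (softmax v) = v := by
  funext i
  have h := (Finset.sum_pos (fun k _ => Real.exp_pos (Fin.snoc (α := fun _ => ℝ) v 0 k))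
    (Finset.univ_nonempty (α := Fin (d + 1)))).ne'
  rw [logCoord, softmax_apply, softmax_apply, Real.log_div (Real.exp_ne_zero _) h,
    Real.log_div (Real.exp_ne_zero _) h, Real.log_exp, Real.log_exp, Fin.snoc_castSucc,
    Fin.snoc_last]
  ring

lemma pos_of_notMem_bd {n : ℕ} {x : Splx n} (h : x ∉ bd n) (i : Fin n) : 0 < x i :=
  lt_of_le_of_ne (x.2.1 i) fun e => h ⟨i, e.symm⟩

lemma softmax_logCoord {x : Splx (d + 1)} (h : x ∉ bd (d + 1)) : softmax (logCoord x) = x := by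
  have key : ∀ i : Fin (d + 1), Real.exp (Fin.snoc (α := fun _ => ℝ) (logCoord x) 0 i) =
      x i / x (Fin.last d) := fun i => by
    refine Fin.lastCases ?_ (fun i => ?_) i
    · rw [Fin.snoc_last, Real.exp_zero, div_self (pos_of_notMem_bd h _).ne']
    · rw [Fin.snoc_castSucc, logCoord, Real.exp_sub, Real.exp_log (pos_of_notMem_bd h _),
        Real.exp_log (pos_of_notMem_bd h _)]
  refine Subtype.ext (funext fun i => ?_)
  change softmax (logCoord x) i = x i
  rw [softmax_apply, key, Finset.sum_congr rfl fun k _ => key k, ← Finset.sum_div]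
  have h1 : ∑ k, x k = 1 := x.2.2
  rw [h1]
  have := (pos_of_notMem_bd h (Fin.last d)).ne'
  field_simp

lemma isClosed_bd {n : ℕ} : IsClosed (bd n) := by
  have : bd n = ⋃ i, {x | x i = 0} := by ext x; simp [bd]
  rw [this]
  exact isClosed_iUnion_of_finite fun i => isClosed_eq (continuous_splx_apply i) continuous_const

lemma vertex_mem_bd (hd : 1 ≤ d) : stdSimplex.vertex 0 ∈ bd (d + 1) := by
  have : Fin.last d ≠ 0 := by
    rw [Ne, Fin.ext_iff, Fin.val_last, Fin.val_zero]
    omega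
  exact ⟨Fin.last d, by simp [stdSimplex.vertex, this]⟩

/-- The quotient of a simplex by its boundary is the one-point compactification of a vector
space. -/
lemma exists_collapse (hd : 1 ≤ d) : ∃ q : C(Splx (d + 1), OnePoint (Fin d → ℝ)),
    Function.Surjective q ∧ Spherical ∞ q ∧
      ∀ x y, q x = q y → x = y ∨ (x ∈ bd (d + 1) ∧ y ∈ bd (d + 1)) := by
  classical
  let f : Splx (d + 1) → OnePoint (Fin d → ℝ) := fun x =>
    if x ∈ bd (d + 1) then ∞ else (logCoord x : Fin d → ℝ)
  have f1 : ∀ x ∈ bd (d + 1), f x = ∞ := fun x hx => if_pos hx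
  have f2 : ∀ x ∉ bd (d + 1), f x = (logCoord x : Fin d → ℝ) := fun x hx => if_neg hx
  have hf : Continuous f := by
    refine continuous_of_onePoint (fun x v hx => ?_) fun x hx K _ hK => ?_
    · have hxb : x ∉ bd (d + 1) := fun h => infty_ne_coe v ((f1 x h).symm.trans hx)
      have h1 : ContinuousAt (logCoord (d := d)) x := by
        refine continuousAt_pi.2 fun i => ContinuousAt.sub ?_ ?_
        · exact (continuous_splx_apply _).continuousAt.log (pos_of_notMem_bd hxb _).ne'
        · exact (continuous_splx_apply _).continuousAt.log (pos_of_notMem_bd hxb _).ne'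
      refine (continuous_coe.continuousAt.comp h1).congr ?_
      filter_upwards [isClosed_bd.isOpen_compl.mem_nhds hxb] with y hy
      exact (f2 y hy).symm
    · have hxb : x ∈ bd (d + 1) := by_contra fun h => coe_ne_infty _ ((f2 x h).symm.trans hx)
      -- The image of a compact set under `softmax` is compact in the open simplex. So it misses a
      -- neighbourhood of each boundary point, and near the boundary the logarithmic coordinates
      -- leave `K`.
      have hKc : IsClosed (softmax '' K) := (hK.image continuous_softmax).isClosed
      have hxK : x ∉ softmax '' K := by
        rintro ⟨v, -, rfl⟩
        obtain ⟨i, hi⟩ := hxb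
        exact (softmax_pos v i).ne' hi
      filter_upwards [hKc.isOpen_compl.mem_nhds hxK] with y hy
      rintro ⟨v, hv, hvy⟩
      refine hy ⟨v, hv, ?_⟩
      have hyb : y ∉ bd (d + 1) := fun h => coe_ne_infty v (hvy.trans (f1 y h))
      rw [f2 y hyb, coe_eq_coe] at hvy
      rw [hvy, softmax_logCoord hyb]
  have hsm : ∀ v : Fin d → ℝ, softmax v ∉ bd (d + 1) := fun v ⟨i, hi⟩ => (softmax_pos v i).ne' hi
  refine ⟨⟨f, hf⟩, fun y => ?_, f1, fun x y hxy => ?_⟩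
  · rcases y with _ | v
    -- The point at infinity is attained because the boundary is nonempty, which requires `1 ≤ d`.
    · exact ⟨_, f1 _ (vertex_mem_bd hd)⟩
    · refine ⟨softmax v, (f2 _ (hsm v)).trans ?_⟩
      rw [logCoord_softmax]
      rfl
  · change f x = f y at hxy
    by_cases hx : x ∈ bd (d + 1)
    · by_cases hy : y ∈ bd (d + 1)
      · exact Or.inr ⟨hx, hy⟩
      · rw [f1 x hx, f2 y hy] at hxy
        exact (infty_ne_coe _ hxy).elim
    · by_cases hy : y ∈ bd (d + 1)
      · rw [f1 y hy, f2 x hx] at hxy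
        exact (coe_ne_infty _ hxy).elim
      · rw [f2 x hx, f2 y hy, coe_eq_coe] at hxy
        refine Or.inl ?_
        rw [← softmax_logCoord hx, hxy, softmax_logCoord hy]

variable {Y : Type} [TopologicalSpace Y] {y₀ : Y}

/-- A spherical simplex is a map from the sphere. -/
theorem Spherical.exists_factor (hd : 1 ≤ d) {τ : C(Splx (d + 1), Y)} (hτ : Spherical y₀ τ) :
    ∃ (q : C(Splx (d + 1), sphere d)) (p : sphere d) (f : C(sphere d, Y)), Spherical p q ∧
      f.comp q = τ ∧ f p = y₀ := by
  obtain ⟨q, hqs, hqb, hq⟩ := exists_collapse hd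
  have hquot : IsQuotientMap q := q.continuous.isClosedMap.isQuotientMap q.continuous hqs
  have hfac : Function.FactorsThrough τ q := fun x y hxy => by
    rcases hq x y hxy with rfl | ⟨hx, hy⟩
    · rfl
    · rw [hτ x hx, hτ y hy]
  let e : OnePoint (Fin d → ℝ) ≃ₜ sphere d := sphereHomeomorph (by simp)
  have hlift : ∀ x, hquot.lift τ hfac (q x) = τ x := fun x =>
    DFunLike.congr_fun (hquot.lift_comp τ hfac) x
  refine ⟨(e : C(_, _)).comp q, e ∞, (hquot.lift τ hfac).comp (e.symm : C(_, _)), ?_, ?_, ?_⟩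
  · intro x hx
    exact congrArg e (hqb x hx)
  · refine ContinuousMap.ext fun x => ?_
    simp only [ContinuousMap.comp_apply, ContinuousMap.coe_coe, e.symm_apply_apply, hlift]
  · simp only [ContinuousMap.comp_apply, ContinuousMap.coe_coe, e.symm_apply_apply]
    rw [← hqb _ (vertex_mem_bd hd), hlift, hτ _ (vertex_mem_bd hd)]

end

end

section

/-! ### Rational equivalences from spheres -/

section
variable {Y Z : Type} [TopologicalSpace Y] [TopologicalSpace Z]

/-- Both reduced homologies are lines concentrated in the same index, so a single class with nonzero
image forces an isomorphism. -/
lemma isIso_cohomology_map_of_homLine [Nonempty Y] (f : C(Y, Z)) {k : ℕ} (hY : HomLine ℚ Y k)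
    (hY' : ∀ n, n ≠ k → Acyc ℚ Y n) (hZ : HomLine ℚ Z k) (hZ' : ∀ n, n ≠ k → Acyc ℚ Z n)
    {z : (Sing Y).Chain ℚ k} (hz : z ∈ cyc ℚ (Sing Y) k)
    (hfz : (push f).map ℚ k z ∉ bdry ℚ (Sing Z) k) (m : ℕ) :
    IsIso ((cohomology m).map (TopCat.ofHom f).op) := by
  refine isIso_cohomology_map f (fun n w hw hfw => ?_) (fun n y hy => ?_) m
  · by_cases hn : n = k
    · subst hn
      obtain ⟨g, hg, -, hgen⟩ := hY
      obtain ⟨a, ha⟩ := hgen w hw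
      obtain ⟨b, hb⟩ := hgen z hz
      have h1 := map_mem_bdry (push f) ha
      have h2 := map_mem_bdry (push f) hb
      rw [map_sub, map_smul] at h1 h2
      have h3 := (Submodule.sub_mem_iff_right _ hfw).1 h1
      by_cases h0 : a = 0
      · rwa [h0, zero_smul, sub_zero] at ha
      · rw [Submodule.smul_mem_iff _ h0] at h3
        exact (hfz ((Submodule.sub_mem_iff_left _ (Submodule.smul_mem _ b h3)).1 h2)).elim
    · exact hY' n hn w hw
  · by_cases hn : n = k
    · subst hn
      obtain ⟨g, hg, -, hgen⟩ := hZ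
      obtain ⟨a, ha⟩ := hgen y hy
      obtain ⟨b, hb⟩ := hgen _ (map_mem_cyc (push f) hz)
      have hb0 : b ≠ 0 := fun h => hfz (by rwa [h, zero_smul, sub_zero] at hb)
      refine ⟨(a / b) • z, Submodule.smul_mem _ _ hz, ?_⟩
      have := Submodule.sub_mem _ ha (Submodule.smul_mem _ (a / b) hb)
      rw [map_smul]
      convert this using 1
      rw [smul_sub, smul_smul, div_mul_cancel₀ _ hb0]
      abel
    · exact ⟨0, Submodule.zero_mem _, by rw [map_zero, sub_zero]; exact hZ' n hn y hy⟩

/-- A suspension with the rational homology of an even sphere receives a rational equivalence from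
this sphere. -/
theorem IsSusp.exists_sphere_map {L : Type} [TopologicalSpace L] [CompactSpace L] [T2Space Y]
    [PathConnectedSpace L] {θ : C(L × I, Y)} (h : IsSusp θ) {d : ℕ} (hd : 1 ≤ d)
    (hL : HomLine ℚ Y (d + 1)) (hA : ∀ n, n ≠ d + 1 → Acyc ℚ Y n) :
    ∃ f : C(sphere d, Y), ∀ m, IsIso ((cohomology m).map (TopCat.ofHom f).op) := by
  have := h.simplyConnectedSpace
  -- The rational Hurewicz theorem applies because a suspension carries the self-maps of `hasMult`.
  -- The simplex it provides is then factored through the sphere.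
  obtain ⟨τ, hτ, hne⟩ := exists_spherical (h.hasMult (Classical.arbitrary L))
    (fun n hn => hA n (by omega)) hL
  obtain ⟨q, p, f, hq, hfq, hfp⟩ := hτ.exists_factor hd
  refine ⟨f, fun m => isIso_cohomology_map_of_homLine f (sphere_homology d).1
    (sphere_homology d).2 hL hA (hq.sub_mem_cyc (R := ℚ)) ?_ m⟩
  rw [map_sub, Hom.map_of, Hom.map_of]
  convert hne using 3
  · exact congrArg _ hfq
  · exact congrArg _ (ContinuousMap.ext fun _ => hfp)

end

end

section

/-! ### Rationally smooth cones -/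

section
variable {Y : Type} [TopologicalSpace Y]

/-- The indicator of the path component of `x` is a functional on chains of points which vanishes on
boundaries. If `y` were outside that component, its value on the cycle `x - y` would be `1`. -/
lemma pathConnectedSpace_of_acyc [Nonempty Y] (h : Acyc ℚ Y 1) : PathConnectedSpace Y := by
  classical
  refine ⟨inferInstance, fun x y => ?_⟩
  let u : Y → ℚ := fun z => if Joined x z then 1 else 0
  let φ : (Sing Y).Chain ℚ 1 →ₗ[ℚ] ℚ :=
    lift ℚ fun σ : C(Splx 1, Y) => u (σ (stdSimplex.vertex 0))
  have hφ : ∀ c ∈ bdry ℚ (Sing Y) 1, φ c = 0 := by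
    rintro - ⟨w, rfl⟩
    refine chain_induction (p := fun w => φ (d ℚ 1 w) = 0) w (by simp) (fun a b ha hb => ?_)
      fun r σ => ?_
    · rw [map_add, map_add, ha, hb, add_zero]
    · rw [map_smul, map_smul, d_of]
      have hp : PathConnectedSpace (Splx 2) :=
        isPathConnected_iff_pathConnectedSpace.1 ((convex_stdSimplex ℝ (Fin 2)).isPathConnected
          ⟨_, (stdSimplex.vertex (S := ℝ) (0 : Fin 2)).2⟩)
      have hj : Joined (σ (faceMap 0 (stdSimplex.vertex 0))) (σ (faceMap 1 (stdSimplex.vertex 0))) :=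
        (PathConnectedSpace.joined _ _).map (σ : C(Splx 2, Y)).continuous
      have hu : u (σ (faceMap 0 (stdSimplex.vertex 0))) = u (σ (faceMap 1 (stdSimplex.vertex 0))) :=
        if_congr ⟨fun h => h.trans hj, fun h => h.trans hj.symm⟩ rfl rfl
      rw [Fin.sum_univ_two, map_add, map_smul, map_smul]
      simp only [φ, lift_of, ContinuousMap.comp_apply, hu]
      simp
  have hxy : of ℚ (pt x) - of ℚ (pt y) ∈ cyc ℚ (Sing Y) 1 := by
    change d ℚ 0 _ = 0
    rw [map_sub, d_pt, d_pt, sub_self]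
  have h0 := hφ _ (h _ hxy)
  rw [map_sub, lift_of, lift_of] at h0
  change u x - u y = 0 at h0
  by_contra hn
  rw [show u x = 1 from if_pos (Joined.refl x), show u y = 0 from if_neg hn] at h0
  norm_num at h0

variable {X : Type} [TopologicalSpace X] {μ : C(NNReal × X, X)} {ρ : C(X, NNReal)} {x₀ : X}

/-- The one-point compactification of a cone whose vertex is a rationally smooth point is
rationally equivalent to a sphere. -/
theorem IsCone.sameRationalHomotopyType (h : IsCone μ ρ x₀) [T2Space X] [LocallyCompactSpace X]
    {n : ℕ} (hn : 1 ≤ n) (h₀ : ∀ m, m ≠ 2 * n → Subsingleton (relativeCohomology X {x₀}ᶜ m))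
    (h₁ : Nonempty (relativeCohomology X {x₀}ᶜ (2 * n) ≃ₗ[ℚ] ℚ)) :
    SimplyConnectedSpace (OnePoint X) ∧
      SameRationalHomotopyType (TopCat.of (OnePoint X)) (sphere (2 * n)) ∧
      ∀ m : ℕ, Nonempty ((cohomology m).obj (Opposite.op (TopCat.of (OnePoint X))) ≃ₗ[ℚ]
        (cohomology m).obj (Opposite.op (sphere (2 * n)))) := by
  have hX : ∀ k, Acyc ℚ X k := fun k => by
    have := h.contractibleSpace
    exact Acyc.of_contractible k
  -- Together with `hL` this says that the complement of the vertex, and hence the link, has the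
  -- reduced rational homology of a sphere of dimension `2n - 1`.
  have hA : ∀ m, m ≠ 2 * n → Acyc ℚ ({x₀}ᶜ : Set X) m := fun m hm =>
    acyc_of_relativeCohomology_subsingleton hX (h₀ m hm)
  have hL : HomLine ℚ ({x₀}ᶜ : Set X) (2 * n) := homLine_of_relativeCohomology_line hX h₁
  obtain ⟨i, r, hri, hir⟩ := h.exists_equiv_link
  have hri' : (r.comp i).Homotopic (ContinuousMap.id _) := by rw [hri]
  have hA' : ∀ m, m ≠ 2 * n → Acyc ℚ (link ρ) m := fun m hm => Acyc.of_retract hri' (hA m hm)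
  have hL' : HomLine ℚ (link ρ) (2 * n) := HomLine.of_equiv hri' hir hL
  -- An empty link would have nonzero reduced homology in index `0`, which differs from `2 * n`.
  have hne : Nonempty (link ρ) := by
    by_contra he
    rw [not_nonempty_iff] at he
    obtain ⟨z, hz, hzn, -⟩ := homLine_of_isEmpty (R := ℚ) (Y := link ρ)
    exact hzn (hA' 0 (by omega) z hz)
  -- Index `1` is degree zero, and `1 ≠ 2 * n` by parity.
  have hpc : PathConnectedSpace (link ρ) := pathConnectedSpace_of_acyc (hA' 1 (by omega))
  have hc := h.compactSpace_link
  obtain ⟨θ, hθ, -⟩ := h.exists_isSusp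
  have hsc : SimplyConnectedSpace (OnePoint X) := hθ.simplyConnectedSpace
  obtain ⟨k, rfl⟩ : ∃ k, n = k + 1 := ⟨n - 1, by omega⟩
  have hsc' : SimplyConnectedSpace (sphere (2 * (k + 1))) := simplyConnectedSpace_sphere (2 * k)
  obtain ⟨f, hf⟩ := hθ.exists_sphere_map (d := 2 * (k + 1)) (by omega) (hθ.homLine hL')
    fun m hm => by
      cases m with
      | zero => exact acyc_zero
      | succ m => exact hθ.acyc (hA' m (by omega))
  refine ⟨hsc, ⟨hsc, hsc', Relation.EqvGen.symm _ _ (Relation.EqvGen.rel _ _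
    ⟨hsc', hsc, TopCat.ofHom f, hf⟩)⟩, fun m => ?_⟩
  have := hf m
  exact ⟨(asIso ((cohomology m).map (TopCat.ofHom f).op)).toLinearEquiv⟩

end

end

section

/-! ### Euclidean neighbourhoods are Zariski dense -/

section
open Polynomial

/-- Up to sign the constant coefficient is the product of the roots, so not all of them can have
norm at least `δ`. -/
lemma exists_root_norm_lt {p : ℂ[X]} (hp : p.Monic) {δ : ℝ} (hδ : 0 ≤ δ)
    (h : ‖p.coeff 0‖ < δ ^ p.natDegree) : ∃ r, p.eval r = 0 ∧ ‖r‖ < δ := by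
  by_contra! hr
  have hs : p.Splits := IsAlgClosed.splits p
  have h1 : ∀ m : Multiset ℂ, (∀ r ∈ m, δ ≤ ‖r‖) → δ ^ Multiset.card m ≤ ‖m.prod‖ := by
    intro m
    induction m using Multiset.induction_on with
    | empty => simp
    | cons a m ih =>
      intro hm
      rw [Multiset.card_cons, Multiset.prod_cons, norm_mul, pow_succ']
      exact mul_le_mul (hm a (Multiset.mem_cons_self a m))
        (ih fun r hr => hm r (Multiset.mem_cons_of_mem hr)) (pow_nonneg hδ _) (norm_nonneg _)
  have h2 := h1 p.roots fun r hr' => hr r (mem_roots'.1 hr').2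
  rw [hs.coeff_zero_eq_prod_roots_of_monic hp, norm_mul, norm_pow, norm_neg, norm_one, one_pow,
    one_mul, hs.natDegree_eq_card_roots] at h
  linarith

lemma algHom_bijective_of_maximal {A : Type} [CommRing A] [Algebra ℂ A] [Algebra.FiniteType ℂ A]
    (Q : Ideal A) [Q.IsMaximal] : Function.Bijective (algebraMap ℂ (A ⧸ Q)) := by
  let _ := Ideal.Quotient.field Q
  have : Module.Finite ℂ (A ⧸ Q) := finite_of_finite_type_of_isJacobsonRing ℂ (A ⧸ Q)
  exact IsAlgClosed.algebraMap_bijective_of_isIntegral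

/-- The minimal polynomial of an element `u` of an integral extension of a polynomial ring describes
the values of `u` at the points over a given point. -/
lemma exists_monic_lifting {s : ℕ} {A : Type} [CommRing A] [IsDomain A] [Algebra ℂ A]
    [Algebra.FiniteType ℂ A] (φ : MvPolynomial (Fin s) ℂ →ₐ[ℂ] A) (hφ : Function.Injective φ)
    (hint : φ.IsIntegral) (u : A) :
    ∃ P : (MvPolynomial (Fin s) ℂ)[X], P.Monic ∧ P.eval₂ φ.toRingHom u = 0 ∧
      ∀ (w : Fin s → ℂ) (r : ℂ), (P.map (MvPolynomial.eval w)).eval r = 0 →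
        ∃ ψ : A →ₐ[ℂ] ℂ, (∀ q, ψ (φ q) = MvPolynomial.eval w q) ∧ ψ u = r := by
  let _ : Algebra (MvPolynomial (Fin s) ℂ) A := φ.toRingHom.toAlgebra
  have hZ : Algebra.IsIntegral (MvPolynomial (Fin s) ℂ) A := ⟨hint⟩
  have hinj : Function.Injective (algebraMap (MvPolynomial (Fin s) ℂ) A) := hφ
  have htf : Module.IsTorsionFree (MvPolynomial (Fin s) ℂ) A :=
    Module.isTorsionFree_iff_algebraMap_injective.2 hinj
  have hu := Algebra.IsIntegral.isIntegral (R := MvPolynomial (Fin s) ℂ) u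
  refine ⟨minpoly _ u, minpoly.monic hu, minpoly.aeval _ u, fun w r hr => ?_⟩
  let Ψ : (MvPolynomial (Fin s) ℂ)[X] →+* A := (aeval u).toRingHom
  let e : (MvPolynomial (Fin s) ℂ)[X] →+* ℂ := eval₂RingHom (MvPolynomial.eval w) r
  have he : Function.Surjective e := fun c => ⟨C (MvPolynomial.C c), by simp [e]⟩
  -- A polynomial ring over a field is integrally closed, so the minimal polynomial of `u` divides
  -- every polynomial relation of `u`. Since it vanishes at `(w, r)`, all these relations do.
  have hker : RingHom.ker Ψ ≤ RingHom.ker e := by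
    intro p hp
    obtain ⟨q, rfl⟩ := minpoly.isIntegrallyClosed_dvd hu (RingHom.mem_ker.1 hp)
    rw [RingHom.mem_ker, map_mul]
    have : e (minpoly _ u) = 0 := by rw [← hr, Polynomial.eval_map]; rfl
    rw [this, zero_mul]
  have hmax : (RingHom.ker e).IsMaximal := RingHom.ker_isMaximal_of_surjective e he
  let _ : Algebra (MvPolynomial (Fin s) ℂ)[X] A := Ψ.toAlgebra
  have htower : IsScalarTower (MvPolynomial (Fin s) ℂ) (MvPolynomial (Fin s) ℂ)[X] A :=
    IsScalarTower.of_algebraMap_eq fun x => by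
      change _ = aeval u (C x)
      rw [aeval_C]
  have hI : Algebra.IsIntegral (MvPolynomial (Fin s) ℂ)[X] A := Algebra.IsIntegral.tower_top
    (MvPolynomial (Fin s) ℂ)
  -- Lying over gives a maximal ideal of `A` above the point `(w, r)`, and by the Nullstellensatz
  -- its residue field is `ℂ`.
  obtain ⟨Q, hQ, hQe⟩ := Ideal.exists_ideal_over_maximal_of_isIntegral (S := A) (RingHom.ker e) hker
  let E : ℂ ≃ₐ[ℂ] A ⧸ Q := AlgEquiv.ofBijective (Algebra.ofId ℂ (A ⧸ Q))
    (algHom_bijective_of_maximal Q)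
  let ψ : A →ₐ[ℂ] ℂ := E.symm.toAlgHom.comp (Ideal.Quotient.mkₐ ℂ Q)
  have key : ∀ p, ψ (Ψ p) = e p := fun p => by
    have h1 : p - C (MvPolynomial.C (e p)) ∈ RingHom.ker e := by
      rw [RingHom.mem_ker, map_sub]
      simp [e]
    rw [← hQe] at h1
    have h2 : ψ (Ψ (p - C (MvPolynomial.C (e p)))) = 0 := by
      change E.symm (Ideal.Quotient.mk Q (Ψ _)) = 0
      rw [Ideal.Quotient.eq_zero_iff_mem.2 (show Ψ _ ∈ Q from h1), map_zero]
    have h3 : Ψ (C (MvPolynomial.C (e p))) = algebraMap ℂ A (e p) := by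
      change aeval u (C (MvPolynomial.C (e p))) = _
      rw [aeval_C]
      exact φ.commutes _
    rw [map_sub, map_sub, h3, AlgHom.commutes, sub_eq_zero] at h2
    exact h2
  refine ⟨ψ, fun q => ?_, ?_⟩
  · have := key (C q)
    rwa [show Ψ (C q) = φ q from aeval_C u q, show e (C q) = MvPolynomial.eval w q from
      eval₂_C _ _] at this
  · have := key X
    rwa [show Ψ X = u from aeval_X u, show e X = r from eval₂_X _ _] at this

end

end

/-! ### Regular functions and the identity theorem on an irreducible variety -/

section

section
variable {N : ℕ} {X : Set (Fin N → ℂ)}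

/-- The coordinate ring. -/
abbrev CoordRing (X : Set (Fin N → ℂ)) : Type :=
  MvPolynomial (Fin N) ℂ ⧸ MvPolynomial.vanishingIdeal ℂ X

/-- Evaluation at a point. -/
def evalAt (x : X) : CoordRing X →ₐ[ℂ] ℂ :=
  Ideal.Quotient.liftₐ _ (MvPolynomial.aeval x.1) fun _ hp => hp x.1 x.2

lemma evalAt_mk (x : X) (p : MvPolynomial (Fin N) ℂ) :
    evalAt x (Ideal.Quotient.mk _ p) = MvPolynomial.eval x.1 p := rfl

lemma continuous_evalAt (a : CoordRing X) : Continuous fun x : X => evalAt x a := by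
  obtain ⟨p, rfl⟩ := Ideal.Quotient.mk_surjective a
  exact (MvPolynomial.continuous_eval p).comp continuous_subtype_val

lemma exists_eq_evalAt (hX : IsIrreducibleAffineVariety X) (ψ : CoordRing X →ₐ[ℂ] ℂ) :
    ∃ x : X, ψ = evalAt x := by
  let y : Fin N → ℂ := fun i => ψ (Ideal.Quotient.mk _ (MvPolynomial.X i))
  have key : ∀ p, ψ (Ideal.Quotient.mk _ p) = MvPolynomial.aeval y p := fun p => by
    have : ψ.comp (Ideal.Quotient.mkₐ ℂ _) = MvPolynomial.aeval y :=
      MvPolynomial.algHom_ext fun i => by simp [y]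
    exact DFunLike.congr_fun this p
  obtain ⟨J, hJ⟩ := hX.isClosed
  have hy : y ∈ X := by
    rw [hJ]
    intro p hp
    rw [← key, Ideal.Quotient.eq_zero_iff_mem.2, map_zero]
    intro x hx
    rw [hJ] at hx
    exact hx p hp
  refine ⟨⟨y, hy⟩, AlgHom.ext fun a => ?_⟩
  obtain ⟨p, rfl⟩ := Ideal.Quotient.mk_surjective a
  exact key p

lemma isClosed_of_variety (hX : IsIrreducibleAffineVariety X) : IsClosed X := by
  obtain ⟨J, hJ⟩ := hX.isClosed
  have : X = ⋂ p ∈ J, {x | MvPolynomial.eval x p = 0} := by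
    rw [hJ]
    ext x
    simp [MvPolynomial.zeroLocus, MvPolynomial.aeval_eq_eval]
  rw [this]
  exact isClosed_biInter fun p _ => isClosed_eq (MvPolynomial.continuous_eval p) continuous_const

/-- Roots of monic polynomials with bounded coefficients are bounded. -/
lemma exists_root_bound {s : ℕ} (P : Polynomial (MvPolynomial (Fin s) ℂ)) (hP : P.Monic)
    {K : Set (Fin s → ℂ)} (hK : IsCompact K) :
    ∃ B : ℝ, ∀ w ∈ K, ∀ r : ℂ, (P.map (MvPolynomial.eval w)).eval r = 0 → ‖r‖ ≤ B := by
  have h1 : ∀ k, ∃ B : NNReal, ∀ w ∈ K, ‖MvPolynomial.eval w (P.coeff k)‖₊ ≤ B := fun k => by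
    obtain ⟨B, hB⟩ := (hK.image
      ((MvPolynomial.continuous_eval (P.coeff k)).nnnorm)).bddAbove
    exact ⟨B, fun w hw => hB ⟨w, hw, rfl⟩⟩
  choose B hB using h1
  refine ⟨(∑ k ∈ Finset.range P.natDegree, B k) + 1, fun w hw r hr => ?_⟩
  have hm := hP.map (MvPolynomial.eval w)
  have h2 := Polynomial.IsRoot.norm_lt_cauchyBound hm.ne_zero hr
  have h3 : (P.map (MvPolynomial.eval w)).cauchyBound ≤
      (∑ k ∈ Finset.range P.natDegree, B k) + 1 := by
    rw [Polynomial.cauchyBound, hm.leadingCoeff, nnnorm_one, div_one, hP.natDegree_map]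
    refine add_le_add_left (Finset.sup_le fun k hk => ?_) 1
    rw [Polynomial.coeff_map]
    exact (hB k w hw).trans (Finset.single_le_sum (f := B) (fun _ _ => zero_le) hk)
  exact_mod_cast (h2.le.trans h3)

/-- For each `y ≠ x₀` an affine function in one coordinate is `1` at `x₀` and `0` at `y`. One minus
the product of these functions vanishes at `x₀` and is `1` at the other points of `F`. -/
lemma exists_separating {F : Set (Fin N → ℂ)} (hF : F.Finite) (x₀ : Fin N → ℂ) :
    ∃ p : MvPolynomial (Fin N) ℂ, MvPolynomial.eval x₀ p = 0 ∧
      ∀ y ∈ F, MvPolynomial.eval y p = 0 → y = x₀ := by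
  have h1 : ∀ y : Fin N → ℂ, ∃ q : MvPolynomial (Fin N) ℂ, y ≠ x₀ →
      MvPolynomial.eval x₀ q = 1 ∧ MvPolynomial.eval y q = 0 := fun y => by
    by_cases hy : y = x₀
    · exact ⟨0, fun h => (h hy).elim⟩
    · obtain ⟨i, hi⟩ := Function.ne_iff.1 hy
      refine ⟨MvPolynomial.C (x₀ i - y i)⁻¹ * (MvPolynomial.X i - MvPolynomial.C (y i)),
        fun _ => ⟨?_, ?_⟩⟩
      · simp [inv_mul_cancel₀ (sub_ne_zero.2 (Ne.symm hi))]
      · simp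
  choose q hq using h1
  classical
  refine ⟨1 - ∏ y ∈ hF.toFinset.erase x₀, q y, ?_, fun y hy h => ?_⟩
  · rw [map_sub, map_one, map_prod, Finset.prod_eq_one, sub_self]
    exact fun y hy => (hq y (Finset.ne_of_mem_erase hy)).1
  · by_contra hne
    rw [map_sub, map_one, map_prod, Finset.prod_eq_zero (i := y), sub_zero] at h
    · exact one_ne_zero h
    · exact Finset.mem_erase.2 ⟨hne, hF.mem_toFinset.2 hy⟩
    · exact (hq y hne).2

/-- On the line from `w₀` to a point where `h` is nonzero, `h` restricts to a nonzero polynomial in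
one variable, which has finitely many roots. -/
lemma eventually_ne_zero_on_line {s : ℕ} {h : MvPolynomial (Fin s) ℂ} (h0 : h ≠ 0)
    (w₀ : Fin s → ℂ) : ∃ v : Fin s → ℂ, ∀ᶠ t in 𝓝[≠] (0 : ℂ),
      MvPolynomial.eval (w₀ + t • v) h ≠ 0 := by
  obtain ⟨w, hw⟩ : ∃ w, MvPolynomial.eval w h ≠ 0 := by
    by_contra! hw
    exact h0 (MvPolynomial.funext fun w => by rw [hw, map_zero])
  let q : Polynomial ℂ := MvPolynomial.aeval
    (fun i => Polynomial.C (w₀ i) + Polynomial.X * Polynomial.C (w i - w₀ i)) h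
  have hq : ∀ t, q.eval t = MvPolynomial.eval (w₀ + t • (w - w₀)) h := fun t => by
    have : (Polynomial.aeval t).comp (MvPolynomial.aeval (R := ℂ)
        (fun i => Polynomial.C (w₀ i) + Polynomial.X * Polynomial.C (w i - w₀ i))) =
        MvPolynomial.aeval (w₀ + t • (w - w₀)) := MvPolynomial.algHom_ext fun i => by simp
    have := DFunLike.congr_fun this h
    simpa [q, MvPolynomial.aeval_eq_eval] using this
  have hq0 : q ≠ 0 := fun e => hw (by
    have := hq 1
    rw [e, Polynomial.eval_zero, one_smul, add_sub_cancel] at this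
    exact this.symm)
  refine ⟨w - w₀, ?_⟩
  have hfin : {t | q.eval t = 0}.Finite := by
    refine (q.roots.toFinset.finite_toSet).subset fun t ht => ?_
    simpa [hq0] using ht
  have := hfin.isClosed.isOpen_compl
  have h2 : ((fun t => t) ⁻¹' ({t | q.eval t = 0} \ {0})ᶜ) ∈ 𝓝 (0 : ℂ) :=
    (hfin.subset Set.sdiff_subset).isClosed.isOpen_compl.mem_nhds (by simp)
  filter_upwards [nhdsWithin_le_nhds h2, self_mem_nhdsWithin] with t ht ht0
  rw [← hq]
  exact fun e => ht ⟨e, ht0⟩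

/-- A regular function on an irreducible variety which vanishes near a point vanishes. -/
theorem eq_zero_of_eventually (hX : IsIrreducibleAffineVariety X) (x₀ : X) (g : CoordRing X)
    (hg : ∀ᶠ x in 𝓝 x₀, evalAt x g = 0) : g = 0 := by
  have hprime := hX.isPrime
  by_contra hg0
  -- Noether normalization. If `g ≠ 0`, some multiple of `g` is a nonzero polynomial `h` on the
  -- base. The aim is a point of `X` close to `x₀`, where `g` vanishes, lying over a base point
  -- where `h` does not; this is a weak form of openness of the finite projection.
  obtain ⟨s, -, φ, hφ, hint⟩ := exists_integral_inj_algHom_of_quotient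
    (MvPolynomial.vanishingIdeal ℂ X) hprime.ne_top
  -- the finite projection
  let z : X → Fin s → ℂ := fun x j => evalAt x (φ (MvPolynomial.X j))
  have hzc : Continuous z := continuous_pi fun j => continuous_evalAt _
  have hz : ∀ x q, evalAt x (φ q) = MvPolynomial.eval (z x) q := fun x q => by
    have : (evalAt x).comp φ = MvPolynomial.aeval (z x) :=
      MvPolynomial.algHom_ext fun j => by simp [z]
    exact DFunLike.congr_fun this q
  have hroot : ∀ (P : Polynomial (MvPolynomial (Fin s) ℂ)) (u : CoordRing X),
      P.eval₂ φ.toRingHom u = 0 → ∀ x, (P.map (MvPolynomial.eval (z x))).eval (evalAt x u) = 0 := by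
    intro P u hP x
    have h1 := congrArg (evalAt x) hP
    rw [map_zero] at h1
    rw [Polynomial.eval_map, ← h1]
    change _ = (evalAt x).toRingHom _
    rw [Polynomial.hom_eval₂]
    congr 1
    exact RingHom.ext fun q => (hz x q).symm
  -- a nonzero multiple of `g` in the base
  obtain ⟨h, hh0, a, ha⟩ : ∃ h : MvPolynomial (Fin s) ℂ, h ≠ 0 ∧ ∃ a, φ h = g * a := by
    let _ : Algebra (MvPolynomial (Fin s) ℂ) (CoordRing X) := φ.toRingHom.toAlgebra
    have hgi : IsIntegral (MvPolynomial (Fin s) ℂ) g := hint g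
    have : Nontrivial (MvPolynomial (Fin s) ℂ) := inferInstance
    obtain ⟨h, hh, a, ha⟩ := hgi.isAlgebraic.exists_nonzero_dvd (mem_nonZeroDivisors_of_ne_zero hg0)
    exact ⟨h, hh, a, ha⟩
  -- properness
  have hcoord : ∀ i, ∃ P : Polynomial (MvPolynomial (Fin s) ℂ), P.Monic ∧
      P.eval₂ φ.toRingHom (Ideal.Quotient.mk _ (MvPolynomial.X i)) = 0 := fun i => hint _
  choose Q hQm hQ using hcoord
  have hQx : ∀ x : X, ∀ i, ((Q i).map (MvPolynomial.eval (z x))).eval (x.1 i) = 0 := fun x i => by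
    have := hroot _ _ (hQ i) x
    rwa [evalAt_mk, MvPolynomial.eval_X] at this
  have hXc := isClosed_of_variety hX
  have hproper : ∀ K : Set (Fin s → ℂ), IsCompact K → IsCompact (z ⁻¹' K) := by
    intro K hK
    have hb := fun i => exists_root_bound (Q i) (hQm i) hK
    choose B hB using hb
    have hcl : IsClosed (Subtype.val '' (z ⁻¹' K)) :=
      hXc.isClosedEmbedding_subtypeVal.isClosedMap _ (hK.isClosed.preimage hzc)
    have hsub : Subtype.val '' (z ⁻¹' K) ⊆ Set.univ.pi fun i => Metric.closedBall (0 : ℂ) (B i) := by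
      rintro - ⟨x, hx, rfl⟩ i -
      rw [mem_closedBall_zero_iff]
      exact hB i _ hx _ (hQx x i)
    exact hXc.isClosedEmbedding_subtypeVal.isInducing.isCompact_iff.2
      ((isCompact_univ_pi fun i => isCompact_closedBall _ _).of_isClosed_subset hcl hsub)
  -- the fibre through the point
  have hfin : (Subtype.val '' (z ⁻¹' {z x₀})).Finite := by
    refine (Set.Finite.pi' (t := fun i => {r | ((Q i).map (MvPolynomial.eval (z x₀))).eval r = 0})
      fun i => ?_).subset ?_
    · refine (((Q i).map (MvPolynomial.eval (z x₀))).roots.toFinset.finite_toSet).subset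
        fun r hr => ?_
      simpa [((hQm i).map (MvPolynomial.eval (z x₀))).ne_zero] using hr
    · rintro - ⟨x, hx, rfl⟩ i
      rw [← show z x = z x₀ from hx]
      exact hQx x i
  -- `U` separates `x₀` from the rest of its fibre. By properness a point is then close to `x₀` as
  -- soon as its image in the base is close to `z x₀` and its value of `U` is small.
  obtain ⟨U, hU0, hU⟩ := exists_separating hfin x₀.1
  obtain ⟨P, hPm, hPu, hP⟩ := exists_monic_lifting φ hφ hint (Ideal.Quotient.mk _ U)
  have hc0 : MvPolynomial.eval (z x₀) (P.coeff 0) = 0 := by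
    have := hroot P _ hPu x₀
    rw [evalAt_mk, hU0, ← Polynomial.coeff_zero_eq_eval_zero, Polynomial.coeff_map] at this
    exact this
  -- points outside the neighbourhood stay away
  obtain ⟨W, hWg, hWo, hxW⟩ := eventually_nhds_iff.1 hg
  let m : X → ℝ := fun x => dist (z x) (z x₀) + ‖MvPolynomial.eval x.1 U‖
  have hmc : Continuous m := (hzc.dist continuous_const).add
    ((MvPolynomial.continuous_eval U).comp continuous_subtype_val).norm
  have hm0 : ∀ x, m x = 0 → x = x₀ := fun x hx => by
    have h1 : dist (z x) (z x₀) = 0 := by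
      have := dist_nonneg (x := z x) (y := z x₀)
      have := norm_nonneg (MvPolynomial.eval x.1 U)
      simp only [m] at hx
      linarith
    have h2 : ‖MvPolynomial.eval x.1 U‖ = 0 := by
      simp only [m] at hx
      linarith
    exact Subtype.ext (hU _ ⟨x, dist_eq_zero.1 h1, rfl⟩ (norm_eq_zero.1 h2))
  obtain ⟨ε, hε0, hε⟩ : ∃ ε > 0, ∀ x, dist (z x) (z x₀) ≤ 1 → m x < ε → x ∈ W := by
    have hK : IsCompact (z ⁻¹' Metric.closedBall (z x₀) 1 ∩ Wᶜ) :=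
      (hproper _ (isCompact_closedBall _ _)).inter_right hWo.isClosed_compl
    rcases (z ⁻¹' Metric.closedBall (z x₀) 1 ∩ Wᶜ).eq_empty_or_nonempty with he | he
    · refine ⟨1, one_pos, fun x hx _ => by_contra fun hxW' => ?_⟩
      have : x ∈ z ⁻¹' Metric.closedBall (z x₀) 1 ∩ Wᶜ := ⟨hx, hxW'⟩
      rw [he] at this
      exact this
    · obtain ⟨y, hy, hmin⟩ := hK.exists_isMinOn he hmc.continuousOn
      refine ⟨m y, lt_of_le_of_ne (by positivity) fun e => hy.2 (hm0 y e.symm ▸ hxW),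
        fun x hx hlt => by_contra fun hxW' => ?_⟩
      exact absurd hlt (not_lt.2 (hmin ⟨hx, hxW'⟩))
  -- a nearby point of the base
  obtain ⟨v, hv⟩ := eventually_ne_zero_on_line hh0 (z x₀)
  have hline : Continuous fun t : ℂ => z x₀ + t • v := by fun_prop
  have h1 : ∀ᶠ t in 𝓝 (0 : ℂ), dist (z x₀ + t • v) (z x₀) < min 1 (ε / 2) := by
    have : Continuous fun t : ℂ => dist (z x₀ + t • v) (z x₀) := hline.dist continuous_const
    refine this.continuousAt.eventually_lt continuousAt_const ?_
    simp [hε0]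
  have h2 : ∀ᶠ t in 𝓝 (0 : ℂ),
      ‖MvPolynomial.eval (z x₀ + t • v) (P.coeff 0)‖ < (ε / 2) ^ P.natDegree := by
    have : Continuous fun t : ℂ => ‖MvPolynomial.eval (z x₀ + t • v) (P.coeff 0)‖ :=
      ((MvPolynomial.continuous_eval _).comp hline).norm
    refine this.continuousAt.eventually_lt continuousAt_const ?_
    rw [zero_smul, add_zero, hc0, norm_zero]
    positivity
  obtain ⟨t, ⟨ht1, ht2⟩, ht3⟩ := (((h1.and h2).filter_mono nhdsWithin_le_nhds).and hv).exists
  set w := z x₀ + t • v with hw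
  -- The constant coefficient of `P` vanishes at `z x₀`. So over the nearby point `w` the polynomial
  -- has a small root, which lifts to a point `y` over `w` with a small value of `U`.
  obtain ⟨r, hr, hrε⟩ := exists_root_norm_lt (hPm.map (MvPolynomial.eval w)) (half_pos hε0).le
    (by rwa [Polynomial.coeff_map, hPm.natDegree_map])
  obtain ⟨ψ, hψ, hψu⟩ := hP w r hr
  obtain ⟨y, rfl⟩ := exists_eq_evalAt hX ψ
  have hzy : z y = w := funext fun j => by
    change evalAt y (φ (MvPolynomial.X j)) = _
    rw [hψ, MvPolynomial.eval_X]
  have hyW : y ∈ W := by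
    refine hε y ?_ ?_
    · rw [hzy]
      exact (ht1.trans_le (min_le_left _ _)).le
    · change dist (z y) (z x₀) + ‖evalAt y (Ideal.Quotient.mk _ U)‖ < ε
      rw [hzy, hψu]
      have := ht1.trans_le (min_le_right 1 (ε / 2))
      linarith
  have := congrArg (evalAt y) ha
  rw [hψ, map_mul, hWg y hyW, zero_mul] at this
  exact ht3 this

end

end

section

/-! ### Laurent expansions -/

section

/-- The filter of the units approaching zero. -/
abbrev unitsNhdsZero : Filter ℂˣ := Filter.comap (fun t : ℂˣ => (t : ℂ)) (𝓝 0)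

instance : unitsNhdsZero.NeBot := Filter.comap_neBot fun s hs => by
  have : ∃ᶠ t in 𝓝[≠] (0 : ℂ), t ∈ s :=
    (Filter.Eventually.filter_mono nhdsWithin_le_nhds hs).frequently
  obtain ⟨t, hts, ht0⟩ := (this.and_eventually self_mem_nhdsWithin).exists
  exact ⟨Units.mk0 t ht0, hts⟩

lemma tendsto_lowest {S : Finset ℤ} {c : ℤ → ℂ} {k₀ : ℤ} (hk₀ : k₀ ∈ S)
    (h : ∀ k ∈ S, k < k₀ → c k = 0) :
    Filter.Tendsto (fun t : ℂˣ => ∑ k ∈ S, c k * (t : ℂ) ^ (k - k₀)) unitsNhdsZero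
      (𝓝 (c k₀)) := by
  have h1 : c k₀ = ∑ k ∈ S, if k = k₀ then c k else 0 := by simp [hk₀]
  rw [h1]
  refine tendsto_finsetSum _ fun k hk => ?_
  rcases lt_trichotomy k k₀ with hlt | rfl | hlt
  · simp [h k hk hlt]
  · simp
  · rw [if_neg hlt.ne']
    obtain ⟨j, hj⟩ : ∃ j : ℕ, k - k₀ = j + 1 := ⟨(k - k₀ - 1).toNat, by omega⟩
    have h2 : Filter.Tendsto (fun t : ℂˣ => (t : ℂ)) unitsNhdsZero (𝓝 0) := Filter.tendsto_comap
    have h3 := (h2.pow (j + 1)).const_mul (c k)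
    rw [zero_pow (Nat.succ_ne_zero j), mul_zero] at h3
    refine h3.congr fun t => ?_
    rw [hj]
    norm_cast

/-- If `k₀ < 0` were the lowest exponent with a nonzero coefficient, the sum multiplied by `t ^
(-k₀)` would tend both to `c k₀` and to `0`. -/
lemma coeff_eq_zero_of_tendsto {S : Finset ℤ} {c : ℤ → ℂ} {L : ℂ}
    (h : Filter.Tendsto (fun t : ℂˣ => ∑ k ∈ S, c k * (t : ℂ) ^ k) unitsNhdsZero (𝓝 L)) :
    ∀ k ∈ S, k < 0 → c k = 0 := by
  by_contra! hcon
  obtain ⟨k, hk, hk0, hck⟩ := hcon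
  let S' := S.filter fun k => k < 0 ∧ c k ≠ 0
  have hne : S'.Nonempty := ⟨k, Finset.mem_filter.2 ⟨hk, hk0, hck⟩⟩
  obtain ⟨h1, h2, h3⟩ := Finset.mem_filter.1 (S'.min'_mem hne)
  set k₀ := S'.min' hne
  have h4 := tendsto_lowest (S := S) (c := c) h1 fun j hj hjk => by
    by_contra hcj
    exact absurd (S'.min'_le j (Finset.mem_filter.2 ⟨hj, hjk.trans h2, hcj⟩)) (not_le.2 hjk)
  obtain ⟨j, hj⟩ : ∃ j : ℕ, -k₀ = j + 1 := ⟨(-k₀ - 1).toNat, by omega⟩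
  have h5 : Filter.Tendsto (fun t : ℂˣ => (t : ℂ)) unitsNhdsZero (𝓝 0) := Filter.tendsto_comap
  have h6 := (h5.pow (j + 1)).mul h
  rw [zero_pow (Nat.succ_ne_zero j), zero_mul] at h6
  refine h3 (tendsto_nhds_unique (h4.congr fun t => ?_) h6)
  rw [Finset.mul_sum]
  refine Finset.sum_congr rfl fun k _ => ?_
  rw [sub_eq_add_neg, zpow_add₀ t.ne_zero, hj, ← Nat.cast_succ, zpow_natCast,
    Nat.succ_eq_add_one]
  ring

lemma coeff_zero_of_tendsto {S : Finset ℤ} (h0 : (0 : ℤ) ∈ S) {c : ℤ → ℂ} {L : ℂ}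
    (h : Filter.Tendsto (fun t : ℂˣ => ∑ k ∈ S, c k * (t : ℂ) ^ k) unitsNhdsZero (𝓝 L)) :
    c 0 = L :=
  tendsto_nhds_unique (by simpa using tendsto_lowest h0 (coeff_eq_zero_of_tendsto h)) h

lemma coeff_eq_of_forall {S : Finset ℤ} {c c' : ℤ → ℂ}
    (h : ∀ t : ℂˣ, ∑ k ∈ S, c k * (t : ℂ) ^ k = ∑ k ∈ S, c' k * (t : ℂ) ^ k) :
    ∀ k ∈ S, c k = c' k := by
  by_contra! hcon
  obtain ⟨k, hk, hck⟩ := hcon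
  let S' := S.filter fun k => c k ≠ c' k
  have hne : S'.Nonempty := ⟨k, Finset.mem_filter.2 ⟨hk, hck⟩⟩
  obtain ⟨h1, h2⟩ := Finset.mem_filter.1 (S'.min'_mem hne)
  set k₀ := S'.min' hne
  have h4 := tendsto_lowest (S := S) (c := fun k => c k - c' k) h1 fun j hj hjk => by
    by_contra hcj
    exact absurd (S'.min'_le j (Finset.mem_filter.2 ⟨hj, sub_ne_zero.1 hcj⟩)) (not_le.2 hjk)
  refine h2 (sub_eq_zero.1 (tendsto_nhds_unique (h4.congr fun t => ?_) tendsto_const_nhds))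
  have h5 : ∑ k ∈ S, (c k - c' k) * (t : ℂ) ^ (k - k₀) =
      (∑ k ∈ S, c k * (t : ℂ) ^ k - ∑ k ∈ S, c' k * (t : ℂ) ^ k) * (t : ℂ) ^ (-k₀) := by
    rw [← Finset.sum_sub_distrib, Finset.sum_mul]
    refine Finset.sum_congr rfl fun k _ => ?_
    rw [sub_eq_add_neg k, zpow_add₀ t.ne_zero]
    ring
  rw [h5, h t, sub_self, zero_mul]

lemma exists_eval₂_eq_sum {R : Type} [CommRing R] (p : LaurentPolynomial R) :
    ∃ f : ℤ →₀ R, ∀ (g : R →+* ℂ) (t : ℂˣ),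
      LaurentPolynomial.eval₂ g t p = f.sum fun k c => g c * (t : ℂ) ^ k := by
  induction p using LaurentPolynomial.induction_on' with
  | add p q hp hq =>
    obtain ⟨f, hf⟩ := hp
    obtain ⟨f', hf'⟩ := hq
    refine ⟨f + f', fun g t => ?_⟩
    rw [map_add, hf, hf', Finsupp.sum_add_index' (by simp) (by intros; rw [map_add, add_mul])]
  | C_mul_T n a =>
    refine ⟨Finsupp.single n a, fun g t => ?_⟩
    rw [LaurentPolynomial.eval₂_C_mul_T, Finsupp.sum_single_index (by simp)]
    simp

variable {N r : ℕ} {X : Set (Fin N → ℂ)} [MulAction (Fin r → ℂˣ) X]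

lemma exists_expansion (h : IsAlgebraicAction r X) (a : Fin r → ℤ) :
    ∃ (S : Finset ℤ) (f : Fin N → ℤ → MvPolynomial (Fin N) ℂ), 0 ∈ S ∧ ∀ (t : ℂˣ) (x : X) (i : Fin N),
      (oneParameterSubgroup a t • x : X).1 i =
        ∑ k ∈ S, MvPolynomial.eval x.1 (f i k) * (t : ℂ) ^ k := by
  choose P hP using h
  let T := LaurentPolynomial (MvPolynomial (Fin N) ℂ)
  let Φ : MvPolynomial ((Fin r ⊕ Fin r) ⊕ Fin N) ℂ →ₐ[ℂ] T := MvPolynomial.aeval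
    (Sum.elim (Sum.elim (fun j => LaurentPolynomial.T (a j)) fun j => LaurentPolynomial.T (-(a j)))
      fun i => LaurentPolynomial.C (MvPolynomial.X i))
  choose f hf using fun i => exists_eval₂_eq_sum (Φ (P i))
  refine ⟨insert 0 (Finset.univ.biUnion fun i => (f i).support), fun i k => f i k,
    Finset.mem_insert_self _ _, fun t x i => ?_⟩
  have h1 : (LaurentPolynomial.eval₂ (MvPolynomial.eval x.1) t).comp Φ.toRingHom =
      MvPolynomial.eval (Sum.elim (Sum.elim (fun j => (oneParameterSubgroup a t j : ℂ))
        (fun j => ((oneParameterSubgroup a t j)⁻¹ : ℂˣ).val)) x.1) := by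
    refine MvPolynomial.ringHom_ext (fun c => ?_) fun i => ?_
    · have : Φ (MvPolynomial.C c) = LaurentPolynomial.C (MvPolynomial.C c) :=
        Φ.commutes c
      simp only [RingHom.comp_apply, AlgHom.toRingHom_eq_coe, RingHom.coe_coe, this,
        LaurentPolynomial.eval₂_C, MvPolynomial.eval_C]
    · rcases i with (j | j) | i
      · simp [Φ, LaurentPolynomial.eval₂_T, oneParameterSubgroup]
      · simp only [RingHom.comp_apply, AlgHom.toRingHom_eq_coe, RingHom.coe_coe, Φ,
          MvPolynomial.aeval_X, Sum.elim_inl, Sum.elim_inr, LaurentPolynomial.eval₂_T,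
          MvPolynomial.eval_X]
        simp [oneParameterSubgroup]
      · simp [Φ, LaurentPolynomial.eval₂_C]
  rw [hP, ← h1]
  change LaurentPolynomial.eval₂ (MvPolynomial.eval x.1) t (Φ (P i)) = _
  rw [hf]
  refine Finsupp.sum_of_support_subset _ (fun k hk => ?_) _ (by simp)
  exact Finset.mem_insert_of_mem (Finset.mem_biUnion.2 ⟨i, Finset.mem_univ i, hk⟩)

end

end

section

/-! ### Rational cells are cones -/

section
variable {N r n : ℕ} {X : Set (Fin N → ℂ)} [MulAction (Fin r → ℂˣ) X] {x₀ : X}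

/-- The weight decomposition of the coordinates with respect to an attracting one-parameter
subgroup: all weights are positive. -/
lemma exists_positive_expansion (hX : IsIrreducibleAffineVariety X) (halg : IsAlgebraicAction r X)
    (hatt : IsAttractiveFixedPoint r X x₀) :
    ∃ (a : Fin r → ℤ) (S : Finset ℕ) (f : Fin N → ℕ → MvPolynomial (Fin N) ℂ), (∀ k ∈ S, 1 ≤ k) ∧
      (∀ (t : ℂˣ) (x : X) (i : Fin N), (oneParameterSubgroup a t • x : X).1 i =
        x₀.1 i + ∑ k ∈ S, (t : ℂ) ^ k * MvPolynomial.eval x.1 (f i k)) ∧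
      (∀ (t : ℂˣ) (x : X) (i : Fin N), ∀ k ∈ S,
        MvPolynomial.eval (oneParameterSubgroup a t • x : X).1 (f i k) =
          (t : ℂ) ^ k * MvPolynomial.eval x.1 (f i k)) ∧
      ∀ i, ∀ k ∈ S, MvPolynomial.eval x₀.1 (f i k) = 0 := by
  obtain ⟨hfix, a, ha⟩ := hatt
  obtain ⟨S, f, hS, hf⟩ := exists_expansion halg a
  have hlim : ∀ᶠ y in 𝓝 x₀, ∀ i, Filter.Tendsto
      (fun t : ℂˣ => ∑ k ∈ S, MvPolynomial.eval y.1 (f i k) * (t : ℂ) ^ k) unitsNhdsZero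
      (𝓝 (x₀.1 i)) := by
    filter_upwards [ha] with y hy i
    have h1 := ((continuous_apply i).comp continuous_subtype_val).continuousAt (x := x₀)
      |>.tendsto.comp hy
    refine h1.congr fun t => ?_
    exact hf t y i
  -- The limits are known near `x₀` only. The coefficients of the expansion are regular functions,
  -- so the identity theorem carries their relations over to all of `X`.
  have hvan : ∀ p : MvPolynomial (Fin N) ℂ, (∀ᶠ y in 𝓝 x₀, MvPolynomial.eval y.1 p = 0) →
      ∀ y : X, MvPolynomial.eval y.1 p = 0 := fun p hp y => by
    have := eq_zero_of_eventually hX x₀ (Ideal.Quotient.mk _ p) hp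
    rw [← evalAt_mk, this, map_zero]
  have hneg : ∀ (y : X) i, ∀ k ∈ S, k < 0 → MvPolynomial.eval y.1 (f i k) = 0 :=
    fun y i k hk hk0 => hvan _ (by
      filter_upwards [hlim] with y hy
      exact coeff_eq_zero_of_tendsto (hy i) k hk hk0) y
  have hzero : ∀ (y : X) i, MvPolynomial.eval y.1 (f i 0) = x₀.1 i := fun y i => by
    have := hvan (f i 0 - MvPolynomial.C (x₀.1 i)) (by
      filter_upwards [hlim] with y hy
      rw [map_sub, MvPolynomial.eval_C, sub_eq_zero]
      exact coeff_zero_of_tendsto (c := fun k => MvPolynomial.eval y.1 (f i k)) hS (hy i)) y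
    rwa [map_sub, MvPolynomial.eval_C, sub_eq_zero] at this
  let S' : Finset ℕ := (S.filter (0 < ·)).image Int.toNat
  have hS' : ∀ k ∈ S', 1 ≤ k ∧ (k : ℤ) ∈ S := fun k hk => by
    obtain ⟨j, hj, rfl⟩ := Finset.mem_image.1 hk
    obtain ⟨h1, h2⟩ := Finset.mem_filter.1 hj
    refine ⟨by omega, ?_⟩
    rwa [Int.toNat_of_nonneg h2.le]
  have hsum : ∀ (t : ℂˣ) (x : X) i, (oneParameterSubgroup a t • x : X).1 i =
      x₀.1 i + ∑ k ∈ S', (t : ℂ) ^ k * MvPolynomial.eval x.1 (f i k) := fun t x i => by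
    rw [hf, Finset.sum_image (fun j hj k hk hjk => by
      have h1 := (Finset.mem_filter.1 hj).2
      have h2 := (Finset.mem_filter.1 hk).2
      omega), ← Finset.add_sum_erase _ _ hS, hzero, zpow_zero, mul_one]
    congr 1
    have hsub : S.filter (0 < ·) ⊆ S.erase 0 := fun k hk => by
      obtain ⟨h1, h2⟩ := Finset.mem_filter.1 hk
      exact Finset.mem_erase.2 ⟨h2.ne', h1⟩
    rw [← Finset.sum_subset hsub fun k hk hk' => ?_]
    · refine Finset.sum_congr rfl fun k hk => ?_
      have h2 := (Finset.mem_filter.1 hk).2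
      rw [mul_comm, Int.toNat_of_nonneg h2.le, ← zpow_natCast, Int.toNat_of_nonneg h2.le]
    · obtain ⟨h1, h2⟩ := Finset.mem_erase.1 hk
      have h3 : ¬ 0 < k := fun h => hk' (Finset.mem_filter.2 ⟨h2, h⟩)
      rw [hneg x i k h2 (by omega), zero_mul]
  -- The coordinates of the point moved by `s * t` are expanded in two ways, and the coefficients of
  -- the powers of `s` are compared.
  have hhom : ∀ (t : ℂˣ) (x : X) (i : Fin N), ∀ k ∈ S,
      MvPolynomial.eval (oneParameterSubgroup a t • x : X).1 (f i k) =
        MvPolynomial.eval x.1 (f i k) * (t : ℂ) ^ k := fun t x i => by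
    refine coeff_eq_of_forall fun s => ?_
    rw [← hf, smul_smul, ← map_mul, hf]
    refine Finset.sum_congr rfl fun k _ => ?_
    rw [Units.val_mul, mul_zpow]
    ring
  refine ⟨a, S', fun i k => f i k, fun k hk => (hS' k hk).1, hsum, fun t x i k hk => ?_,
    fun i k hk => ?_⟩
  · rw [hhom t x i k (hS' k hk).2, zpow_natCast, mul_comm]
  -- At the fixed point the value is multiplied by `2 ^ k` and yet unchanged; as `k ≥ 1`, it is
  -- zero.
  · have h1 := hhom (Units.mk0 2 two_ne_zero) x₀ i k (hS' k hk).2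
    rw [hfix, zpow_natCast, Units.val_mk0] at h1
    have h2 : (2 : ℂ) ^ k ≠ 1 := fun e => by
      have h3 := congrArg norm e
      rw [norm_pow, norm_one, RCLike.norm_ofNat] at h3
      exact (one_lt_pow₀ (one_lt_two (α := ℝ)) (Nat.one_le_iff_ne_zero.1 (hS' k hk).1)).ne' h3
    have h3 : MvPolynomial.eval x₀.1 (f i k) * ((2 : ℂ) ^ k - 1) = 0 := by
      rw [mul_sub, ← h1, mul_one, sub_self]
    exact (mul_eq_zero.1 h3).resolve_right (sub_ne_zero.2 h2)

/-- The attracting one-parameter subgroup turns a variety with an attractive fixed point into a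
cone. -/
theorem exists_isCone (hX : IsIrreducibleAffineVariety X) (halg : IsAlgebraicAction r X)
    (hatt : IsAttractiveFixedPoint r X x₀) :
    ∃ (μ : C(NNReal × X, X)) (ρ : C(X, NNReal)), IsCone μ ρ x₀ := by
  obtain ⟨a, S, f, hS, hsum, hhom, hx₀⟩ := exists_positive_expansion hX halg hatt
  have hfix := hatt.1
  -- Because all weights are positive, the formula for the action makes sense and is continuous at
  -- `t = 0`, where it gives `x₀`.
  let F : NNReal × X → (Fin N → ℂ) := fun p i =>
    x₀.1 i + ∑ k ∈ S, ((p.1 : ℝ) : ℂ) ^ k * MvPolynomial.eval p.2.1 (f i k)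
  let unit : ∀ t : NNReal, t ≠ 0 → ℂˣ := fun t ht =>
    Units.mk0 ((t : ℝ) : ℂ) (by exact_mod_cast ht)
  have hF : ∀ (t : NNReal) (ht : t ≠ 0) (x : X),
      F (t, x) = (oneParameterSubgroup a (unit t ht) • x : X).1 := fun t ht x => by
    funext i
    rw [hsum]
    rfl
  have hF0 : ∀ x, F (0, x) = x₀.1 := fun x => by
    funext i
    refine add_eq_left.2 (Finset.sum_eq_zero fun k hk => ?_)
    simp [(Nat.one_le_iff_ne_zero.1 (hS k hk))]
  have hFX : ∀ p, F p ∈ X := fun ⟨t, x⟩ => by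
    by_cases ht : t = 0
    · rw [ht, hF0]; exact x₀.2
    · rw [hF t ht]; exact Subtype.prop _
  have hFc : Continuous F := by
    refine continuous_pi fun i => continuous_const.add (continuous_finsetSum _ fun k _ => ?_)
    have h1 : Continuous fun p : NNReal × X => MvPolynomial.eval p.2.1 (f i k) :=
      (MvPolynomial.continuous_eval _).comp (continuous_subtype_val.comp continuous_snd)
    have h2 : Continuous fun p : NNReal × X => ((p.1 : ℝ) : ℂ) ^ k :=
      (Complex.continuous_ofReal.comp (NNReal.continuous_coe.comp continuous_fst)).pow k
    exact h2.mul h1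
  let μ : C(NNReal × X, X) := ⟨fun p => ⟨F p, hFX p⟩, hFc.subtype_mk _⟩
  have hμ : ∀ (t : NNReal) (ht : t ≠ 0) (x : X),
      μ (t, x) = oneParameterSubgroup a (unit t ht) • x := fun t ht x => Subtype.ext (hF t ht x)
  have hμ0 : ∀ x, μ (0, x) = x₀ := fun x => Subtype.ext (hF0 x)
  have hfμ : ∀ (t : NNReal) (x : X) i, ∀ k ∈ S, MvPolynomial.eval (μ (t, x)).1 (f i k) =
      ((t : ℝ) : ℂ) ^ k * MvPolynomial.eval x.1 (f i k) := fun t x i k hk => by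
    by_cases ht : t = 0
    · rw [ht, hμ0, hx₀ i k hk]
      simp [(Nat.one_le_iff_ne_zero.1 (hS k hk))]
    · rw [hμ t ht, hhom _ _ _ k hk]
      rfl
  -- A weighted norm: the function `f i k` has weight `k`, so the `k`-th root of its absolute value
  -- is homogeneous of degree one.
  let ρ : C(X, NNReal) := ⟨fun x => ∑ i, ∑ k ∈ S, ‖MvPolynomial.eval x.1 (f i k)‖₊ ^ (k : ℝ)⁻¹, by
    refine continuous_finsetSum _ fun i _ => continuous_finsetSum _ fun k _ => ?_
    exact (NNReal.continuous_rpow_const (by positivity)).comp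
      ((MvPolynomial.continuous_eval _).comp continuous_subtype_val).nnnorm⟩
  have hone : ∀ x, μ (1, x) = x := fun x => by
    rw [hμ 1 one_ne_zero, show unit 1 one_ne_zero = 1 from Units.ext (by simp [unit]), map_one,
      one_smul]
  have hexp : ∀ (x : X) i, x.1 i = x₀.1 i + ∑ k ∈ S, MvPolynomial.eval x.1 (f i k) := fun x i => by
    conv_lhs => rw [← hone x]
    change x₀.1 i + ∑ k ∈ S, (((1 : NNReal) : ℝ) : ℂ) ^ k * MvPolynomial.eval x.1 (f i k) = _
    simp
  have hle : ∀ (x : X) i, ∀ k ∈ S, ‖MvPolynomial.eval x.1 (f i k)‖₊ ≤ ρ x ^ k := by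
    intro x i k hk
    have h1 : ‖MvPolynomial.eval x.1 (f i k)‖₊ ^ (k : ℝ)⁻¹ ≤ ρ x :=
      (Finset.single_le_sum (f := fun k => ‖MvPolynomial.eval x.1 (f i k)‖₊ ^ (k : ℝ)⁻¹)
        (fun _ _ => zero_le) hk).trans
      (Finset.single_le_sum
        (f := fun i => ∑ k ∈ S, ‖MvPolynomial.eval x.1 (f i k)‖₊ ^ (k : ℝ)⁻¹)
        (fun _ _ => zero_le) (Finset.mem_univ i))
    calc ‖MvPolynomial.eval x.1 (f i k)‖₊ =
          (‖MvPolynomial.eval x.1 (f i k)‖₊ ^ (k : ℝ)⁻¹) ^ k :=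
          (NNReal.rpow_inv_natCast_pow _ (Nat.one_le_iff_ne_zero.1 (hS k hk))).symm
      _ ≤ ρ x ^ k := pow_le_pow_left₀ zero_le h1 k
  refine ⟨μ, ρ, hone, fun s t x => ?_, hμ0, fun t x => ?_, fun x hx => ?_, fun R => ?_⟩
  · by_cases hs : s = 0
    · rw [hs, zero_mul, hμ0, hμ0]
    · by_cases ht : t = 0
      · rw [ht, mul_zero, hμ0, hμ s hs, hfix]
      · rw [hμ _ (mul_ne_zero hs ht), hμ s hs, hμ t ht, smul_smul, ← map_mul]
        congr 2
        exact Units.ext (by simp [unit])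
  · have hρ : ∀ y, ρ y = ∑ i, ∑ k ∈ S, ‖MvPolynomial.eval y.1 (f i k)‖₊ ^ (k : ℝ)⁻¹ := fun _ => rfl
    rw [hρ, hρ, Finset.mul_sum]
    refine Finset.sum_congr rfl fun i _ => ?_
    rw [Finset.mul_sum]
    refine Finset.sum_congr rfl fun k hk => ?_
    have h1 : ‖((t : ℝ) : ℂ)‖₊ = t := NNReal.eq (by simp)
    rw [hfμ t x i k hk, nnnorm_mul, nnnorm_pow, h1, NNReal.mul_rpow,
      NNReal.pow_rpow_inv_natCast _ (Nat.one_le_iff_ne_zero.1 (hS k hk))]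
  · refine Subtype.ext (funext fun i => ?_)
    rw [hexp]
    refine add_eq_left.2 (Finset.sum_eq_zero fun k hk => ?_)
    have := hle x i k hk
    rw [hx, zero_pow (Nat.one_le_iff_ne_zero.1 (hS k hk))] at this
    exact nnnorm_eq_zero.1 (le_antisymm this zero_le)
  · have hXc := isClosed_of_variety hX
    have hcl : IsClosed (Subtype.val '' (ρ ⁻¹' Set.Iic R)) :=
      hXc.isClosedEmbedding_subtypeVal.isClosedMap _ (isClosed_Iic.preimage ρ.continuous)
    -- A bound on `ρ` bounds every weight component and hence every coordinate. Sublevel sets are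
    -- therefore closed and bounded in the ambient space.
    have hsub : Subtype.val '' (ρ ⁻¹' Set.Iic R) ⊆ Set.univ.pi fun i =>
        Metric.closedBall (x₀.1 i) (∑ k ∈ S, (R : ℝ) ^ k) := by
      rintro - ⟨x, hx, rfl⟩ i -
      rw [mem_closedBall_iff_norm, hexp x i, add_sub_cancel_left]
      refine (norm_sum_le _ _).trans (Finset.sum_le_sum fun k hk => ?_)
      have := (hle x i k hk).trans (pow_le_pow_left₀ zero_le hx k)
      exact_mod_cast this
    exact hXc.isClosedEmbedding_subtypeVal.isInducing.isCompact_iff.2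
      ((isCompact_univ_pi fun i => isCompact_closedBall _ _).of_isClosed_subset hcl hsub)

end

end

end RationalCell

end

/-! ### Conclusion for rational cells -/

theorem proposition3p11 {N r n : ℕ} (X : Set (Fin N → ℂ)) [MulAction (Fin r → ℂˣ) X] (x₀ : X)
    (hn : 1 ≤ n) (hX : RationalCell.IsRationalCell r X x₀ n) :
    SimplyConnectedSpace (OnePoint X) ∧
      RationalCell.SameRationalHomotopyType (TopCat.of (OnePoint X))
        (RationalCell.sphere (2 * n)) ∧
      ∀ m : ℕ, Nonempty
        ((RationalCell.cohomology m).obj (Opposite.op (TopCat.of (OnePoint X))) ≃ₗ[ℚ]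
          (RationalCell.cohomology m).obj (Opposite.op (RationalCell.sphere (2 * n)))) := by
  have hLC : LocallyCompactSpace X :=
    (RationalCell.isClosed_of_variety hX.irreducible).isClosedEmbedding_subtypeVal.locallyCompactSpace
  obtain ⟨μ, ρ, h⟩ := RationalCell.exists_isCone hX.irreducible hX.algebraic hX.attractive
  obtain ⟨h₀, h₁⟩ := hX.rationallySmooth.self_of_nhds
  exact h.sameRationalHomotopyType hn h₀ h₁
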